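/- Let $M^7$ be a connected smooth (Hausdorff, second countable) $7$-manifold with a Riemannian metric $g$ and a $\mathrm{G}_2$-structure $\varphi$, i.e. a smooth $3$-form such that every tangent space $T_pM$ has a $g$-orthonormal basis $e_1,\dots,e_7$ (an adapted frame) in which $$\varphi = e_{127}+e_{135}-e_{146}-e_{236}-e_{245}+e_{347}+e_{567}.$$ Suppose that $(M,g,\varphi)$ is nearly parallel, i.e. $d\varphi=\mu\,{*\varphi}$ for some constant $\mu\in\mathbb{R}$. Let $\nabla^{c}$ be its characteristic connection, i.e. the connection on $TM$ with $\nabla^{c}g=0$, $\nabla^{c}\varphi=0$ whose torsion $\mathrm{T}^{c}(X,Y,Z)=g(T(X,Y),Z)$ is totally skew-symmetric, and suppose that $\mathrm{T}^{c}\neq 0$ (the structure is not parallel). Let $\Delta_7=\mathbb{R}^8$ be the real spin representation of $\mathrm{Spin}(7)$ with the orthonormal basis $\psi_1,\dots,\psi_8$, realized so that $\mathrm{G}_2\subset \mathrm{SO}(7)$ lifts to the isotropy group of $\psi_1$ in $\mathrm{Spin}(7)$, and let $\mathfrak{su}(3)\subset\mathfrak{g}_2\subset\mathfrak{so}(7)$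 be the Lie algebra annihilating both $\psi_1$ and $\psi_2$. Let $S=P\times_{\mathrm{G}_2}\Delta_7$ be the real spinor bundle associated with the bundle $P$ of adapted frames, with the connection induced by $\nabla^{c}$. Then: 1. The holonomy algebra $\mathfrak{hol}(\nabla^{c})$ is not contained in $\mathfrak{su}(3)$: for no point $p\in M$ and no adapted frame of $T_pM$ does the induced identification $T_pM\cong\mathbb{R}^7$ map $\mathfrak{hol}_p(\nabla^{c})\subset\mathrm{End}(T_pM)$ into $\mathfrak{su}(3)$. 2. The $\nabla^{c}$-parallel spinor is unique: there is a non-zero $\nabla^{c}$-parallel section $\Psi$ of $S$, and every $\nabla^{c}$-parallel section of $S$ is a constant real multiple of $\Psi$. -/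

import Mathlib

open Bundle Manifold Topology
open scoped ContDiff

noncomputable section

/-! ### Algebra on `ℝ⁷` and on the spin representation `ℝ⁸` -/

namespace G2

/-- The 3-form `e_{ijk} = e_i ∧ e_j ∧ e_k` on `ℝ⁷` (indices run from `0` to `6`). -/
def elemForm (i j k : Fin 7) (v : Fin 3 → Fin 7 → ℝ) : ℝ :=
  Matrix.det (Matrix.of fun a b : Fin 3 => v a (![i, j, k] b))

/-- The standard 3-form
`φ = e₁₂₇ + e₁₃₅ - e₁₄₆ - e₂₃₆ - e₂₄₅ + e₃₄₇ + e₅₆₇` on `ℝ⁷`;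
the indices `1, …, 7` of the formula are `0, …, 6` in the code. -/
def stdForm (v : Fin 3 → Fin 7 → ℝ) : ℝ :=
  elemForm 0 1 6 v + elemForm 0 2 4 v - elemForm 0 3 5 v - elemForm 1 2 5 v
    - elemForm 1 3 4 v + elemForm 2 3 6 v + elemForm 4 5 6 v

/-- The element `E_{ij}` of the standard basis of `𝔰𝔬(8)`: it maps the `i`-th basis vector to the
`j`-th one, the `j`-th one to minus the `i`-th one, and the others to zero. The arguments are the
indices `1, …, 8`, shifted down by one. -/
def soBasis (i j : Fin 8) : Matrix (Fin 8) (Fin 8) ℝ :=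
  Matrix.single j i 1 - Matrix.single i j 1

/-- Clifford multiplication by the standard basis vectors `e₁, …, e₇` of `ℝ⁷` on the space
`Δ₇ = ℝ⁸` of real spinors (with `eᵢ² = -1`). -/
def cliff : Fin 7 → Matrix (Fin 8) (Fin 8) ℝ :=
  ![soBasis 0 7 + soBasis 1 6 - soBasis 2 5 - soBasis 3 4,
    -soBasis 0 6 + soBasis 1 7 + soBasis 2 4 - soBasis 3 5,
    -soBasis 0 5 + soBasis 1 4 - soBasis 2 7 + soBasis 3 6,
    -soBasis 0 4 - soBasis 1 5 - soBasis 2 6 - soBasis 3 7,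
    -soBasis 0 2 - soBasis 1 3 + soBasis 4 6 + soBasis 5 7,
    soBasis 0 3 - soBasis 1 2 - soBasis 4 7 + soBasis 5 6,
    soBasis 0 1 - soBasis 2 3 - soBasis 4 5 + soBasis 6 7]

/-- The standard basis spinors `ψ₁, …, ψ₈` (indices shifted down by one). -/
def basisSpinor (k : Fin 8) : Fin 8 → ℝ := Pi.single k 1

/-- The spin representation of `𝔰𝔬(7)` on `Δ₇`: a skew-symmetric endomorphism `A` of `ℝ⁷` acts by
`½ ∑_{i<j} ⟨A eᵢ, eⱼ⟩ eᵢ eⱼ = ¼ ∑_{i,j} ⟨A eᵢ, eⱼ⟩ eᵢ eⱼ`. -/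
def spinAction (A : Matrix (Fin 7) (Fin 7) ℝ) : Matrix (Fin 8) (Fin 8) ℝ :=
  (1 / 4 : ℝ) • ∑ i, ∑ j, A j i • (cliff i * cliff j)

/-- The Lie algebra `𝔰𝔲(3) ⊂ 𝔤₂ ⊂ 𝔰𝔬(7)`: all skew-symmetric endomorphisms of `ℝ⁷` that annihilate
the two spinors `ψ₁` and `ψ₂`. -/
def su3 : Set (Matrix (Fin 7) (Fin 7) ℝ) :=
  {A | A.transpose = -A ∧ (spinAction A).mulVec (basisSpinor 0) = 0 ∧
    (spinAction A).mulVec (basisSpinor 1) = 0}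

/-- `s` is the lift to `Spin(7) ⊂ SO(8)` of the element `h` of `G₂ ⊂ SO(7)`, where `G₂` is embedded
into `Spin(7)` as the isotropy group of `ψ₁`: `s` is orthogonal, it covers `h`, that is
`s (v · ψ) = (h v) · (s ψ)` for Clifford multiplication, and it fixes `ψ₁`. The commutant of the
Clifford multiplication consists of the scalars, so the first two conditions determine `s` up to
sign, and the third one fixes the sign. -/
def IsSpinLift (h : Matrix (Fin 7) (Fin 7) ℝ) (s : Matrix (Fin 8) (Fin 8) ℝ) : Prop :=
  s.transpose * s = 1 ∧ (∀ j, s * cliff j = (∑ i, h i j • cliff i) * s) ∧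
    s.mulVec (basisSpinor 0) = basisSpinor 0

end G2

/-! ### Connections on the tangent bundle: parallel transport and holonomy -/

section Holonomy

variable {M : Type*} [TopologicalSpace M] [ChartedSpace (EuclideanSpace ℝ (Fin 7)) M]
  [IsManifold (𝓡 7) ∞ M]

/-- The velocity `γ'(t)` of a curve. -/
def velocity (γ : ℝ → M) (t : ℝ) : TangentSpace (𝓡 7) (γ t) :=
  mfderiv 𝓘(ℝ, ℝ) (𝓡 7) γ t (1 : ℝ)

/-- `w` is the covariant derivative at time `t` of the vector field `V` along the curve `γ`.
If `V = ∑ aᵢ · (eᵢ ∘ γ)` near `t` with vector fields `eᵢ` on `M` that are smooth near `γ t`, then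
`(∇_{γ'} V)(t) = ∑ (aᵢ'(t) eᵢ + aᵢ(t) ∇_{γ'(t)} eᵢ)`; this does not depend on the choices. -/
def HasCovDerivAlong
    (cov : CovariantDerivative (𝓡 7) (EuclideanSpace ℝ (Fin 7))
      (TangentSpace (𝓡 7) : M → Type _))
    (γ : ℝ → M) (V : ∀ t : ℝ, TangentSpace (𝓡 7) (γ t)) (t : ℝ)
    (w : TangentSpace (𝓡 7) (γ t)) : Prop :=
  ∃ (e : Fin 7 → ∀ x : M, TangentSpace (𝓡 7) x) (a : Fin 7 → ℝ → ℝ) (a' : Fin 7 → ℝ),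
    (∀ i, ContMDiffAt (𝓡 7) (𝓡 7).tangent ∞
      (fun x => (⟨x, e i x⟩ : TangentBundle (𝓡 7) M)) (γ t)) ∧
    (∀ i, HasDerivAt (a i) (a' i) t) ∧
    (∀ᶠ s in 𝓝 t, V s = ∑ i, a i s • e i (γ s)) ∧
    w = ∑ i, (a' i • e i (γ t) + a i t • cov (e i) (γ t) (velocity γ t))

/-- `P` is the parallel transport along `γ` from time `0` to time `1`. -/
def IsTransportAlong
    (cov : CovariantDerivative (𝓡 7) (EuclideanSpace ℝ (Fin 7))
      (TangentSpace (𝓡 7) : M → Type _))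
    (γ : ℝ → M) (P : TangentSpace (𝓡 7) (γ 0) →L[ℝ] TangentSpace (𝓡 7) (γ 1)) : Prop :=
  ∀ v, ∃ V : ∀ t : ℝ, TangentSpace (𝓡 7) (γ t),
    (∀ t, HasCovDerivAlong cov γ V t 0) ∧ V 0 = v ∧ V 1 = P v

/-- `IsTransport cov x y P`: the map `P` is the parallel transport along some piecewise smooth
curve from `x` to `y`, that is, along a concatenation of finitely many smooth curves. -/
inductive IsTransport
    (cov : CovariantDerivative (𝓡 7) (EuclideanSpace ℝ (Fin 7))
      (TangentSpace (𝓡 7) : M → Type _)) :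
    ∀ x y : M, (TangentSpace (𝓡 7) x →L[ℝ] TangentSpace (𝓡 7) y) → Prop
  | refl (x : M) : IsTransport cov x x (ContinuousLinearMap.id ℝ _)
  | smooth (γ : ℝ → M) (hγ : ContMDiff 𝓘(ℝ, ℝ) (𝓡 7) ∞ γ)
      (P : TangentSpace (𝓡 7) (γ 0) →L[ℝ] TangentSpace (𝓡 7) (γ 1))
      (hP : IsTransportAlong cov γ P) : IsTransport cov (γ 0) (γ 1) P
  | trans (x y z : M) (P : TangentSpace (𝓡 7) x →L[ℝ] TangentSpace (𝓡 7) y)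
      (Q : TangentSpace (𝓡 7) y →L[ℝ] TangentSpace (𝓡 7) z)
      (hP : IsTransport cov x y P) (hQ : IsTransport cov y z Q) : IsTransport cov x z (Q.comp P)

/-- The holonomy group at `p`: all parallel transports along piecewise smooth loops based at `p`. -/
def holonomyGroup
    (cov : CovariantDerivative (𝓡 7) (EuclideanSpace ℝ (Fin 7))
      (TangentSpace (𝓡 7) : M → Type _)) (p : M) :
    Set (TangentSpace (𝓡 7) p →L[ℝ] TangentSpace (𝓡 7) p) :=
  {P | IsTransport cov p p P}

variable [RiemannianBundle (TangentSpace (𝓡 7) : M → Type _)]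

/-- The holonomy algebra at `p`, that is the Lie algebra of the holonomy group: all velocities
`c'(0)` of continuously differentiable curves `c` of endomorphisms of `T_p M` which stay in the
holonomy group and start at the identity. -/
def holonomyAlgebra
    (cov : CovariantDerivative (𝓡 7) (EuclideanSpace ℝ (Fin 7))
      (TangentSpace (𝓡 7) : M → Type _)) (p : M) :
    Set (TangentSpace (𝓡 7) p →L[ℝ] TangentSpace (𝓡 7) p) :=
  {A | ∃ c : ℝ → (TangentSpace (𝓡 7) p →L[ℝ] TangentSpace (𝓡 7) p),
    ContDiff ℝ 1 c ∧ c 0 = ContinuousLinearMap.id ℝ _ ∧ (∀ t, c t ∈ holonomyGroup cov p) ∧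
      HasDerivAt c A 0}

end Holonomy

/-! ### `G₂`-structures and their characteristic connection -/

section G2Manifold

variable {M : Type*} [TopologicalSpace M] [ChartedSpace (EuclideanSpace ℝ (Fin 7)) M]
  [IsManifold (𝓡 7) ∞ M]

/-- `(dφ)(X₀, X₁, X₂, X₃)` at `x`, for a 3-form `φ` and vector fields `X₀, …, X₃`:
`∑_i (-1)^i X_i(φ(…, X̂_i, …)) + ∑_{i<j} (-1)^{i+j} φ([X_i, X_j], …, X̂_i, …, X̂_j, …)`.
In the second sum the code uses `j - 1` in the place of `j`, which gives the minus sign. -/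
def extDerivThree (φ : ∀ x : M, (TangentSpace (𝓡 7) x) [⋀^Fin 3]→L[ℝ] ℝ)
    (X : Fin 4 → ∀ x : M, TangentSpace (𝓡 7) x) (x : M) : ℝ :=
  (∑ i : Fin 4, (-1 : ℝ) ^ (i : ℕ) *
      mvfderiv (𝓡 7) (fun y => φ y (i.removeNth fun k => X k y)) x (X i x)) -
    ∑ i : Fin 3, ∑ j ∈ Finset.Ici i, (-1 : ℝ) ^ ((i : ℕ) + (j : ℕ)) *
      φ x (Matrix.vecCons (VectorField.mlieBracket (𝓡 7) (X i.castSucc) (X j.succ) x)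
        (j.removeNth (i.castSucc.removeNth fun k => X k x)))

variable [RiemannianBundle (TangentSpace (𝓡 7) : M → Type _)]

/-- The tuple `e = (e₁, …, e₇)` is a `G₂`-adapted frame of `T_x M`: it is orthonormal, and `φ` has
in it the coefficients of the standard form. -/
def IsAdaptedFrame (φ : ∀ x : M, (TangentSpace (𝓡 7) x) [⋀^Fin 3]→L[ℝ] ℝ) (x : M)
    (e : Fin 7 → TangentSpace (𝓡 7) x) : Prop :=
  (∀ i j, inner ℝ (e i) (e j) = if i = j then (1 : ℝ) else 0) ∧
    ∀ i : Fin 3 → Fin 7, φ x (fun a => e (i a)) = G2.stdForm (fun a => Pi.single (i a) 1)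

/-- `φ` is a `G₂`-structure inducing the given Riemannian metric: it is a smooth 3-form, and every
tangent space has an adapted frame. -/
structure IsG2Structure (φ : ∀ x : M, (TangentSpace (𝓡 7) x) [⋀^Fin 3]→L[ℝ] ℝ) : Prop where
  /-- smoothness: `φ(X₁, X₂, X₃)` is smooth for smooth (local) vector fields -/
  smooth : ∀ (U : Set M) (X : Fin 3 → ∀ x : M, TangentSpace (𝓡 7) x), IsOpen U →
    (∀ k, ContMDiffOn (𝓡 7) (𝓡 7).tangent ∞
      (fun x => (⟨x, X k x⟩ : TangentBundle (𝓡 7) M)) U) →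
    ContMDiffOn (𝓡 7) 𝓘(ℝ, ℝ) ∞ (fun x => φ x (fun k => X k x)) U
  exists_adaptedFrame : ∀ x, ∃ e, IsAdaptedFrame φ x e

/-- The Hodge star operator `⋆ : Λ³ → Λ⁴` of `T_x M` with the orientation given by the orthonormal
frame `e`: `(⋆α)(w₁, …, w₄) = ∑_{i<j<k} α(eᵢ, eⱼ, eₖ) vol(eᵢ, eⱼ, eₖ, w₁, …, w₄)`, written as
`1/3!` of the sum over all `i, j, k`. -/
def hodgeStarThree {x : M} (e : Fin 7 → TangentSpace (𝓡 7) x)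
    (α : (TangentSpace (𝓡 7) x) [⋀^Fin 3]→L[ℝ] ℝ) (w : Fin 4 → TangentSpace (𝓡 7) x) : ℝ :=
  (1 / 6 : ℝ) * ∑ i : Fin 3 → Fin 7, α (fun a => e (i a)) *
    Matrix.det (Matrix.of fun (k l : Fin 7) =>
      inner ℝ (e k) (Fin.append (m := 3) (n := 4) (fun a => e (i a)) w l))

/-- The `G₂`-structure `φ` is nearly parallel: the 4-forms `dφ` and `⋆φ` are proportional,
`dφ = μ ⋆φ` for a constant `μ`. -/
def IsNearlyParallel (φ : ∀ x : M, (TangentSpace (𝓡 7) x) [⋀^Fin 3]→L[ℝ] ℝ) : Prop :=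
  ∃ μ : ℝ, ∀ (x : M) (X : Fin 4 → ∀ x : M, TangentSpace (𝓡 7) x),
    (∀ k, MDifferentiableAt (𝓡 7) (𝓡 7).tangent
      (fun y => (⟨y, X k y⟩ : TangentBundle (𝓡 7) M)) x) →
    ∀ e, IsAdaptedFrame φ x e →
      extDerivThree φ X x = μ * hodgeStarThree e (φ x) (fun k => X k x)

/-- `∇g = 0`. -/
def IsMetric
    (cov : CovariantDerivative (𝓡 7) (EuclideanSpace ℝ (Fin 7))
      (TangentSpace (𝓡 7) : M → Type _)) : Prop :=
  ∀ (x : M) (X Y : ∀ x : M, TangentSpace (𝓡 7) x),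
    MDifferentiableAt (𝓡 7) (𝓡 7).tangent
      (fun y => (⟨y, X y⟩ : TangentBundle (𝓡 7) M)) x →
    MDifferentiableAt (𝓡 7) (𝓡 7).tangent
      (fun y => (⟨y, Y y⟩ : TangentBundle (𝓡 7) M)) x →
    ∀ v : TangentSpace (𝓡 7) x,
      mvfderiv (𝓡 7) (fun y => (inner ℝ (X y) (Y y) : ℝ)) x v =
        inner ℝ (cov X x v) (Y x) + inner ℝ (X x) (cov Y x v)

/-- `∇φ = 0`. -/
def IsParallelForm
    (cov : CovariantDerivative (𝓡 7) (EuclideanSpace ℝ (Fin 7))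
      (TangentSpace (𝓡 7) : M → Type _))
    (φ : ∀ x : M, (TangentSpace (𝓡 7) x) [⋀^Fin 3]→L[ℝ] ℝ) : Prop :=
  ∀ (x : M) (X : Fin 3 → ∀ x : M, TangentSpace (𝓡 7) x),
    (∀ k, MDifferentiableAt (𝓡 7) (𝓡 7).tangent
      (fun y => (⟨y, X k y⟩ : TangentBundle (𝓡 7) M)) x) →
    ∀ v : TangentSpace (𝓡 7) x,
      mvfderiv (𝓡 7) (fun y => φ y (fun k => X k y)) x v =
        ∑ k, φ x (Function.update (fun l => X l x) k (cov (X k) x v))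

/-- The torsion of `∇` as a `(0,3)`-tensor, `T(u, v, w) = g(T(u, v), w)`. -/
def torsionForm
    (cov : CovariantDerivative (𝓡 7) (EuclideanSpace ℝ (Fin 7))
      (TangentSpace (𝓡 7) : M → Type _))
    (x : M) (u v w : TangentSpace (𝓡 7) x) : ℝ :=
  inner ℝ (cov.torsion x u v) w

/-- `∇` is the characteristic connection of the `G₂`-structure `φ`: a smooth connection on the
tangent bundle which preserves the metric and `φ` and has totally skew-symmetric torsion (the
skew-symmetry in the first two arguments is automatic). -/
structure IsCharacteristicConnection
    (φ : ∀ x : M, (TangentSpace (𝓡 7) x) [⋀^Fin 3]→L[ℝ] ℝ)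
    (cov : CovariantDerivative (𝓡 7) (EuclideanSpace ℝ (Fin 7))
      (TangentSpace (𝓡 7) : M → Type _)) : Prop where
  smooth : CovariantDerivative.ContMDiffCovariantDerivative cov ∞
  metric : IsMetric cov
  parallel : IsParallelForm cov φ
  torsion_skew : ∀ (x : M) (u v w : TangentSpace (𝓡 7) x),
    torsionForm cov x u v w = -torsionForm cov x u w v

/-- The matrix of an endomorphism of `T_x M` in an orthonormal frame `e`. -/
def frameMatrix {x : M} (e : Fin 7 → TangentSpace (𝓡 7) x)
    (A : TangentSpace (𝓡 7) x →L[ℝ] TangentSpace (𝓡 7) x) : Matrix (Fin 7) (Fin 7) ℝ :=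
  Matrix.of fun i j => inner ℝ (e i) (A (e j))

/-- `e = (e₁, …, e₇)` is a smooth local adapted frame over the open set `U`. -/
structure IsLocalAdaptedFrame (φ : ∀ x : M, (TangentSpace (𝓡 7) x) [⋀^Fin 3]→L[ℝ] ℝ)
    (U : Set M) (e : Fin 7 → ∀ x : M, TangentSpace (𝓡 7) x) : Prop where
  isOpen : IsOpen U
  smooth : ∀ i, ContMDiffOn (𝓡 7) (𝓡 7).tangent ∞
    (fun x => (⟨x, e i x⟩ : TangentBundle (𝓡 7) M)) U
  adapted : ∀ x ∈ U, IsAdaptedFrame φ x (fun i => e i x)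

/-- A smooth spinor field on `(M, g, φ)`, that is a section of the real spinor bundle
`S = P ×_{G₂} Δ₇`, where `P` is the `G₂`-bundle of adapted frames and `G₂` acts on `Δ₇ = ℝ⁸` through
its lift to `Spin(7)`. It is given by its coordinates in all adapted frames, transforming as
`Ψ(e h) = s⁻¹ Ψ(e)` for the lift `s` of `h`; the value at a tuple that is not an adapted frame is set
to be zero. -/
structure SpinorField (φ : ∀ x : M, (TangentSpace (𝓡 7) x) [⋀^Fin 3]→L[ℝ] ℝ) where
  toFun : ∀ x : M, (Fin 7 → TangentSpace (𝓡 7) x) → (Fin 8 → ℝ)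
  eq_zero : ∀ x e, ¬ IsAdaptedFrame φ x e → toFun x e = 0
  equivariant : ∀ (x : M) (e e' : Fin 7 → TangentSpace (𝓡 7) x) (h s),
    IsAdaptedFrame φ x e → IsAdaptedFrame φ x e' → (∀ j, e' j = ∑ i, h i j • e i) →
    G2.IsSpinLift h s → s.mulVec (toFun x e') = toFun x e
  smooth : ∀ (U : Set M) (e : Fin 7 → ∀ x : M, TangentSpace (𝓡 7) x),
    IsLocalAdaptedFrame φ U e →
      ContMDiffOn (𝓡 7) 𝓘(ℝ, Fin 8 → ℝ) ∞ (fun x => toFun x (fun i => e i x)) U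

/-- The spinor field `Ψ` is parallel for the connection on the spinor bundle induced by `∇`. In a
local adapted frame this is
`∇_v Ψ = v(Ψ) + ½ ∑_{i<j} g(∇_v eᵢ, eⱼ) eᵢ eⱼ Ψ = 0`. -/
def SpinorField.IsParallel {φ : ∀ x : M, (TangentSpace (𝓡 7) x) [⋀^Fin 3]→L[ℝ] ℝ}
    (Ψ : SpinorField φ)
    (cov : CovariantDerivative (𝓡 7) (EuclideanSpace ℝ (Fin 7))
      (TangentSpace (𝓡 7) : M → Type _)) : Prop :=
  ∀ (U : Set M) (e : Fin 7 → ∀ x : M, TangentSpace (𝓡 7) x), IsLocalAdaptedFrame φ U e →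
    ∀ x ∈ U, ∀ v : TangentSpace (𝓡 7) x,
      mvfderiv (𝓡 7) (fun y => Ψ.toFun y (fun i => e i y)) x v +
        (G2.spinAction (Matrix.of fun i j => inner ℝ (e i x) (cov (e j) x v))).mulVec
          (Ψ.toFun x (fun i => e i x)) = 0

end G2Manifold

end

/-! Everything is governed by the cross product of `ℝ⁷`, `⟨a × b, c⟩ = φ(a, b, c)`. Clifford
multiplication on `ψ₁` identifies `Δ₇` with `ℝ ⊕ ℝ⁷` through `a ψ₁ + v · ψ₁` (`spinorOf`), and `𝔤₂`,
the skew derivations of the cross product, acts there as `0 ⊕ W` (`IsG2Matrix.spinAction_spinorOf`).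
In particular `ψ₂ = e₇ · ψ₁`, so elements of `𝔰𝔲(3)` annihilate `e₇`. Both claims therefore follow
once no non-zero vector of `ℝ⁷` is annihilated by the whole curvature `R` of the characteristic
connection.

Torsion. In an adapted frame the coefficients of `φ` are constant and the connection form is
`𝔤₂`-valued, hence `dφ = ∑ (e_m ⌟ T) ∧ (e_m ⌟ φ)`. The map `t ↦ ∑ (e_m ⌟ t) ∧ (e_m ⌟ φ)` from
3-forms to 4-forms is injective (`IsTorsionKernel.eq_zero`) and sends `φ` to `6 ⋆φ`, so `dφ = μ ⋆φ`
forces `T = (μ/6) φ`. Write `c = μ/6`; non-vanishing torsion means `c ≠ 0`.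

Curvature. With torsion `c a × b` and parallel cross product, the first Bianchi identity reads `∑
R(u, v)w = c² ∑ (u × v) × w`, both sums being cyclic (`sum_curv_eq`). If `R(u, v)ξ = 0` for all `u`,
`v`, pairing with `ξ` and skew-symmetry of `R(u, v)` make `ξ` orthogonal to every Jacobiator of the
cross product. Jacobiators span `ℝ⁷`, so `ξ = 0` (`G2.eq_zero_of_curv_eq_zero`).

Spinors. The section `ψ₁` is parallel because `𝔤₂` annihilates it. For any parallel spinor, the
vector part is a parallel section for the same connection form, hence lies in the kernel of the
curvature and vanishes. What remains is a multiple of `ψ₁` with locally constant coefficient, and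
`M` is connected.

Holonomy. Half of the Ambrose-Singer theorem is needed: a vector annihilated by the holonomy algebra
at `p` is annihilated by the curvature at `p`. In a chart, consider the paths `τ ↦ y + sτ u + ε(τ -
τ²) v`, whose end points do not depend on `ε`. Going along the path for `(s, ε)` and back along the
one for `(s, 0)` is a loop; differentiating its holonomy in `ε` at `0` gives an element of the
holonomy algebra for each small `s`. Hence the `ε`-derivative of the propagator annihilates `ξ`, and
its `s`-derivative at `0` is `1/6` of `R(u, v)ξ`. Smooth dependence of the propagator on `(s, ε)`
comes from writing the transport equation as `y = ξ + V(a) y` with a Volterra operator `V(a)` linear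
in the coefficient path, and inverting `1 - V(a)` by a Neumann series, which converges because the
paths are short. -/

noncomputable section

set_option linter.unusedSectionVars false

/-! ### The cross product on `ℝ⁷` -/

namespace G2

open Matrix

/-- The cross product on `ℝ⁷` determined by `⟨cross a b, c⟩ = φ(a, b, c)`. -/
def cross {R : Type*} [CommRing R] (a b : Fin 7 → R) : Fin 7 → R :=
  ![a 1 * b 6 - a 6 * b 1 + (a 2 * b 4 - a 4 * b 2) - (a 3 * b 5 - a 5 * b 3),
    a 6 * b 0 - a 0 * b 6 - (a 2 * b 5 - a 5 * b 2) - (a 3 * b 4 - a 4 * b 3),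
    a 4 * b 0 - a 0 * b 4 - (a 5 * b 1 - a 1 * b 5) + (a 3 * b 6 - a 6 * b 3),
    -(a 5 * b 0 - a 0 * b 5) - (a 4 * b 1 - a 1 * b 4) + (a 6 * b 2 - a 2 * b 6),
    a 0 * b 2 - a 2 * b 0 - (a 1 * b 3 - a 3 * b 1) + (a 5 * b 6 - a 6 * b 5),
    -(a 0 * b 3 - a 3 * b 0) - (a 1 * b 2 - a 2 * b 1) + (a 6 * b 4 - a 4 * b 6),
    a 0 * b 1 - a 1 * b 0 + (a 2 * b 3 - a 3 * b 2) + (a 4 * b 5 - a 5 * b 4)]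

theorem stdForm_eq (v : Fin 3 → Fin 7 → ℝ) : stdForm v = cross (v 0) (v 1) ⬝ᵥ v 2 := by
  simp only [stdForm, elemForm, Matrix.det_fin_three, Matrix.of_apply, cross, dotProduct,
    Fin.sum_univ_seven, Matrix.cons_val]
  ring

theorem cross_add_left (a a' b : Fin 7 → ℝ) : cross (a + a') b = cross a b + cross a' b := by
  ext k; fin_cases k <;> simp [cross] <;> ring

theorem cross_smul_left (r : ℝ) (a b : Fin 7 → ℝ) : cross (r • a) b = r • cross a b := by
  ext k; fin_cases k <;> simp [cross] <;> ring

theorem cross_swap (a b : Fin 7 → ℝ) : cross a b = -cross b a := by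
  ext k; fin_cases k <;> simp [cross] <;> ring

theorem cross_add_right (a b b' : Fin 7 → ℝ) : cross a (b + b') = cross a b + cross a b' := by
  rw [cross_swap, cross_add_left, cross_swap b, cross_swap b']; abel

theorem cross_smul_right (r : ℝ) (a b : Fin 7 → ℝ) : cross a (r • b) = r • cross a b := by
  rw [cross_swap, cross_smul_left, cross_swap b, smul_neg, neg_neg]

@[simp] theorem cross_self (a : Fin 7 → ℝ) : cross a a = 0 := by
  ext k; fin_cases k <;> simp [cross] <;> ring

theorem cross_neg_left (a b : Fin 7 → ℝ) : cross (-a) b = -cross a b := by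
  simpa using cross_smul_left (-1) a b

theorem cross_sub_left (a a' b : Fin 7 → ℝ) : cross (a - a') b = cross a b - cross a' b := by
  rw [sub_eq_add_neg, cross_add_left, cross_neg_left, ← sub_eq_add_neg]

theorem cross_neg_right (a b : Fin 7 → ℝ) : cross a (-b) = -cross a b := by
  simpa using cross_smul_right (-1) a b

theorem cross_dotProduct_swap (a b c : Fin 7 → ℝ) : cross a b ⬝ᵥ c = -(cross a c ⬝ᵥ b) := by
  simp only [cross, dotProduct, Fin.sum_univ_seven, Matrix.cons_val]; ring

theorem cross_dotProduct_rotate (a b c : Fin 7 → ℝ) : cross a b ⬝ᵥ c = cross b c ⬝ᵥ a := by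
  rw [cross_swap, neg_dotProduct, cross_dotProduct_swap, neg_neg]

/-- `a × (b × c) + b × (a × c) = -2⟨a, b⟩ c + ⟨a, c⟩ b + ⟨b, c⟩ a`. -/
theorem cross_cross (a b c : Fin 7 → ℝ) :
    cross a (cross b c) + cross b (cross a c) =
      (-2 * (a ⬝ᵥ b)) • c + (a ⬝ᵥ c) • b + (b ⬝ᵥ c) • a := by
  ext k
  fin_cases k <;>
    · simp only [cross, dotProduct, Fin.sum_univ_seven, Matrix.cons_val, Pi.add_apply,
        Pi.smul_apply, smul_eq_mul, Fin.reduceFinMk, Fin.zero_eta, Fin.mk_one]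
      ring

/-- The polarised identity with its first two vectors equal is twice this one. It is the alternative
law of the octonions. -/
theorem cross_cross_self (a b : Fin 7 → ℝ) :
    cross a (cross a b) = (a ⬝ᵥ b) • a - (a ⬝ᵥ a) • b := by
  have h := cross_cross a a b
  ext k
  have hk := congrFun h k
  simp only [Pi.add_apply, Pi.smul_apply, Pi.sub_apply, smul_eq_mul] at hk ⊢
  linarith

theorem cross_dotProduct_cross (a b c : Fin 7 → ℝ) :
    cross a b ⬝ᵥ cross a c = (a ⬝ᵥ a) * (b ⬝ᵥ c) - (a ⬝ᵥ b) * (a ⬝ᵥ c) := by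
  rw [cross_dotProduct_swap, cross_cross_self, sub_dotProduct, smul_dotProduct, smul_dotProduct,
    smul_eq_mul, smul_eq_mul, dotProduct_comm c b]
  ring

theorem cross_cross_of_orthogonal {a b c : Fin 7 → ℝ} (hab : a ⬝ᵥ b = 0) (hac : a ⬝ᵥ c = 0)
    (hbc : b ⬝ᵥ c = 0) : cross a (cross b c) = -cross b (cross a c) := by
  have h := cross_cross a b c
  rw [hab, hac, hbc] at h
  simpa [eq_neg_iff_add_eq_zero] using h

@[simp] theorem cross_dotProduct_left (a b : Fin 7 → ℝ) : cross a b ⬝ᵥ a = 0 := by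
  rw [cross_dotProduct_rotate, cross_dotProduct_rotate]; simp

@[simp] theorem cross_dotProduct_right (a b : Fin 7 → ℝ) : cross a b ⬝ᵥ b = 0 := by
  rw [cross_swap]; simp

/-- The vectors `e₁, …, e₇` of the adapted frame with first three vectors `a, b, d`. -/
def frameOf (a b d : Fin 7 → ℝ) : Fin 7 → Fin 7 → ℝ :=
  ![a, b, d, cross (cross a b) d, cross a d, -cross b d, cross a b]

/-- The multiplication table of the cross product. -/
def crossTable : Fin 7 → Fin 7 → Fin 7 → ℤ :=
  ![![0, Pi.single 6 1, Pi.single 4 1, -Pi.single 5 1, -Pi.single 2 1, Pi.single 3 1, -Pi.single 1 1],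
    ![-Pi.single 6 1, 0, -Pi.single 5 1, -Pi.single 4 1, Pi.single 3 1, Pi.single 2 1, Pi.single 0 1],
    ![-Pi.single 4 1, Pi.single 5 1, 0, Pi.single 6 1, Pi.single 0 1, -Pi.single 1 1, -Pi.single 3 1],
    ![Pi.single 5 1, Pi.single 4 1, -Pi.single 6 1, 0, -Pi.single 1 1, -Pi.single 0 1, Pi.single 2 1],
    ![Pi.single 2 1, -Pi.single 3 1, -Pi.single 0 1, Pi.single 1 1, 0, Pi.single 6 1, -Pi.single 5 1],
    ![-Pi.single 3 1, -Pi.single 2 1, Pi.single 1 1, Pi.single 0 1, -Pi.single 6 1, 0, Pi.single 4 1],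
    ![Pi.single 1 1, -Pi.single 0 1, Pi.single 3 1, -Pi.single 2 1, Pi.single 5 1, -Pi.single 4 1, 0]]

/-- Stated over `ℤ`, where equality is decidable, so that the kernel verifies the whole table; the
real version follows by casting. The same device serves for the Clifford matrices and the Hodge
star. -/
theorem cross_single_int (i j : Fin 7) :
    cross (Pi.single i (1 : ℤ)) (Pi.single j 1) = crossTable i j := by
  revert i j; decide +kernel

theorem cross_intCast (a b : Fin 7 → ℤ) :
    cross (fun k => (a k : ℝ)) (fun k => (b k : ℝ)) = fun k => ((cross a b k : ℤ) : ℝ) := by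
  ext k; fin_cases k <;> simp [cross]

theorem single_intCast (i : Fin 7) :
    (Pi.single i 1 : Fin 7 → ℝ) = fun k => ((Pi.single i 1 : Fin 7 → ℤ) k : ℝ) := by
  ext k; simp [Pi.single_apply]

theorem cross_single (i j : Fin 7) :
    cross (Pi.single i 1) (Pi.single j 1) = fun k => (crossTable i j k : ℝ) := by
  rw [single_intCast i, single_intCast j, cross_intCast, cross_single_int]

/-- The coefficients of the standard form. -/
def coeff (i j k : Fin 7) : ℝ := cross (Pi.single i 1) (Pi.single j 1) k

theorem coeff_eq (i j k : Fin 7) : coeff i j k = crossTable i j k := by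
  rw [coeff, cross_single]

theorem stdForm_single (i : Fin 3 → Fin 7) :
    stdForm (fun a => Pi.single (i a) 1) = coeff (i 0) (i 1) (i 2) := by
  simp [stdForm_eq, coeff]

theorem cross_eq_sum (a b : Fin 7 → ℝ) (k : Fin 7) :
    cross a b k = ∑ i, ∑ j, a i * b j * coeff i j k := by
  simp only [coeff, Fin.sum_univ_seven]
  fin_cases k <;> simp [cross] <;> ring

/-- The Jacobiators of the cross product span `ℝ⁷`: for each `l` there are three basis vectors whose
Jacobiator is `±3 e_l`, all three of its terms being equal. -/
theorem sum_cross_cross_dotProduct_eq_zero {x : Fin 7 → ℝ}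
    (h : ∀ a b c, (cross (cross a b) c + cross (cross b c) a + cross (cross c a) b) ⬝ᵥ x = 0) :
    x = 0 := by
  have key : ∀ i j k : Fin 7, (cross (cross (Pi.single i 1) (Pi.single j 1)) (Pi.single k 1) +
      cross (cross (Pi.single j 1) (Pi.single k 1)) (Pi.single i 1) +
      cross (cross (Pi.single k 1) (Pi.single i 1)) (Pi.single j 1)) ⬝ᵥ x = 0 :=
    fun i j k => h _ _ _
  ext l
  fin_cases l
  · simpa [cross, dotProduct, Fin.sum_univ_seven, show (1 : ℝ) + 1 + 1 ≠ 0 by norm_num,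
      show (-1 : ℝ) + -1 + -1 ≠ 0 by norm_num] using key 1 2 3
  · simpa [cross, dotProduct, Fin.sum_univ_seven, show (1 : ℝ) + 1 + 1 ≠ 0 by norm_num,
      show (-1 : ℝ) + -1 + -1 ≠ 0 by norm_num] using key 0 2 3
  · simpa [cross, dotProduct, Fin.sum_univ_seven, show (1 : ℝ) + 1 + 1 ≠ 0 by norm_num,
      show (-1 : ℝ) + -1 + -1 ≠ 0 by norm_num] using key 0 1 3
  · simpa [cross, dotProduct, Fin.sum_univ_seven, show (1 : ℝ) + 1 + 1 ≠ 0 by norm_num,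
      show (-1 : ℝ) + -1 + -1 ≠ 0 by norm_num] using key 0 1 2
  · simpa [cross, dotProduct, Fin.sum_univ_seven, show (1 : ℝ) + 1 + 1 ≠ 0 by norm_num,
      show (-1 : ℝ) + -1 + -1 ≠ 0 by norm_num] using key 0 1 5
  · simpa [cross, dotProduct, Fin.sum_univ_seven, show (1 : ℝ) + 1 + 1 ≠ 0 by norm_num,
      show (-1 : ℝ) + -1 + -1 ≠ 0 by norm_num] using key 0 1 4
  · simpa [cross, dotProduct, Fin.sum_univ_seven, show (1 : ℝ) + 1 + 1 ≠ 0 by norm_num,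
      show (-1 : ℝ) + -1 + -1 ≠ 0 by norm_num] using key 0 2 5

end G2

/-! ### Adapted frames and the Lie algebra `𝔤₂` -/

namespace G2

open Matrix

/-- Three orthonormal vectors with `d ⟂ a × b` play the role of a basic triple of octonions. All
products reduce to those of `a`, `b`, `d` by skew-symmetry of `φ` and `⟨x × y, x × z⟩ = |x|²⟨y, z⟩ -
⟨x, y⟩⟨x, z⟩`. -/
theorem frameOf_dotProduct {a b d : Fin 7 → ℝ} (haa : a ⬝ᵥ a = 1) (hbb : b ⬝ᵥ b = 1)
    (hdd : d ⬝ᵥ d = 1) (hab : a ⬝ᵥ b = 0) (had : a ⬝ᵥ d = 0) (hbd : b ⬝ᵥ d = 0)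
    (hc : cross a b ⬝ᵥ d = 0) (i j : Fin 7) :
    frameOf a b d i ⬝ᵥ frameOf a b d j = if i = j then 1 else 0 := by
  have hac : a ⬝ᵥ cross a b = 0 := by rw [dotProduct_comm]; simp
  have hbc : b ⬝ᵥ cross a b = 0 := by rw [dotProduct_comm]; simp
  have hcc : cross a b ⬝ᵥ cross a b = 1 := by rw [cross_dotProduct_cross, haa, hbb, hab]; simp
  have sl : ∀ x y : Fin 7 → ℝ, x ⬝ᵥ cross x y = 0 := fun x y => by
    rw [dotProduct_comm, cross_dotProduct_left]
  have sr : ∀ x y : Fin 7 → ℝ, y ⬝ᵥ cross x y = 0 := fun x y => by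
    rw [dotProduct_comm, cross_dotProduct_right]
  have hba : b ⬝ᵥ a = 0 := by rw [dotProduct_comm, hab]
  have hda : d ⬝ᵥ a = 0 := by rw [dotProduct_comm, had]
  have hdb : d ⬝ᵥ b = 0 := by rw [dotProduct_comm, hbd]
  have hcad : cross a d ⬝ᵥ cross a b = 0 := by rw [cross_dotProduct_cross, hab, hdb]; simp
  have hcbd : cross b d ⬝ᵥ cross a b = 0 := by
    rw [cross_swap a b, dotProduct_neg, cross_dotProduct_cross, hba, hda]; simp
  have hadb : cross a d ⬝ᵥ b = 0 := by rw [cross_dotProduct_swap, hc, neg_zero]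
  have hbda : cross b d ⬝ᵥ a = 0 := by rw [← cross_dotProduct_rotate, hc]
  have hcda : cross (cross a b) d ⬝ᵥ a = 0 := by
    rw [cross_dotProduct_rotate, cross_dotProduct_rotate, cross_cross_self, hab, haa]
    simp [hbd]
  have hcdb : cross (cross a b) d ⬝ᵥ b = 0 := by
    rw [cross_dotProduct_rotate, cross_dotProduct_rotate, cross_swap a b, cross_neg_right,
      cross_cross_self, hba, hbb]
    simp [had]
  have e1 : cross (cross a b) d ⬝ᵥ cross (cross a b) d = 1 := by
    rw [cross_dotProduct_cross, hcc, hdd, hc]; simp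
  have e2 : cross a d ⬝ᵥ cross a d = 1 := by rw [cross_dotProduct_cross, haa, hdd, had]; simp
  have e3 : cross b d ⬝ᵥ cross b d = 1 := by rw [cross_dotProduct_cross, hbb, hdd, hbd]; simp
  have polar : ∀ x y, x ⬝ᵥ y = 0 → x ⬝ᵥ d = 0 → cross x d ⬝ᵥ cross y d = 0 := by
    intro x y hxy hxd
    rw [cross_swap x, cross_swap y, neg_dotProduct, dotProduct_neg, cross_dotProduct_cross, hxy,
      dotProduct_comm d x, hxd]
    simp
  have e4 := polar (cross a b) a (by simp) hc
  have e5 := polar (cross a b) b (by simp) hc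
  have e6 := polar a b hab had
  have hcab : cross a b ⬝ᵥ cross a d = 0 := by rw [dotProduct_comm, hcad]
  have f1 : b ⬝ᵥ cross a d = 0 := by rw [dotProduct_comm, hadb]
  have f2 : a ⬝ᵥ cross b d = 0 := by rw [dotProduct_comm, hbda]
  have f3 : a ⬝ᵥ cross (cross a b) d = 0 := by rw [dotProduct_comm, hcda]
  have f4 : b ⬝ᵥ cross (cross a b) d = 0 := by rw [dotProduct_comm, hcdb]
  have f5 : d ⬝ᵥ cross a b = 0 := by rw [dotProduct_comm, hc]
  have key : ∀ i j : Fin 7, i ≤ j →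
      frameOf a b d i ⬝ᵥ frameOf a b d j = if i = j then 1 else 0 := by
    intro i j hij
    fin_cases i <;> fin_cases j <;> first
      | exact absurd hij (by decide)
      | simp [frameOf, haa, hbb, hdd, hab, had, hbd, hcc, hcad, hcbd, e1, e2, e3, e4, e5, e6,
          sl, sr, f1, f2, f3, f4, f5]
  rcases le_total i j with h | h
  · exact key i j h
  · rw [dotProduct_comm, key j i h]; simp [eq_comm]

/-- The multiplication table generated by a basic triple does not depend on the triple; this is how
`G₂` acts transitively on such triples. -/
theorem cross_frameOf {a b d : Fin 7 → ℝ} (haa : a ⬝ᵥ a = 1) (hbb : b ⬝ᵥ b = 1)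
    (hdd : d ⬝ᵥ d = 1) (hab : a ⬝ᵥ b = 0) (had : a ⬝ᵥ d = 0) (hbd : b ⬝ᵥ d = 0)
    (hc : cross a b ⬝ᵥ d = 0) (i j : Fin 7) :
    cross (frameOf a b d i) (frameOf a b d j) = ∑ k, coeff i j k • frameOf a b d k := by
  have hac : a ⬝ᵥ cross a b = 0 := by rw [dotProduct_comm]; simp
  have hbc : b ⬝ᵥ cross a b = 0 := by rw [dotProduct_comm]; simp
  have hcc : cross a b ⬝ᵥ cross a b = 1 := by rw [cross_dotProduct_cross, haa, hbb, hab]; simp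
  have hba : b ⬝ᵥ a = 0 := by rw [dotProduct_comm, hab]
  have hda : d ⬝ᵥ a = 0 := by rw [dotProduct_comm, had]
  have hdb : d ⬝ᵥ b = 0 := by rw [dotProduct_comm, hbd]
  have hdc : d ⬝ᵥ cross a b = 0 := by rw [dotProduct_comm, hc]
  set c := cross a b with hcdef
  have hadb : b ⬝ᵥ cross a d = 0 := by rw [dotProduct_comm, cross_dotProduct_swap, ← hcdef, hc, neg_zero]
  have hbda : a ⬝ᵥ cross b d = 0 := by
    rw [dotProduct_comm, ← cross_dotProduct_rotate, ← hcdef, hc]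
  have p01 : cross a b = c := rfl
  have p06 : cross a c = -b := by rw [hcdef, cross_cross_self, hab, haa]; simp
  have p16 : cross b c = a := by
    rw [hcdef, cross_swap a b, cross_neg_right, cross_cross_self, hba, hbb]; simp
  have sq : ∀ x y : Fin 7 → ℝ, x ⬝ᵥ x = 1 → x ⬝ᵥ y = 0 → cross x (cross x y) = -y := by
    intro x y hx hxy; rw [cross_cross_self, hx, hxy]; simp
  have p04 : cross a (cross a d) = -d := sq a d haa had
  have p15 : cross b (cross b d) = -d := sq b d hbb hbd
  have p63 : cross c (cross c d) = -d := sq c d hcc hc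
  have p23 : ∀ x : Fin 7 → ℝ, x ⬝ᵥ d = 0 → cross d (cross x d) = x := by
    intro x hx
    rw [cross_swap x d, cross_neg_right, sq d x hdd (by rw [dotProduct_comm, hx]), neg_neg]
  have p62 : cross c d = cross c d := rfl
  -- For mutually orthogonal vectors the iterated product is invariant under cyclic permutation;
  -- this moves `d` to the outside, where the inner product of `a`, `b`, `c` is known.
  have anti : ∀ x y z : Fin 7 → ℝ, x ⬝ᵥ y = 0 → x ⬝ᵥ z = 0 → y ⬝ᵥ z = 0 →
      cross x (cross y z) = cross z (cross x y) := by
    intro x y z hxy hxz hyz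
    rw [cross_swap y z, cross_neg_right,
      cross_cross_of_orthogonal hxz hxy (by rw [dotProduct_comm, hyz]), neg_neg]
  have p03 : cross a (cross c d) = cross b d := by
    rw [anti a c d hac had hc, p06, cross_neg_right, ← cross_swap]
  have p13 : cross b (cross c d) = -cross a d := by
    rw [anti b c d hbc hbd hc, p16, cross_swap]
  have p14 : cross b (cross a d) = cross c d := by
    rw [anti b a d hba hbd had, cross_swap b a, p01, cross_neg_right, ← cross_swap]
  have p05 : cross a (cross b d) = -cross c d := by
    rw [anti a b d hab had hbd, p01, cross_swap]
  have p64 : cross c (cross a d) = -cross b d := by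
    rw [anti c a d (by rw [dotProduct_comm, hac]) hc had, cross_swap c a, p06, neg_neg, cross_swap]
  have p65 : cross c (cross b d) = cross a d := by
    rw [anti c b d (by rw [dotProduct_comm, hbc]) hc hbd, cross_swap c b, p16, cross_neg_right,
      ← cross_swap]
  have hcad : a ⬝ᵥ cross c d = 0 := by
    rw [dotProduct_comm, cross_dotProduct_rotate, cross_dotProduct_rotate, p06, neg_dotProduct,
      hbd, neg_zero]
  have hcbd : b ⬝ᵥ cross c d = 0 := by
    rw [dotProduct_comm, cross_dotProduct_rotate, cross_dotProduct_rotate, p16, had]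
  -- Products of two vectors of the form `· × d`: `anti` is used twice to produce `d × (d × (y ×
  -- x))`, which is a sign.
  have s : ∀ x y, x ⬝ᵥ y = 0 → x ⬝ᵥ d = 0 → y ⬝ᵥ d = 0 → y ⬝ᵥ cross x d = 0 →
      cross (cross x d) (cross y d) = -cross x y := by
    intro x y hxy hx hy hyx
    have hyxd : d ⬝ᵥ cross y x = 0 := by
      rw [dotProduct_comm, cross_dotProduct_rotate, dotProduct_comm, hyx]
    rw [anti (cross x d) y d (by rw [dotProduct_comm, hyx]) (by simp) hy,
      cross_swap (cross x d) y, anti y x d (by rw [dotProduct_comm, hxy]) hy hx,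
      cross_neg_right, sq d _ hdd hyxd, neg_neg, cross_swap]
  have p34 := s c a (by rw [dotProduct_comm, hac]) hc had hcad
  have p35 := s c b (by rw [dotProduct_comm, hbc]) hc hbd hcbd
  have p45 := s a b hab had hbd hadb
  have p60 : cross c a = b := by rw [cross_swap, p06, neg_neg]
  have p61 : cross c b = -a := by rw [cross_swap, p16]
  have p26 : cross d c = -cross c d := cross_swap ..
  have p36 : cross (cross c d) c = d := by rw [cross_swap, p63, neg_neg]
  have p46 : cross (cross a d) c = cross b d := by rw [cross_swap, p64, neg_neg]
  have p56 : cross (cross b d) c = -cross a d := by rw [cross_swap, p65]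
  have key : ∀ i j : Fin 7, i < j →
      cross (frameOf a b d i) (frameOf a b d j) = ∑ k, coeff i j k • frameOf a b d k := by
    intro i j hij
    simp only [frameOf, ← hcdef]
    fin_cases i <;> fin_cases j <;> first
      | exact absurd hij (by decide)
      | simp [Fin.sum_univ_seven, coeff_eq, crossTable, cross_neg_right, cross_neg_left, ← hcdef,
          p03, p04, p05, p06, p13, p14, p15, p16, p23 c hc, p23 a had, p23 b hbd, p26, p34, p35,
          p36, p45, p46, p56, p60, p61]
  have swap : ∀ k, coeff i j k = -coeff j i k := fun k => by
    rw [coeff, cross_swap]; rfl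
  rcases lt_trichotomy i j with h | rfl | h
  · exact key i j h
  · simp [coeff]
  · rw [cross_swap, key j i h]
    simp [swap]

theorem stdForm_frameOf {a b d : Fin 7 → ℝ} (haa : a ⬝ᵥ a = 1) (hbb : b ⬝ᵥ b = 1)
    (hdd : d ⬝ᵥ d = 1) (hab : a ⬝ᵥ b = 0) (had : a ⬝ᵥ d = 0) (hbd : b ⬝ᵥ d = 0)
    (hc : cross a b ⬝ᵥ d = 0) (i : Fin 3 → Fin 7) :
    stdForm (fun k => frameOf a b d (i k)) = stdForm (fun k => Pi.single (i k) 1) := by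
  rw [stdForm_single, stdForm_eq, cross_frameOf haa hbb hdd hab had hbd hc, sum_dotProduct]
  simp [frameOf_dotProduct haa hbb hdd hab had hbd hc]

theorem eq_zero_of_single {p : (Fin 7 → ℝ) → ℝ} (hp : IsLinearMap ℝ p)
    (h : ∀ i, p (Pi.single i 1) = 0) (v : Fin 7 → ℝ) : p v = 0 := by
  have : hp.mk' p = 0 := by
    refine LinearMap.pi_ext' fun i => LinearMap.ext_ring ?_
    simpa using h i
  exact congrArg (fun f => f v) this

/-- A matrix in `𝔤₂`: a skew-symmetric derivation of the cross product. -/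
structure IsG2Matrix (W : Matrix (Fin 7) (Fin 7) ℝ) : Prop where
  skew : Wᵀ = -W
  derivation : ∀ a b, W *ᵥ cross a b = cross (W *ᵥ a) b + cross a (W *ᵥ b)

theorem mulVec_dotProduct_of_skew {W : Matrix (Fin 7) (Fin 7) ℝ} (h : Wᵀ = -W)
    (a b : Fin 7 → ℝ) : (W *ᵥ a) ⬝ᵥ b = -(a ⬝ᵥ (W *ᵥ b)) := by
  rw [dotProduct_comm, dotProduct_mulVec, ← mulVec_transpose, h, neg_mulVec, neg_dotProduct,
    dotProduct_comm]

/-- The hypothesis is that `W` annihilates `φ` on basis triples. It extends to all vectors one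
argument at a time, and skew-symmetry turns the term with `W c` into the derivation rule tested
against `c`. -/
theorem isG2Matrix_of_form {W : Matrix (Fin 7) (Fin 7) ℝ} (hW : Wᵀ = -W)
    (h : ∀ i j k : Fin 7,
      cross (W *ᵥ Pi.single i 1) (Pi.single j 1) ⬝ᵥ Pi.single k 1 +
      cross (Pi.single i 1) (W *ᵥ Pi.single j 1) ⬝ᵥ Pi.single k 1 +
      cross (Pi.single i 1) (Pi.single j 1) ⬝ᵥ (W *ᵥ Pi.single k 1) = 0) : IsG2Matrix W := by
  refine ⟨hW, ?_⟩
  have main : ∀ a b c, cross (W *ᵥ a) b ⬝ᵥ c + cross a (W *ᵥ b) ⬝ᵥ c +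
      cross a b ⬝ᵥ (W *ᵥ c) = 0 := by
    intro a b c
    refine eq_zero_of_single (p := fun c => cross (W *ᵥ a) b ⬝ᵥ c + cross a (W *ᵥ b) ⬝ᵥ c +
      cross a b ⬝ᵥ (W *ᵥ c)) ⟨fun x y => ?_, fun r x => ?_⟩ (fun k => ?_) c
    · simp only [mulVec_add, dotProduct_add]; ring
    · simp only [mulVec_smul, dotProduct_smul, smul_eq_mul]; ring
    refine eq_zero_of_single (p := fun b => cross (W *ᵥ a) b ⬝ᵥ Pi.single k 1 +
      cross a (W *ᵥ b) ⬝ᵥ Pi.single k 1 + cross a b ⬝ᵥ (W *ᵥ Pi.single k 1))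
      ⟨fun x y => ?_, fun r x => ?_⟩ (fun j => ?_) b
    · simp only [mulVec_add, cross_add_right, add_dotProduct]; ring
    · simp only [mulVec_smul, cross_smul_right, smul_dotProduct, smul_eq_mul]; ring
    refine eq_zero_of_single (p := fun a => cross (W *ᵥ a) (Pi.single j 1) ⬝ᵥ Pi.single k 1 +
      cross a (W *ᵥ Pi.single j 1) ⬝ᵥ Pi.single k 1 +
      cross a (Pi.single j 1) ⬝ᵥ (W *ᵥ Pi.single k 1))
      ⟨fun x y => ?_, fun r x => ?_⟩ (fun i => h i j k) a
    · simp only [mulVec_add, cross_add_left, add_dotProduct]; ring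
    · simp only [mulVec_smul, cross_smul_left, smul_dotProduct, smul_eq_mul]; ring
  intro a b
  refine dotProduct_eq _ _ fun c => ?_
  rw [mulVec_dotProduct_of_skew hW, add_dotProduct]
  linarith [main a b c]

/-! ### Clifford multiplication -/

/-- The matrices of `cliff` with integer entries. -/
def cliffInt : Fin 7 → Matrix (Fin 8) (Fin 8) ℤ :=
  let E (i j : Fin 8) : Matrix (Fin 8) (Fin 8) ℤ :=
    Matrix.of fun a b => if a = j ∧ b = i then 1 else if a = i ∧ b = j then -1 else 0
  ![E 0 7 + E 1 6 - E 2 5 - E 3 4, -E 0 6 + E 1 7 + E 2 4 - E 3 5,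
    -E 0 5 + E 1 4 - E 2 7 + E 3 6, -E 0 4 - E 1 5 - E 2 6 - E 3 7,
    -E 0 2 - E 1 3 + E 4 6 + E 5 7, E 0 3 - E 1 2 - E 4 7 + E 5 6,
    E 0 1 - E 2 3 - E 4 5 + E 6 7]

theorem soBasis_apply {i j : Fin 8} (hij : i ≠ j) (a b : Fin 8) :
    soBasis i j a b =
      ((if a = j ∧ b = i then 1 else if a = i ∧ b = j then -1 else 0 : ℤ) : ℝ) := by
  have h1 : (j = a ∧ i = b) ↔ (a = j ∧ b = i) := by simp [eq_comm]
  have h2 : (i = a ∧ j = b) ↔ (a = i ∧ b = j) := by simp [eq_comm]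
  rw [soBasis, Matrix.sub_apply, Matrix.single_apply, Matrix.single_apply]
  simp only [h1, h2]
  by_cases p : a = j ∧ b = i
  · have q : ¬ (a = i ∧ b = j) := fun q => hij (q.1.symm.trans p.1)
    simp [p, hij.symm]
  · by_cases q : a = i ∧ b = j <;> simp [p, q, hij]

theorem cliff_eq_map (i : Fin 7) : cliff i = (cliffInt i).map (fun n : ℤ => (n : ℝ)) := by
  ext a b
  fin_cases i <;>
    simp [cliff, cliffInt, soBasis_apply]

theorem cliff_apply (i : Fin 7) (a b : Fin 8) : cliff i a b = cliffInt i a b := by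
  rw [cliff_eq_map]; rfl

theorem cliff_mul_cliff_apply (i j : Fin 7) (a b : Fin 8) :
    (cliff i * cliff j) a b = ((cliffInt i * cliffInt j) a b : ℤ) := by
  simp [Matrix.mul_apply, cliff_apply]

theorem cliff_mul_cliff (i j : Fin 7) :
    cliff i * cliff j = -(cliff j * cliff i) + if i = j then (-2 : ℝ) • 1 else 0 := by
  have h : ∀ (i j : Fin 7) (a b : Fin 8), (cliffInt i * cliffInt j) a b =
      -(cliffInt j * cliffInt i) a b + if i = j ∧ a = b then -2 else 0 := by decide +kernel
  ext a b
  rw [Matrix.add_apply, Matrix.neg_apply, cliff_mul_cliff_apply, cliff_mul_cliff_apply, h]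
  push_cast
  by_cases hij : i = j <;> by_cases hab : a = b <;> simp [hij, hab]

theorem cliff_transpose (i : Fin 7) : (cliff i)ᵀ = -cliff i := by
  have h : ∀ (i : Fin 7) (a b : Fin 8), cliffInt i b a = -cliffInt i a b := by decide +kernel
  ext a b
  simp [cliff_apply, h i a b]

/-- Clifford multiplication by a vector. -/
def cliffVec (v : Fin 7 → ℝ) : Matrix (Fin 8) (Fin 8) ℝ := ∑ i, v i • cliff i

/-- The spinor `a ψ₁ + v · ψ₁`. -/
def spinorOf (a : ℝ) (v : Fin 7 → ℝ) : Fin 8 → ℝ :=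
  a • basisSpinor 0 + cliffVec v *ᵥ basisSpinor 0

theorem mulVec_basisSpinor (A : Matrix (Fin 8) (Fin 8) ℝ) (k a : Fin 8) :
    (A *ᵥ basisSpinor k) a = A a k := by
  simp [basisSpinor]

theorem cliffVec_add (v w : Fin 7 → ℝ) : cliffVec (v + w) = cliffVec v + cliffVec w := by
  simp [cliffVec, add_smul, Finset.sum_add_distrib]

theorem cliffVec_smul (r : ℝ) (v : Fin 7 → ℝ) : cliffVec (r • v) = r • cliffVec v := by
  simp [cliffVec, Finset.smul_sum, mul_smul]

/-- `cliffVec` as a linear map. -/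
def cliffVecₗ : (Fin 7 → ℝ) →ₗ[ℝ] Matrix (Fin 8) (Fin 8) ℝ where
  toFun := cliffVec
  map_add' := cliffVec_add
  map_smul' := cliffVec_smul

theorem cliffVec_single (i : Fin 7) : cliffVec (Pi.single i 1) = cliff i := by
  simp [cliffVec, Pi.single_apply]

theorem spinorOf_apply (a : ℝ) (v : Fin 7 → ℝ) (x : Fin 8) :
    spinorOf a v x = a * (if x = 0 then 1 else 0) + ∑ i, v i * cliff i x 0 := by
  simp only [spinorOf, Pi.add_apply, mulVec_basisSpinor, cliffVec, Matrix.sum_apply,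
    Matrix.smul_apply, Pi.smul_apply, smul_eq_mul]
  simp [basisSpinor, Pi.single_apply]

/-- The place where the chosen Clifford matrices and the chosen `φ` are seen to fit together: `e_i
e_j ψ₁ = -δ_{ij} ψ₁ + (e_i × e_j) · ψ₁`. -/
theorem cliff_cliff_basisSpinor (i j : Fin 7) :
    (cliff i * cliff j) *ᵥ basisSpinor 0 =
      spinorOf (if i = j then -1 else 0) (cross (Pi.single i 1) (Pi.single j 1)) := by
  have h : ∀ (i j : Fin 7) (a : Fin 8), (cliffInt i * cliffInt j) a 0 =
      (if i = j then -1 else 0) * (if a = 0 then 1 else 0) +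
        ∑ k, crossTable i j k * cliffInt k a 0 := by decide +kernel
  ext a
  rw [mulVec_basisSpinor, cliff_mul_cliff_apply, h, cross_single, spinorOf_apply]
  push_cast
  simp only [cliff_apply]

/-- The coordinates of a spinor in the basis `ψ₁, e₁ψ₁, …, e₇ψ₁`. -/
def vecOf (ψ : Fin 8 → ℝ) : Fin 7 → ℝ := fun i => (cliff i *ᵥ basisSpinor 0) ⬝ᵥ ψ

theorem spinorOf_vecOf (ψ : Fin 8 → ℝ) : spinorOf (ψ 0) (vecOf ψ) = ψ := by
  -- The completeness relation of the orthonormal basis `ψ₁, e₁ψ₁, …, e₇ψ₁`.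
  have h : ∀ a b : Fin 8, (if a = 0 ∧ b = 0 then 1 else 0) +
      ∑ k, cliffInt k a 0 * cliffInt k b 0 = if a = b then 1 else 0 := by decide +kernel
  have h' : ∀ a b : Fin 8, (if a = 0 ∧ b = 0 then (1 : ℝ) else 0) +
      ∑ k, cliff k a 0 * cliff k b 0 = if a = b then 1 else 0 := fun a b => by
    have := congrArg (fun n : ℤ => (n : ℝ)) (h a b)
    push_cast at this
    simpa [cliff_apply] using this
  ext a
  have e : ψ a = ∑ b, ((if a = 0 ∧ b = 0 then (1 : ℝ) else 0) +
      ∑ k, cliff k a 0 * cliff k b 0) * ψ b := by simp [h']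
  rw [e, spinorOf_apply]
  simp only [vecOf, dotProduct, mulVec_basisSpinor, add_mul, Finset.sum_add_distrib,
    Finset.sum_mul]
  congr 1
  · by_cases ha : a = 0 <;> simp [ha]
  · rw [Finset.sum_comm]
    exact Finset.sum_congr rfl fun b _ => Finset.sum_congr rfl fun k _ => by ring

/-- Clifford matrices have zero diagonal entry at `ψ₁`, so the scalar part of a spinor is its
coordinate `0`. -/
theorem spinorOf_zero (a : ℝ) (v : Fin 7 → ℝ) : spinorOf a v 0 = a := by
  have h : ∀ i : Fin 7, cliffInt i 0 0 = 0 := by decide +kernel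
  rw [spinorOf_apply]
  simp [cliff_apply, h]

end G2

/-! ### The spin representation -/

namespace G2

open Matrix

theorem cliffVec_mulVec_basisSpinor (v : Fin 7 → ℝ) :
    cliffVec v *ᵥ basisSpinor 0 = spinorOf 0 v := by
  simp [spinorOf]

theorem spinorOf_add (a b : ℝ) (v w : Fin 7 → ℝ) :
    spinorOf a v + spinorOf b w = spinorOf (a + b) (v + w) := by
  simp only [spinorOf, add_smul, cliffVec_add, add_mulVec]; abel

theorem spinorOf_smul (r a : ℝ) (v : Fin 7 → ℝ) :
    r • spinorOf a v = spinorOf (r * a) (r • v) := by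
  simp only [spinorOf, smul_add, mul_smul, cliffVec_smul, smul_mulVec]

theorem spinorOf_sum {ι : Type*} (s : Finset ι) (a : ι → ℝ) (v : ι → Fin 7 → ℝ) :
    ∑ i ∈ s, spinorOf (a i) (v i) = spinorOf (∑ i ∈ s, a i) (∑ i ∈ s, v i) := by
  classical
  induction s using Finset.induction_on with
  | empty => simp [spinorOf, cliffVec]
  | insert i s hi ih => rw [Finset.sum_insert hi, ih, spinorOf_add, Finset.sum_insert hi,
      Finset.sum_insert hi]

theorem cliffVec_mul_cliffVec_basisSpinor (v w : Fin 7 → ℝ) :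
    (cliffVec v * cliffVec w) *ᵥ basisSpinor 0 = spinorOf (-(v ⬝ᵥ w)) (cross v w) := by
  have e : (cliffVec v * cliffVec w) *ᵥ basisSpinor 0 =
      ∑ i, ∑ j, (v i * w j) • ((cliff i * cliff j) *ᵥ basisSpinor 0) := by
    simp only [cliffVec, Finset.sum_mul, Finset.mul_sum, sum_mulVec, smul_mul_assoc,
      mul_smul_comm, smul_mulVec, Finset.smul_sum, smul_smul]
    rw [Finset.sum_comm]
    simp only [mul_comm]
  simp only [e, cliff_cliff_basisSpinor, spinorOf_smul, spinorOf_sum]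
  congr 1
  · simp [dotProduct]
  · ext k
    simp [cross_eq_sum v w, coeff]

theorem cliffVec_mulVec_spinorOf (v w : Fin 7 → ℝ) (a : ℝ) :
    cliffVec v *ᵥ spinorOf a w = spinorOf (-(v ⬝ᵥ w)) (a • v + cross v w) := by
  rw [spinorOf, mulVec_add, mulVec_smul, mulVec_mulVec, cliffVec_mul_cliffVec_basisSpinor,
    cliffVec_mulVec_basisSpinor, spinorOf_smul, spinorOf_add]
  simp

theorem spinorOf_dotProduct (a b : ℝ) (v w : Fin 7 → ℝ) :
    spinorOf a v ⬝ᵥ spinorOf b w = a * b + v ⬝ᵥ w := by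
  have ht : (cliffVec v)ᵀ = -cliffVec v := by
    simp [cliffVec, transpose_sum, cliff_transpose]
  have h0 : ∀ ψ : Fin 8 → ℝ, basisSpinor 0 ⬝ᵥ ψ = ψ 0 := fun ψ => by simp [basisSpinor]
  conv_lhs => rw [spinorOf]
  rw [add_dotProduct, smul_dotProduct, h0, spinorOf_zero, dotProduct_comm, dotProduct_mulVec,
    ← mulVec_transpose, ht, neg_mulVec, cliffVec_mulVec_spinorOf, neg_dotProduct,
    dotProduct_comm, h0, spinorOf_zero]
  simp

theorem spinorOf_inj {a b : ℝ} {v w : Fin 7 → ℝ} (h : spinorOf a v = spinorOf b w) :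
    a = b ∧ v = w := by
  refine ⟨by rw [← spinorOf_zero a v, h, spinorOf_zero], dotProduct_eq _ _ fun u => ?_⟩
  have := congrArg (fun ψ => ψ ⬝ᵥ spinorOf 0 u) h
  simpa [spinorOf_dotProduct] using this

/-- The commutator rule `[ρ(A), e_k] = A e_k` of the differential of `Spin(7) → SO(7)`. Moving `e_k`
past `e_i e_j` leaves two contractions; by skew-symmetry each contributes `2 A e_k`, which the
factor `1/4` normalises. -/
theorem spinAction_mul_cliff {A : Matrix (Fin 7) (Fin 7) ℝ} (hA : Aᵀ = -A) (k : Fin 7) :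
    spinAction A * cliff k = cliff k * spinAction A + cliffVec (A *ᵥ Pi.single k 1) := by
  have hc : ∀ i j, (cliff i * cliff j) * cliff k = cliff k * (cliff i * cliff j) +
      ((if j = k then (-2 : ℝ) • cliff i else 0) - if i = k then (-2 : ℝ) • cliff j else 0) := by
    intro i j
    rw [mul_assoc, cliff_mul_cliff j k, mul_add, mul_neg, ← mul_assoc, cliff_mul_cliff i k]
    split_ifs <;> simp [add_mul, mul_assoc] <;> abel
  have hs : ∀ i j, A i j = -A j i := fun i j => by
    simpa using congrFun (congrFun hA j) i
  have e : spinAction A * cliff k = (1 / 4 : ℝ) • ∑ i, ∑ j, A j i • (cliff i * cliff j * cliff k) := by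
    simp only [spinAction, smul_mul_assoc, Finset.sum_mul]
  have e' : cliff k * spinAction A = (1 / 4 : ℝ) • ∑ i, ∑ j, A j i • (cliff k * (cliff i * cliff j)) := by
    simp only [spinAction, mul_smul_comm, Finset.mul_sum]
  rw [e, e']
  simp only [hc, smul_add, Finset.sum_add_distrib, smul_sub, Finset.sum_sub_distrib]
  congr 1
  have s1 : ∑ i, ∑ j, A j i • (if j = k then (-2 : ℝ) • cliff i else 0) =
      (2 : ℝ) • ∑ i, A i k • cliff i := by
    simp only [smul_ite, smul_zero, Finset.sum_ite_eq', Finset.mem_univ, if_true, Finset.smul_sum]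
    refine Finset.sum_congr rfl fun i _ => ?_
    rw [hs k i, smul_smul, smul_smul]; congr 1; ring
  have s2 : ∑ i, ∑ j, A j i • (if i = k then (-2 : ℝ) • cliff j else 0) =
      (-2 : ℝ) • ∑ i, A i k • cliff i := by
    rw [Finset.sum_comm]
    simp only [smul_ite, smul_zero, Finset.sum_ite_eq', Finset.mem_univ, if_true, Finset.smul_sum]
    refine Finset.sum_congr rfl fun i _ => ?_
    rw [smul_smul, smul_smul]; congr 1; ring
  rw [s1, s2, cliffVec, smul_smul, smul_smul, ← sub_smul]
  norm_num

theorem spinAction_mul_cliffVec {A : Matrix (Fin 7) (Fin 7) ℝ} (hA : Aᵀ = -A) (v : Fin 7 → ℝ) :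
    spinAction A * cliffVec v = cliffVec v * spinAction A + cliffVec (A *ᵥ v) := by
  have hv : A *ᵥ v = ∑ i, v i • (A *ᵥ Pi.single i 1) := by
    ext k; simp [mulVec, dotProduct, mul_comm]
  have hl : cliffVec (∑ i, v i • (A *ᵥ Pi.single i 1)) =
      ∑ i, v i • cliffVec (A *ᵥ Pi.single i 1) := by
    change cliffVecₗ _ = ∑ i, v i • cliffVecₗ _
    simp
  rw [hv, hl]
  conv_lhs => rw [cliffVec, Finset.mul_sum]
  conv_rhs => rw [cliffVec, Finset.sum_mul, ← Finset.sum_add_distrib]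
  refine Finset.sum_congr rfl fun i _ => ?_
  rw [mul_smul_comm, spinAction_mul_cliff hA, smul_add, smul_mul_assoc]

/-- Since `ψ₂ = e₇ · ψ₁`, the commutator rule gives `0 = ρ(A)ψ₂ = e₇ · ρ(A)ψ₁ + (A e₇) · ψ₁ = (A e₇)
· ψ₁`. -/
theorem mulVec_single_eq_zero_of_mem_su3 {A : Matrix (Fin 7) (Fin 7) ℝ} (hA : A ∈ su3) :
    A *ᵥ Pi.single 6 1 = 0 := by
  obtain ⟨h1, h2, h3⟩ := hA
  have h6 : basisSpinor 1 = cliff 6 *ᵥ basisSpinor 0 := by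
    have : ∀ a : Fin 8, cliffInt 6 a 0 = if a = 1 then 1 else 0 := by decide +kernel
    ext a
    rw [mulVec_basisSpinor, cliff_apply, this]
    simp [basisSpinor, Pi.single_apply]
  rw [h6, mulVec_mulVec, spinAction_mul_cliff h1, add_mulVec, ← mulVec_mulVec, h2, mulVec_zero,
    zero_add, cliffVec_mulVec_basisSpinor] at h3
  exact (spinorOf_inj (h3.trans (show (0 : Fin 8 → ℝ) = spinorOf 0 0 by simp [spinorOf, cliffVec]))).2

-- `𝔤₂` annihilates `ψ₁`: the spinor `ρ(W)ψ₁` is a multiple of `(∑ W_{ji} e_i × e_j) · ψ₁`, and this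
-- vector is the 7-dimensional component of `W` in `Λ² = 𝔤₂ ⊕ ℝ⁷`.
set_option maxHeartbeats 1000000 in
theorem IsG2Matrix.spinAction_basisSpinor {W : Matrix (Fin 7) (Fin 7) ℝ} (hW : IsG2Matrix W) :
    spinAction W *ᵥ basisSpinor 0 = 0 := by
  have hs : ∀ i j, W j i = -W i j := fun i j => by
    simpa using congrFun (congrFun hW.skew i) j
  have d : ∀ i, W i i = 0 := fun i => by linarith [hs i i]
  have e : spinAction W *ᵥ basisSpinor 0 =
      (1 / 4 : ℝ) • ∑ i, ∑ j, W j i • ((cliff i * cliff j) *ᵥ basisSpinor 0) := by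
    simp only [spinAction, smul_mulVec, sum_mulVec]
  have z : spinorOf 0 0 = 0 := by simp [spinorOf, cliffVec]
  simp only [e, cliff_cliff_basisSpinor, spinorOf_smul, spinorOf_sum]
  have key : ∀ i j k, (W *ᵥ cross (Pi.single i 1) (Pi.single j 1)) k =
      cross (W *ᵥ Pi.single i 1) (Pi.single j 1) k + cross (Pi.single i 1) (W *ᵥ Pi.single j 1) k :=
    fun i j k => congrFun (hW.derivation _ _) k
  rw [← z]
  congr 1
  · simp [d]
  -- One triple for each coordinate of the vector, the same as for the Jacobiators: the derivation
  -- rule on the triple is a relation between the three entries of `W` that enter the coordinate.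
  have k0 := key 1 2 3
  have k1 := key 0 2 3
  have k2 := key 0 1 3
  have k3 := key 0 1 2
  have k4 := key 0 1 5
  have k5 := key 0 1 4
  have k6 := key 0 2 5
  simp [mulVec, dotProduct, Fin.sum_univ_seven, cross] at k0 k1 k2 k3 k4 k5 k6
  ext k
  have hk : (∑ i, ∑ j, W j i • cross (Pi.single i (1 : ℝ)) (Pi.single j 1)) k =
      ∑ i, ∑ j, W j i * (crossTable i j k : ℝ) := by
    simp [cross_single, Finset.sum_apply]
  rw [Pi.smul_apply, hk, Pi.zero_apply, smul_eq_zero]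
  right
  fin_cases k <;>
    · simp [Fin.sum_univ_seven, crossTable]
      linarith [hs 0 1, hs 0 2, hs 0 3, hs 0 4, hs 0 5, hs 0 6, hs 1 2, hs 1 3, hs 1 4, hs 1 5,
        hs 1 6, hs 2 3, hs 2 4, hs 2 5, hs 2 6, hs 3 4, hs 3 5, hs 3 6, hs 4 5, hs 4 6, hs 5 6]

theorem IsG2Matrix.spinAction_spinorOf {W : Matrix (Fin 7) (Fin 7) ℝ} (hW : IsG2Matrix W)
    (a : ℝ) (v : Fin 7 → ℝ) : spinAction W *ᵥ spinorOf a v = spinorOf 0 (W *ᵥ v) := by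
  rw [spinorOf, mulVec_add, mulVec_smul, hW.spinAction_basisSpinor, smul_zero, zero_add,
    mulVec_mulVec, spinAction_mul_cliffVec hW.skew, add_mulVec, ← mulVec_mulVec,
    hW.spinAction_basisSpinor, mulVec_zero, zero_add, cliffVec_mulVec_basisSpinor]

/-- On `Δ₇ = ℝ ⊕ ℝ⁷` the lift is `1 ⊕ h`. Since Clifford multiplication is expressed by the inner
and the cross product, it is compatible with any `h` preserving both. -/
theorem exists_isSpinLift {h : Matrix (Fin 7) (Fin 7) ℝ} (ho : hᵀ * h = 1)
    (hc : ∀ a b, h *ᵥ cross a b = cross (h *ᵥ a) (h *ᵥ b)) :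
    ∃ s : Matrix (Fin 8) (Fin 8) ℝ, IsSpinLift h s ∧
      ∀ a v, s *ᵥ spinorOf a v = spinorOf a (h *ᵥ v) := by
  have hvl : ∀ x y : Fin 8 → ℝ, ∀ r : ℝ, vecOf (x + y) = vecOf x + vecOf y ∧
      vecOf (r • x) = r • vecOf x := fun x y r =>
    ⟨by ext; simp [vecOf], by ext; simp [vecOf]⟩
  let f : (Fin 8 → ℝ) →ₗ[ℝ] (Fin 8 → ℝ) :=
    { toFun := fun ψ => spinorOf (ψ 0) (h *ᵥ vecOf ψ)
      map_add' := fun x y => by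
        rw [(hvl x y 0).1, mulVec_add, spinorOf_add]; rfl
      map_smul' := fun r x => by
        rw [(hvl x x r).2, mulVec_smul, RingHom.id_apply, spinorOf_smul]; rfl }
  have hf : ∀ a v, f (spinorOf a v) = spinorOf a (h *ᵥ v) := fun a v => by
    have := spinorOf_inj (spinorOf_vecOf (spinorOf a v))
    change spinorOf _ _ = _
    rw [this.1, this.2]
  have hs : ∀ a v, LinearMap.toMatrix' f *ᵥ spinorOf a v = spinorOf a (h *ᵥ v) := fun a v => by
    rw [LinearMap.toMatrix'_mulVec, hf]
  have hh : ∀ v w, (h *ᵥ v) ⬝ᵥ (h *ᵥ w) = v ⬝ᵥ w := fun v w => by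
    rw [dotProduct_mulVec, ← mulVec_transpose, mulVec_mulVec, ho, one_mulVec]
  refine ⟨LinearMap.toMatrix' f, ⟨?_, fun j => ?_, ?_⟩, hs⟩
  · refine Matrix.ext_of_mulVec_single fun i => ?_
    refine dotProduct_eq _ _ fun ψ => ?_
    rw [← mulVec_mulVec, mulVec_transpose, ← dotProduct_mulVec, ← spinorOf_vecOf ψ,
      ← spinorOf_vecOf (Pi.single i 1), hs, hs, spinorOf_dotProduct, hh, one_mulVec, spinorOf_dotProduct]
  · have hcol : (∑ i, h i j • cliff i) = cliffVec (h *ᵥ Pi.single j 1) := by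
      simp [cliffVec]
    rw [hcol, ← cliffVec_single]
    refine Matrix.ext_of_mulVec_single fun i => ?_
    rw [← mulVec_mulVec, ← mulVec_mulVec, ← spinorOf_vecOf (Pi.single i 1),
      cliffVec_mulVec_spinorOf, hs, hs, cliffVec_mulVec_spinorOf, hh, mulVec_add, mulVec_smul, hc]
  · have : basisSpinor 0 = spinorOf 1 0 := by simp [spinorOf, cliffVec]
    rw [this, hs, mulVec_zero]

end G2

/-! ### The differential of the standard form in terms of the torsion -/

namespace G2

open Matrix

/-- The Levi-Civita symbol. -/
def leviCivita (c : Fin 7 → Fin 7) : ℤ :=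
  ∏ j, ∏ i ∈ Finset.Iio j, if c i < c j then 1 else if c j < c i then -1 else 0

/-- Replaces the volume form on basis vectors by an integer product over pairs, which the kernel can
evaluate. -/
theorem det_eq_leviCivita (c : Fin 7 → Fin 7) :
    (Matrix.of fun k l : Fin 7 => if k = c l then (1 : ℝ) else 0).det = leviCivita c := by
  by_cases hc : Function.Injective c
  · set σ : Equiv.Perm (Fin 7) := Equiv.ofBijective c (Finite.injective_iff_bijective.1 hc) with hσ
    have h1 : (Matrix.of fun k l : Fin 7 => if k = c l then (1 : ℝ) else 0) =
        (Equiv.Perm.permMatrix ℝ σ)ᵀ := by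
      ext k l
      simp [Equiv.Perm.permMatrix, PEquiv.toMatrix_apply, hσ, eq_comm]
    rw [h1, Matrix.det_transpose, Matrix.det_permutation, Equiv.Perm.sign_eq_prod_prod_Iio]
    simp only [leviCivita]
    push_cast
    refine Finset.prod_congr rfl fun j _ => Finset.prod_congr rfl fun i hi => ?_
    have hne : c i ≠ c j := fun h => (Finset.mem_Iio.1 hi).ne (hc h)
    have e : ∀ x, σ x = c x := fun _ => rfl
    rw [e, e]
    rcases lt_or_gt_of_ne hne with h | h
    · simp [h]
    · simp [h, h.not_gt]
  · have : ∃ i j, i < j ∧ c i = c j := by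
      simp only [Function.Injective, not_forall] at hc
      obtain ⟨a, b, hab, hne⟩ := hc
      rcases lt_or_gt_of_ne hne with h | h
      exacts [⟨a, b, h, hab⟩, ⟨b, a, h, hab.symm⟩]
    obtain ⟨i, j, hij, e⟩ := this
    have hz : leviCivita c = 0 := by
      refine Finset.prod_eq_zero (Finset.mem_univ j)
        (Finset.prod_eq_zero (Finset.mem_Iio.2 hij) ?_)
      simp [e]
    rw [hz, Matrix.det_zero_of_column_eq hij.ne (fun k => by simp [e])]
    simp

/-- The coefficients of the 4-form `∑ (e_m ⌟ t) ∧ (e_m ⌟ φ)`. -/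
def torsionWedge {R : Type*} [CommRing R] (t f : Fin 7 → Fin 7 → Fin 7 → R) (i j k l : Fin 7) : R :=
  ∑ m, (t i j m * f m k l - t i k m * f m j l + t i l m * f m j k + t j k m * f m i l
    - t j l m * f m i k + t k l m * f m i j)

/-- The identity `∑ (e_m ⌟ φ) ∧ (e_m ⌟ φ) = 6 ⋆φ`; the factor 6 is the number of orderings of `a, b,
c`. The `if` spares the evaluation of the sign for the triples not occurring in `φ`. -/
theorem torsionWedge_crossTable (i j k l : Fin 7) (hij : i < j) (hjk : j < k) (hkl : k < l) :
    torsionWedge crossTable crossTable i j k l =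
      ∑ a, ∑ b, ∑ c, if crossTable a b c = 0 then 0 else
        crossTable a b c * leviCivita ![a, b, c, i, j, k, l] := by
  revert i j k l; decide +kernel

theorem torsionWedge_coeff {i j k l : Fin 7} (hij : i < j) (hjk : j < k) (hkl : k < l) :
    torsionWedge coeff coeff i j k l = ∑ a : Fin 3 → Fin 7, coeff (a 0) (a 1) (a 2) *
      (Matrix.of fun m n : Fin 7 =>
        if m = ![a 0, a 1, a 2, i, j, k, l] n then (1 : ℝ) else 0).det := by
  let e : Fin 7 × Fin 7 × Fin 7 ≃ (Fin 3 → Fin 7) :=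
    { toFun := fun p => ![p.1, p.2.1, p.2.2]
      invFun := fun v => (v 0, v 1, v 2)
      left_inv := fun p => rfl
      right_inv := fun v => by ext a; fin_cases a <;> rfl }
  rw [← Equiv.sum_comp e, Fintype.sum_prod_type]
  simp only [Fintype.sum_prod_type, det_eq_leviCivita]
  have h := congrArg (fun n : ℤ => (n : ℝ)) (torsionWedge_crossTable i j k l hij hjk hkl)
  simp only [torsionWedge] at h ⊢
  push_cast at h
  simp only [coeff_eq]
  refine h.trans (Finset.sum_congr rfl fun a _ => Finset.sum_congr rfl fun b _ =>
    Finset.sum_congr rfl fun c _ => ?_)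
  change _ = (crossTable a b c : ℝ) * (leviCivita ![a, b, c, i, j, k, l] : ℝ)
  split_ifs with h0
  · simp [h0]
  · rfl

/-- The index `m` with `e_k × e_l = ± e_m`. -/
def crossIndex : Fin 7 → Fin 7 → Fin 7 :=
  -- The diagonal zeros are placeholders: `crossSign` vanishes there.
  ![![0, 6, 4, 5, 2, 3, 1], ![6, 0, 5, 4, 3, 2, 0], ![4, 5, 0, 6, 0, 1, 3], ![5, 4, 6, 0, 1, 0,
    2], ![2, 3, 0, 1, 0, 6, 5], ![3, 2, 1, 0, 6, 0, 4], ![1, 0, 3, 2, 5, 4, 0]]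

/-- The sign in `e_k × e_l = ± e_m`. -/
def crossSign : Fin 7 → Fin 7 → ℤ :=
  ![![0, 1, 1, -1, -1, 1, -1], ![-1, 0, -1, -1, 1, 1, 1], ![-1, 1, 0, 1, 1, -1, -1], ![1, 1, -1,
    0, -1, -1, 1], ![1, -1, -1, 1, 0, 1, -1], ![-1, -1, 1, 1, -1, 0, 1], ![1, -1, 1, -1, 1, -1,
    0]]

theorem sum_mul_coeff (t : Fin 7 → ℝ) (k l : Fin 7) :
    ∑ m, t m * coeff m k l = crossSign k l * t (crossIndex k l) := by
  have h : ∀ m k l : Fin 7, crossTable m k l = if m = crossIndex k l then crossSign k l else 0 := by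
    decide +kernel
  simp [coeff_eq, h, mul_comm]

/-- A totally skew-symmetric tensor `t` with `∑ (e_m ⌟ t) ∧ (e_m ⌟ φ) = 0`. -/
structure IsTorsionKernel (t : Fin 7 → Fin 7 → Fin 7 → ℝ) : Prop where
  skew₁₂ : ∀ i j k, t j i k = -t i j k
  skew₂₃ : ∀ i j k, t i k j = -t i j k
  wedge : ∀ i j k l, i < j → j < k → k < l → torsionWedge t coeff i j k l = 0

/-- A summand of `torsionWedge`. -/
def wedgeTerm (t : Fin 7 → Fin 7 → Fin 7 → ℝ) (i j k l : Fin 7) : ℝ :=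
  crossSign k l * t i j (crossIndex k l)

/-! ### Injectivity of `t ↦ ∑ (e_m ⌟ t) ∧ (e_m ⌟ φ)` on 3-forms -/

namespace IsTorsionKernel

theorem wedgeTerm_sum {t : Fin 7 → Fin 7 → Fin 7 → ℝ} (ht : IsTorsionKernel t)
    (i j k l : Fin 7) (h : i < j ∧ j < k ∧ k < l) :
    wedgeTerm t i j k l - wedgeTerm t i k j l + wedgeTerm t i l j k + wedgeTerm t j k i l -
      wedgeTerm t j l i k + wedgeTerm t k l i j = 0 := by
  have := ht.wedge i j k l h.1 h.2.1 h.2.2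
  simpa only [wedgeTerm, torsionWedge, Finset.sum_add_distrib, Finset.sum_sub_distrib,
    sum_mul_coeff] using this

/-- Brings a coefficient of `t` to sorted indices. The index supplied by `φ` is last, in the middle
or first; only the middle position costs a sign. The alternatives are decidable, so each use is
settled by `decide`. -/
theorem wedgeTerm_sorted {t : Fin 7 → Fin 7 → Fin 7 → ℝ} (ht : IsTorsionKernel t)
    (i j k l a b c : Fin 7) (s : ℤ)
    (h : (crossSign k l = s ∧ i = a ∧ j = b ∧ crossIndex k l = c) ∨
      (crossSign k l = -s ∧ i = a ∧ j = c ∧ crossIndex k l = b) ∨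
      (crossSign k l = s ∧ i = b ∧ j = c ∧ crossIndex k l = a)) :
    wedgeTerm t i j k l = s * t a b c := by
  rcases h with ⟨h, rfl, rfl, rfl⟩ | ⟨h, rfl, rfl, rfl⟩ | ⟨h, rfl, rfl, rfl⟩
  · rw [wedgeTerm, h]
  · rw [wedgeTerm, h, ht.skew₂₃ i _ j]; push_cast; ring
  · rw [wedgeTerm, h, ht.skew₂₃ i _ j, ht.skew₁₂ _ i j]; ring

theorem wedgeTerm_eq_zero {t : Fin 7 → Fin 7 → Fin 7 → ℝ} (ht : IsTorsionKernel t)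
    (i j k l : Fin 7)
    (h : crossSign k l = 0 ∨ i = crossIndex k l ∨ j = crossIndex k l) :
    wedgeTerm t i j k l = 0 := by
  rcases h with h | h | h
  · simp [wedgeTerm, h]
  · have := ht.skew₂₃ i j i
    have h2 := ht.skew₁₂ i i j
    rw [wedgeTerm, ← h, show t i j i = 0 by linarith, mul_zero]
  · have := ht.skew₂₃ i j j
    rw [wedgeTerm, ← h, show t i j j = 0 by linarith, mul_zero]

/-- The diagonal sign changes preserving `φ` split the 35 equations in 35 unknowns into independent
blocks. Labelling the indices by the non-zero elements of `𝔽₂³` so that the triples of `φ` sum to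
zero, a block collects the triples and quadruples with a given label sum: seven blocks of size four,
and one of size seven for the triples of `φ` themselves. Each block is a non-singular system, solved
by linear arithmetic. -/
theorem eq_zero_of_mem_block0 {t : Fin 7 → Fin 7 → Fin 7 → ℝ} (ht : IsTorsionKernel t) : ∀ p ∈
    ([(0, 1, 2), (0, 4, 6), (1, 5, 6), (2, 4, 5)] : List (Fin 7 × Fin 7 × Fin 7)), t p.1 p.2.1
    p.2.2 = 0 := by
  have h0136 := ht.wedgeTerm_sum 0 1 3 6 (by decide)
  rw [ht.wedgeTerm_sorted 0 1 3 6 0 1 2 1 (by decide),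
    ht.wedgeTerm_eq_zero 0 3 1 6 (by decide),
    ht.wedgeTerm_sorted 0 6 1 3 0 4 6 1 (by decide),
    ht.wedgeTerm_eq_zero 1 3 0 6 (by decide),
    ht.wedgeTerm_sorted 1 6 0 3 1 5 6 1 (by decide),
    ht.wedgeTerm_eq_zero 3 6 0 1 (by decide)] at h0136
  have h0234 := ht.wedgeTerm_sum 0 2 3 4 (by decide)
  rw [ht.wedgeTerm_sorted 0 2 3 4 0 1 2 1 (by decide),
    ht.wedgeTerm_eq_zero 0 3 2 4 (by decide),
    ht.wedgeTerm_sorted 0 4 2 3 0 4 6 1 (by decide),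
    ht.wedgeTerm_eq_zero 2 3 0 4 (by decide),
    ht.wedgeTerm_sorted 2 4 0 3 2 4 5 (-1) (by decide),
    ht.wedgeTerm_eq_zero 3 4 0 2 (by decide)] at h0234
  have h1235 := ht.wedgeTerm_sum 1 2 3 5 (by decide)
  rw [ht.wedgeTerm_sorted 1 2 3 5 0 1 2 (-1) (by decide),
    ht.wedgeTerm_eq_zero 1 3 2 5 (by decide),
    ht.wedgeTerm_sorted 1 5 2 3 1 5 6 1 (by decide),
    ht.wedgeTerm_eq_zero 2 3 1 5 (by decide),
    ht.wedgeTerm_sorted 2 5 1 3 2 4 5 1 (by decide),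
    ht.wedgeTerm_eq_zero 3 5 1 2 (by decide)] at h1235
  have h3456 := ht.wedgeTerm_sum 3 4 5 6 (by decide)
  rw [ht.wedgeTerm_eq_zero 3 4 5 6 (by decide),
    ht.wedgeTerm_eq_zero 3 5 4 6 (by decide),
    ht.wedgeTerm_eq_zero 3 6 4 5 (by decide),
    ht.wedgeTerm_sorted 4 5 3 6 2 4 5 1 (by decide),
    ht.wedgeTerm_sorted 4 6 3 5 0 4 6 (-1) (by decide),
    ht.wedgeTerm_sorted 5 6 3 4 1 5 6 (-1) (by decide)] at h3456
  push_cast at h0136 h0234 h1235 h3456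
  simp only [List.forall_mem_cons]
  exact ⟨by linarith, by linarith, by linarith, by linarith, by simp⟩

theorem eq_zero_of_mem_block1 {t : Fin 7 → Fin 7 → Fin 7 → ℝ} (ht : IsTorsionKernel t) : ∀ p ∈
    ([(0, 1, 3), (0, 5, 6), (1, 4, 6), (3, 4, 5)] : List (Fin 7 × Fin 7 × Fin 7)), t p.1 p.2.1
    p.2.2 = 0 := by
  have h0126 := ht.wedgeTerm_sum 0 1 2 6 (by decide)
  rw [ht.wedgeTerm_sorted 0 1 2 6 0 1 3 (-1) (by decide),
    ht.wedgeTerm_eq_zero 0 2 1 6 (by decide),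
    ht.wedgeTerm_sorted 0 6 1 2 0 5 6 1 (by decide),
    ht.wedgeTerm_eq_zero 1 2 0 6 (by decide),
    ht.wedgeTerm_sorted 1 6 0 2 1 4 6 (-1) (by decide),
    ht.wedgeTerm_eq_zero 2 6 0 1 (by decide)] at h0126
  have h0235 := ht.wedgeTerm_sum 0 2 3 5 (by decide)
  rw [ht.wedgeTerm_eq_zero 0 2 3 5 (by decide),
    ht.wedgeTerm_sorted 0 3 2 5 0 1 3 1 (by decide),
    ht.wedgeTerm_sorted 0 5 2 3 0 5 6 1 (by decide),
    ht.wedgeTerm_eq_zero 2 3 0 5 (by decide),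
    ht.wedgeTerm_eq_zero 2 5 0 3 (by decide),
    ht.wedgeTerm_sorted 3 5 0 2 3 4 5 (-1) (by decide)] at h0235
  have h1234 := ht.wedgeTerm_sum 1 2 3 4 (by decide)
  rw [ht.wedgeTerm_eq_zero 1 2 3 4 (by decide),
    ht.wedgeTerm_sorted 1 3 2 4 0 1 3 1 (by decide),
    ht.wedgeTerm_sorted 1 4 2 3 1 4 6 1 (by decide),
    ht.wedgeTerm_eq_zero 2 3 1 4 (by decide),
    ht.wedgeTerm_eq_zero 2 4 1 3 (by decide),
    ht.wedgeTerm_sorted 3 4 1 2 3 4 5 (-1) (by decide)] at h1234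
  have h2456 := ht.wedgeTerm_sum 2 4 5 6 (by decide)
  rw [ht.wedgeTerm_eq_zero 2 4 5 6 (by decide),
    ht.wedgeTerm_eq_zero 2 5 4 6 (by decide),
    ht.wedgeTerm_eq_zero 2 6 4 5 (by decide),
    ht.wedgeTerm_sorted 4 5 2 6 3 4 5 (-1) (by decide),
    ht.wedgeTerm_sorted 4 6 2 5 1 4 6 (-1) (by decide),
    ht.wedgeTerm_sorted 5 6 2 4 0 5 6 1 (by decide)] at h2456
  push_cast at h0126 h0235 h1234 h2456
  simp only [List.forall_mem_cons]
  exact ⟨by linarith, by linarith, by linarith, by linarith, by simp⟩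

theorem eq_zero_of_mem_block2 {t : Fin 7 → Fin 7 → Fin 7 → ℝ} (ht : IsTorsionKernel t) : ∀ p ∈
    ([(0, 1, 4), (0, 2, 6), (1, 3, 6), (2, 3, 4)] : List (Fin 7 × Fin 7 × Fin 7)), t p.1 p.2.1
    p.2.2 = 0 := by
  have h0156 := ht.wedgeTerm_sum 0 1 5 6 (by decide)
  rw [ht.wedgeTerm_sorted 0 1 5 6 0 1 4 1 (by decide),
    ht.wedgeTerm_eq_zero 0 5 1 6 (by decide),
    ht.wedgeTerm_sorted 0 6 1 5 0 2 6 (-1) (by decide),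
    ht.wedgeTerm_eq_zero 1 5 0 6 (by decide),
    ht.wedgeTerm_sorted 1 6 0 5 1 3 6 (-1) (by decide),
    ht.wedgeTerm_eq_zero 5 6 0 1 (by decide)] at h0156
  have h0245 := ht.wedgeTerm_sum 0 2 4 5 (by decide)
  rw [ht.wedgeTerm_sorted 0 2 4 5 0 2 6 1 (by decide),
    ht.wedgeTerm_sorted 0 4 2 5 0 1 4 1 (by decide),
    ht.wedgeTerm_eq_zero 0 5 2 4 (by decide),
    ht.wedgeTerm_sorted 2 4 0 5 2 3 4 (-1) (by decide),
    ht.wedgeTerm_eq_zero 2 5 0 4 (by decide),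
    ht.wedgeTerm_eq_zero 4 5 0 2 (by decide)] at h0245
  have h1345 := ht.wedgeTerm_sum 1 3 4 5 (by decide)
  rw [ht.wedgeTerm_sorted 1 3 4 5 1 3 6 1 (by decide),
    ht.wedgeTerm_sorted 1 4 3 5 0 1 4 (-1) (by decide),
    ht.wedgeTerm_eq_zero 1 5 3 4 (by decide),
    ht.wedgeTerm_sorted 3 4 1 5 2 3 4 1 (by decide),
    ht.wedgeTerm_eq_zero 3 5 1 4 (by decide),
    ht.wedgeTerm_eq_zero 4 5 1 3 (by decide)] at h1345
  have h2356 := ht.wedgeTerm_sum 2 3 5 6 (by decide)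
  rw [ht.wedgeTerm_sorted 2 3 5 6 2 3 4 1 (by decide),
    ht.wedgeTerm_eq_zero 2 5 3 6 (by decide),
    ht.wedgeTerm_sorted 2 6 3 5 0 2 6 (-1) (by decide),
    ht.wedgeTerm_eq_zero 3 5 2 6 (by decide),
    ht.wedgeTerm_sorted 3 6 2 5 1 3 6 (-1) (by decide),
    ht.wedgeTerm_eq_zero 5 6 2 3 (by decide)] at h2356
  push_cast at h0156 h0245 h1345 h2356
  simp only [List.forall_mem_cons]
  exact ⟨by linarith, by linarith, by linarith, by linarith, by simp⟩

theorem eq_zero_of_mem_block3 {t : Fin 7 → Fin 7 → Fin 7 → ℝ} (ht : IsTorsionKernel t) : ∀ p ∈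
    ([(0, 1, 5), (0, 3, 6), (1, 2, 6), (2, 3, 5)] : List (Fin 7 × Fin 7 × Fin 7)), t p.1 p.2.1
    p.2.2 = 0 := by
  have h0146 := ht.wedgeTerm_sum 0 1 4 6 (by decide)
  rw [ht.wedgeTerm_sorted 0 1 4 6 0 1 5 (-1) (by decide),
    ht.wedgeTerm_eq_zero 0 4 1 6 (by decide),
    ht.wedgeTerm_sorted 0 6 1 4 0 3 6 (-1) (by decide),
    ht.wedgeTerm_eq_zero 1 4 0 6 (by decide),
    ht.wedgeTerm_sorted 1 6 0 4 1 2 6 1 (by decide),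
    ht.wedgeTerm_eq_zero 4 6 0 1 (by decide)] at h0146
  have h0345 := ht.wedgeTerm_sum 0 3 4 5 (by decide)
  rw [ht.wedgeTerm_sorted 0 3 4 5 0 3 6 1 (by decide),
    ht.wedgeTerm_eq_zero 0 4 3 5 (by decide),
    ht.wedgeTerm_sorted 0 5 3 4 0 1 5 1 (by decide),
    ht.wedgeTerm_eq_zero 3 4 0 5 (by decide),
    ht.wedgeTerm_sorted 3 5 0 4 2 3 5 (-1) (by decide),
    ht.wedgeTerm_eq_zero 4 5 0 3 (by decide)] at h0345
  have h1245 := ht.wedgeTerm_sum 1 2 4 5 (by decide)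
  rw [ht.wedgeTerm_sorted 1 2 4 5 1 2 6 1 (by decide),
    ht.wedgeTerm_eq_zero 1 4 2 5 (by decide),
    ht.wedgeTerm_sorted 1 5 2 4 0 1 5 1 (by decide),
    ht.wedgeTerm_eq_zero 2 4 1 5 (by decide),
    ht.wedgeTerm_sorted 2 5 1 4 2 3 5 (-1) (by decide),
    ht.wedgeTerm_eq_zero 4 5 1 2 (by decide)] at h1245
  have h2346 := ht.wedgeTerm_sum 2 3 4 6 (by decide)
  rw [ht.wedgeTerm_sorted 2 3 4 6 2 3 5 (-1) (by decide),
    ht.wedgeTerm_eq_zero 2 4 3 6 (by decide),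
    ht.wedgeTerm_sorted 2 6 3 4 1 2 6 (-1) (by decide),
    ht.wedgeTerm_eq_zero 3 4 2 6 (by decide),
    ht.wedgeTerm_sorted 3 6 2 4 0 3 6 1 (by decide),
    ht.wedgeTerm_eq_zero 4 6 2 3 (by decide)] at h2346
  push_cast at h0146 h0345 h1245 h2346
  simp only [List.forall_mem_cons]
  exact ⟨by linarith, by linarith, by linarith, by linarith, by simp⟩

theorem eq_zero_of_mem_block4 {t : Fin 7 → Fin 7 → Fin 7 → ℝ} (ht : IsTorsionKernel t) : ∀ p ∈
    ([(0, 1, 6), (0, 2, 4), (0, 3, 5), (1, 2, 5), (1, 3, 4), (2, 3, 6), (4, 5, 6)] : List (Fin 7 ×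
    Fin 7 × Fin 7)), t p.1 p.2.1 p.2.2 = 0 := by
  have h0123 := ht.wedgeTerm_sum 0 1 2 3 (by decide)
  rw [ht.wedgeTerm_sorted 0 1 2 3 0 1 6 1 (by decide),
    ht.wedgeTerm_sorted 0 2 1 3 0 2 4 (-1) (by decide),
    ht.wedgeTerm_sorted 0 3 1 2 0 3 5 (-1) (by decide),
    ht.wedgeTerm_sorted 1 2 0 3 1 2 5 (-1) (by decide),
    ht.wedgeTerm_sorted 1 3 0 2 1 3 4 1 (by decide),
    ht.wedgeTerm_sorted 2 3 0 1 2 3 6 1 (by decide)] at h0123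
  have h0145 := ht.wedgeTerm_sum 0 1 4 5 (by decide)
  rw [ht.wedgeTerm_sorted 0 1 4 5 0 1 6 1 (by decide),
    ht.wedgeTerm_sorted 0 4 1 5 0 2 4 (-1) (by decide),
    ht.wedgeTerm_sorted 0 5 1 4 0 3 5 (-1) (by decide),
    ht.wedgeTerm_sorted 1 4 0 5 1 3 4 (-1) (by decide),
    ht.wedgeTerm_sorted 1 5 0 4 1 2 5 1 (by decide),
    ht.wedgeTerm_sorted 4 5 0 1 4 5 6 1 (by decide)] at h0145
  have h0256 := ht.wedgeTerm_sum 0 2 5 6 (by decide)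
  rw [ht.wedgeTerm_sorted 0 2 5 6 0 2 4 1 (by decide),
    ht.wedgeTerm_sorted 0 5 2 6 0 3 5 1 (by decide),
    ht.wedgeTerm_sorted 0 6 2 5 0 1 6 1 (by decide),
    ht.wedgeTerm_sorted 2 5 0 6 1 2 5 (-1) (by decide),
    ht.wedgeTerm_sorted 2 6 0 5 2 3 6 (-1) (by decide),
    ht.wedgeTerm_sorted 5 6 0 2 4 5 6 1 (by decide)] at h0256
  have h0346 := ht.wedgeTerm_sum 0 3 4 6 (by decide)
  rw [ht.wedgeTerm_sorted 0 3 4 6 0 3 5 (-1) (by decide),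
    ht.wedgeTerm_sorted 0 4 3 6 0 2 4 (-1) (by decide),
    ht.wedgeTerm_sorted 0 6 3 4 0 1 6 1 (by decide),
    ht.wedgeTerm_sorted 3 4 0 6 1 3 4 (-1) (by decide),
    ht.wedgeTerm_sorted 3 6 0 4 2 3 6 (-1) (by decide),
    ht.wedgeTerm_sorted 4 6 0 3 4 5 6 1 (by decide)] at h0346
  have h1246 := ht.wedgeTerm_sum 1 2 4 6 (by decide)
  rw [ht.wedgeTerm_sorted 1 2 4 6 1 2 5 (-1) (by decide),
    ht.wedgeTerm_sorted 1 4 2 6 1 3 4 1 (by decide),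
    ht.wedgeTerm_sorted 1 6 2 4 0 1 6 1 (by decide),
    ht.wedgeTerm_sorted 2 4 1 6 0 2 4 1 (by decide),
    ht.wedgeTerm_sorted 2 6 1 4 2 3 6 (-1) (by decide),
    ht.wedgeTerm_sorted 4 6 1 2 4 5 6 1 (by decide)] at h1246
  have h1356 := ht.wedgeTerm_sum 1 3 5 6 (by decide)
  rw [ht.wedgeTerm_sorted 1 3 5 6 1 3 4 1 (by decide),
    ht.wedgeTerm_sorted 1 5 3 6 1 2 5 (-1) (by decide),
    ht.wedgeTerm_sorted 1 6 3 5 0 1 6 (-1) (by decide),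
    ht.wedgeTerm_sorted 3 5 1 6 0 3 5 1 (by decide),
    ht.wedgeTerm_sorted 3 6 1 5 2 3 6 1 (by decide),
    ht.wedgeTerm_sorted 5 6 1 3 4 5 6 (-1) (by decide)] at h1356
  have h2345 := ht.wedgeTerm_sum 2 3 4 5 (by decide)
  rw [ht.wedgeTerm_sorted 2 3 4 5 2 3 6 1 (by decide),
    ht.wedgeTerm_sorted 2 4 3 5 0 2 4 (-1) (by decide),
    ht.wedgeTerm_sorted 2 5 3 4 1 2 5 (-1) (by decide),
    ht.wedgeTerm_sorted 3 4 2 5 1 3 4 (-1) (by decide),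
    ht.wedgeTerm_sorted 3 5 2 4 0 3 5 1 (by decide),
    ht.wedgeTerm_sorted 4 5 2 3 4 5 6 1 (by decide)] at h2345
  push_cast at h0123 h0145 h0256 h0346 h1246 h1356 h2345
  simp only [List.forall_mem_cons]
  exact ⟨by linarith, by linarith, by linarith, by linarith, by linarith, by linarith, by linarith, by simp⟩

theorem eq_zero_of_mem_block5 {t : Fin 7 → Fin 7 → Fin 7 → ℝ} (ht : IsTorsionKernel t) : ∀ p ∈
    ([(0, 2, 3), (0, 4, 5), (2, 4, 6), (3, 5, 6)] : List (Fin 7 × Fin 7 × Fin 7)), t p.1 p.2.1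
    p.2.2 = 0 := by
  have h0124 := ht.wedgeTerm_sum 0 1 2 4 (by decide)
  rw [ht.wedgeTerm_eq_zero 0 1 2 4 (by decide),
    ht.wedgeTerm_sorted 0 2 1 4 0 2 3 1 (by decide),
    ht.wedgeTerm_sorted 0 4 1 2 0 4 5 (-1) (by decide),
    ht.wedgeTerm_eq_zero 1 2 0 4 (by decide),
    ht.wedgeTerm_eq_zero 1 4 0 2 (by decide),
    ht.wedgeTerm_sorted 2 4 0 1 2 4 6 1 (by decide)] at h0124
  have h0135 := ht.wedgeTerm_sum 0 1 3 5 (by decide)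
  rw [ht.wedgeTerm_eq_zero 0 1 3 5 (by decide),
    ht.wedgeTerm_sorted 0 3 1 5 0 2 3 (-1) (by decide),
    ht.wedgeTerm_sorted 0 5 1 3 0 4 5 1 (by decide),
    ht.wedgeTerm_eq_zero 1 3 0 5 (by decide),
    ht.wedgeTerm_eq_zero 1 5 0 3 (by decide),
    ht.wedgeTerm_sorted 3 5 0 1 3 5 6 1 (by decide)] at h0135
  have h1236 := ht.wedgeTerm_sum 1 2 3 6 (by decide)
  rw [ht.wedgeTerm_eq_zero 1 2 3 6 (by decide),
    ht.wedgeTerm_eq_zero 1 3 2 6 (by decide),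
    ht.wedgeTerm_eq_zero 1 6 2 3 (by decide),
    ht.wedgeTerm_sorted 2 3 1 6 0 2 3 1 (by decide),
    ht.wedgeTerm_sorted 2 6 1 3 2 4 6 1 (by decide),
    ht.wedgeTerm_sorted 3 6 1 2 3 5 6 1 (by decide)] at h1236
  have h1456 := ht.wedgeTerm_sum 1 4 5 6 (by decide)
  rw [ht.wedgeTerm_eq_zero 1 4 5 6 (by decide),
    ht.wedgeTerm_eq_zero 1 5 4 6 (by decide),
    ht.wedgeTerm_eq_zero 1 6 4 5 (by decide),
    ht.wedgeTerm_sorted 4 5 1 6 0 4 5 1 (by decide),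
    ht.wedgeTerm_sorted 4 6 1 5 2 4 6 1 (by decide),
    ht.wedgeTerm_sorted 5 6 1 4 3 5 6 1 (by decide)] at h1456
  push_cast at h0124 h0135 h1236 h1456
  simp only [List.forall_mem_cons]
  exact ⟨by linarith, by linarith, by linarith, by linarith, by simp⟩

theorem eq_zero_of_mem_block6 {t : Fin 7 → Fin 7 → Fin 7 → ℝ} (ht : IsTorsionKernel t) : ∀ p ∈
    ([(0, 2, 5), (0, 3, 4), (1, 2, 4), (1, 3, 5)] : List (Fin 7 × Fin 7 × Fin 7)), t p.1 p.2.1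
    p.2.2 = 0 := by
  have h0246 := ht.wedgeTerm_sum 0 2 4 6 (by decide)
  rw [ht.wedgeTerm_sorted 0 2 4 6 0 2 5 (-1) (by decide),
    ht.wedgeTerm_sorted 0 4 2 6 0 3 4 1 (by decide),
    ht.wedgeTerm_eq_zero 0 6 2 4 (by decide),
    ht.wedgeTerm_sorted 2 4 0 6 1 2 4 (-1) (by decide),
    ht.wedgeTerm_eq_zero 2 6 0 4 (by decide),
    ht.wedgeTerm_eq_zero 4 6 0 2 (by decide)] at h0246
  have h0356 := ht.wedgeTerm_sum 0 3 5 6 (by decide)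
  rw [ht.wedgeTerm_sorted 0 3 5 6 0 3 4 1 (by decide),
    ht.wedgeTerm_sorted 0 5 3 6 0 2 5 (-1) (by decide),
    ht.wedgeTerm_eq_zero 0 6 3 5 (by decide),
    ht.wedgeTerm_sorted 3 5 0 6 1 3 5 (-1) (by decide),
    ht.wedgeTerm_eq_zero 3 6 0 5 (by decide),
    ht.wedgeTerm_eq_zero 5 6 0 3 (by decide)] at h0356
  have h1256 := ht.wedgeTerm_sum 1 2 5 6 (by decide)
  rw [ht.wedgeTerm_sorted 1 2 5 6 1 2 4 1 (by decide),
    ht.wedgeTerm_sorted 1 5 2 6 1 3 5 1 (by decide),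
    ht.wedgeTerm_eq_zero 1 6 2 5 (by decide),
    ht.wedgeTerm_sorted 2 5 1 6 0 2 5 1 (by decide),
    ht.wedgeTerm_eq_zero 2 6 1 5 (by decide),
    ht.wedgeTerm_eq_zero 5 6 1 2 (by decide)] at h1256
  have h1346 := ht.wedgeTerm_sum 1 3 4 6 (by decide)
  rw [ht.wedgeTerm_sorted 1 3 4 6 1 3 5 (-1) (by decide),
    ht.wedgeTerm_sorted 1 4 3 6 1 2 4 (-1) (by decide),
    ht.wedgeTerm_eq_zero 1 6 3 4 (by decide),
    ht.wedgeTerm_sorted 3 4 1 6 0 3 4 1 (by decide),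
    ht.wedgeTerm_eq_zero 3 6 1 4 (by decide),
    ht.wedgeTerm_eq_zero 4 6 1 3 (by decide)] at h1346
  push_cast at h0246 h0356 h1256 h1346
  simp only [List.forall_mem_cons]
  exact ⟨by linarith, by linarith, by linarith, by linarith, by simp⟩

theorem eq_zero_of_mem_block7 {t : Fin 7 → Fin 7 → Fin 7 → ℝ} (ht : IsTorsionKernel t) : ∀ p ∈
    ([(1, 2, 3), (1, 4, 5), (2, 5, 6), (3, 4, 6)] : List (Fin 7 × Fin 7 × Fin 7)), t p.1 p.2.1
    p.2.2 = 0 := by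
  have h0125 := ht.wedgeTerm_sum 0 1 2 5 (by decide)
  rw [ht.wedgeTerm_eq_zero 0 1 2 5 (by decide),
    ht.wedgeTerm_eq_zero 0 2 1 5 (by decide),
    ht.wedgeTerm_eq_zero 0 5 1 2 (by decide),
    ht.wedgeTerm_sorted 1 2 0 5 1 2 3 1 (by decide),
    ht.wedgeTerm_sorted 1 5 0 2 1 4 5 (-1) (by decide),
    ht.wedgeTerm_sorted 2 5 0 1 2 5 6 1 (by decide)] at h0125
  have h0134 := ht.wedgeTerm_sum 0 1 3 4 (by decide)
  rw [ht.wedgeTerm_eq_zero 0 1 3 4 (by decide),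
    ht.wedgeTerm_eq_zero 0 3 1 4 (by decide),
    ht.wedgeTerm_eq_zero 0 4 1 3 (by decide),
    ht.wedgeTerm_sorted 1 3 0 4 1 2 3 1 (by decide),
    ht.wedgeTerm_sorted 1 4 0 3 1 4 5 (-1) (by decide),
    ht.wedgeTerm_sorted 3 4 0 1 3 4 6 1 (by decide)] at h0134
  have h0236 := ht.wedgeTerm_sum 0 2 3 6 (by decide)
  rw [ht.wedgeTerm_eq_zero 0 2 3 6 (by decide),
    ht.wedgeTerm_eq_zero 0 3 2 6 (by decide),
    ht.wedgeTerm_eq_zero 0 6 2 3 (by decide),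
    ht.wedgeTerm_sorted 2 3 0 6 1 2 3 (-1) (by decide),
    ht.wedgeTerm_sorted 2 6 0 3 2 5 6 1 (by decide),
    ht.wedgeTerm_sorted 3 6 0 2 3 4 6 (-1) (by decide)] at h0236
  have h0456 := ht.wedgeTerm_sum 0 4 5 6 (by decide)
  rw [ht.wedgeTerm_eq_zero 0 4 5 6 (by decide),
    ht.wedgeTerm_eq_zero 0 5 4 6 (by decide),
    ht.wedgeTerm_eq_zero 0 6 4 5 (by decide),
    ht.wedgeTerm_sorted 4 5 0 6 1 4 5 (-1) (by decide),
    ht.wedgeTerm_sorted 4 6 0 5 3 4 6 1 (by decide),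
    ht.wedgeTerm_sorted 5 6 0 4 2 5 6 (-1) (by decide)] at h0456
  push_cast at h0125 h0134 h0236 h0456
  simp only [List.forall_mem_cons]
  exact ⟨by linarith, by linarith, by linarith, by linarith, by simp⟩

end IsTorsionKernel

set_option synthInstance.maxHeartbeats 400000 in
set_option synthInstance.maxSize 2000 in
theorem IsTorsionKernel.eq_zero {t : Fin 7 → Fin 7 → Fin 7 → ℝ} (ht : IsTorsionKernel t)
    (i j k : Fin 7) (hij : i < j) (hjk : j < k) : t i j k = 0 := by
  have h : ∀ i j k : Fin 7, i < j → j < k →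
      (i, j, k) ∈ ([(0, 1, 2), (0, 4, 6), (1, 5, 6), (2, 4, 5)] : List (Fin 7 × Fin 7 × Fin 7)) ∨
      (i, j, k) ∈ ([(0, 1, 3), (0, 5, 6), (1, 4, 6), (3, 4, 5)] : List (Fin 7 × Fin 7 × Fin 7)) ∨
      (i, j, k) ∈ ([(0, 1, 4), (0, 2, 6), (1, 3, 6), (2, 3, 4)] : List (Fin 7 × Fin 7 × Fin 7)) ∨
      (i, j, k) ∈ ([(0, 1, 5), (0, 3, 6), (1, 2, 6), (2, 3, 5)] : List (Fin 7 × Fin 7 × Fin 7)) ∨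
      (i, j, k) ∈ ([(0, 1, 6), (0, 2, 4), (0, 3, 5), (1, 2, 5), (1, 3, 4), (2, 3, 6), (4, 5, 6)] :
        List (Fin 7 × Fin 7 × Fin 7)) ∨
      (i, j, k) ∈ ([(0, 2, 3), (0, 4, 5), (2, 4, 6), (3, 5, 6)] : List (Fin 7 × Fin 7 × Fin 7)) ∨
      (i, j, k) ∈ ([(0, 2, 5), (0, 3, 4), (1, 2, 4), (1, 3, 5)] : List (Fin 7 × Fin 7 × Fin 7)) ∨
      (i, j, k) ∈ ([(1, 2, 3), (1, 4, 5), (2, 5, 6), (3, 4, 6)] : List (Fin 7 × Fin 7 × Fin 7)) := by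
    decide +kernel
  rcases h i j k hij hjk with h | h | h | h | h | h | h | h
  · exact ht.eq_zero_of_mem_block0 _ h
  · exact ht.eq_zero_of_mem_block1 _ h
  · exact ht.eq_zero_of_mem_block2 _ h
  · exact ht.eq_zero_of_mem_block3 _ h
  · exact ht.eq_zero_of_mem_block4 _ h
  · exact ht.eq_zero_of_mem_block5 _ h
  · exact ht.eq_zero_of_mem_block6 _ h
  · exact ht.eq_zero_of_mem_block7 _ h

theorem eq_zero_of_skew {t : Fin 7 → Fin 7 → Fin 7 → ℝ}
    (h12 : ∀ i j k, t j i k = -t i j k) (h23 : ∀ i j k, t i k j = -t i j k)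
    (h : ∀ i j k, i < j → j < k → t i j k = 0) (i j k : Fin 7) : t i j k = 0 := by
  have h1 : ∀ i j k, i < j → t i j k = 0 := by
    intro i j k hij
    rcases lt_trichotomy j k with hjk | rfl | hjk
    · exact h i j k hij hjk
    · linarith [h23 i j j]
    · rcases lt_trichotomy i k with hik | rfl | hik
      · linarith [h23 i j k, h i k j hik hjk]
      · linarith [h23 i j i, h12 i i j]
      · linarith [h23 i j k, h12 i k j, h k i j hik hij]
  rcases lt_trichotomy i j with hij | rfl | hij
  · exact h1 i j k hij
  · linarith [h12 i i k]
  · linarith [h12 j i k, h1 j i k hij]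

/-- A totally skew-symmetric tensor `t` with `∑ (e_m ⌟ t) ∧ (e_m ⌟ φ) = 6 r ⋆φ` is equal to `r φ`. -/
theorem eq_smul_coeff {t : Fin 7 → Fin 7 → Fin 7 → ℝ}
    (h12 : ∀ i j k, t j i k = -t i j k) (h23 : ∀ i j k, t i k j = -t i j k) (r : ℝ)
    (h : ∀ i j k l, i < j → j < k → k < l →
      torsionWedge t coeff i j k l = r * torsionWedge coeff coeff i j k l) (i j k : Fin 7) :
    t i j k = r * coeff i j k := by
  have c12 : ∀ i j k, coeff j i k = -coeff i j k := fun i j k => by rw [coeff, cross_swap]; rfl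
  have c23 : ∀ i j k, coeff i k j = -coeff i j k := fun i j k => by
    have := cross_dotProduct_swap (Pi.single i 1) (Pi.single k 1) (Pi.single j 1)
    simpa [coeff] using this
  have z1 : ∀ i j k, t j i k - r * coeff j i k = -(t i j k - r * coeff i j k) := fun i j k => by
    rw [h12, c12]; ring
  have z2 : ∀ i j k, t i k j - r * coeff i k j = -(t i j k - r * coeff i j k) := fun i j k => by
    rw [h23, c23]; ring
  -- By linearity `t - r φ` lies in the kernel, which is trivial.
  refine sub_eq_zero.1 (eq_zero_of_skew (t := fun i j k => t i j k - r * coeff i j k) z1 z2 ?_ i j k)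
  refine IsTorsionKernel.eq_zero ⟨z1, z2, fun i j k l hij hjk hkl => ?_⟩
  rw [← sub_eq_zero.2 (h i j k l hij hjk hkl)]
  simp only [torsionWedge, Finset.mul_sum, ← Finset.sum_sub_distrib]
  exact Finset.sum_congr rfl fun m _ => by ring

end G2

/-! ### Smooth families of continuous maps -/

namespace ParametricODE

open Set

section Families

variable {X F : Type} [NormedAddCommGroup X] [NormedSpace ℝ X]
  [NormedAddCommGroup F] [NormedSpace ℝ F]

/-- The family of continuous maps `τ ↦ a (x, τ)` on the unit interval. -/
def family (a : X × ℝ → F) (ha : Continuous a) (x : X) : C(Icc (0 : ℝ) 1, F) :=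
  ⟨fun τ => a (x, τ), by fun_prop⟩

omit [NormedSpace ℝ X] [NormedSpace ℝ F] in
theorem continuous_family {a : X × ℝ → F} (ha : Continuous a) : Continuous (family a ha) :=
  (ContinuousMap.curry ⟨fun p : X × Icc (0 : ℝ) 1 => a (p.1, p.2), by fun_prop⟩).continuous

/-- Pointwise evaluation of a continuous family of linear maps. -/
def pointwiseApply {H : Type} [NormedAddCommGroup H] [NormedSpace ℝ H] (B : H →L[ℝ] X →L[ℝ] F) :
    C(Icc (0 : ℝ) 1, H) →L[ℝ] X →L[ℝ] C(Icc (0 : ℝ) 1, F) :=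
  LinearMap.mkContinuous₂
    (LinearMap.mk₂ ℝ (fun (T : C(Icc (0 : ℝ) 1, H)) (h : X) =>
        (⟨fun τ => B (T τ) h, by fun_prop⟩ : C(Icc (0 : ℝ) 1, F)))
      (fun _ _ _ => by ext; simp) (fun _ _ _ => by ext; simp)
      (fun _ _ _ => by ext; simp) (fun _ _ _ => by ext; simp)) ‖B‖
    (fun T h => by
      rw [ContinuousMap.norm_le _ (by positivity)]
      intro τ
      refine (B.le_opNorm₂ (T τ) h).trans ?_
      gcongr
      exact T.norm_coe_le_norm τ)

/-- The partial derivative of `a` with respect to the first variable. -/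
def partialFst (a : X × ℝ → F) (p : X × ℝ) : X →L[ℝ] F :=
  (fderiv ℝ a p).comp (ContinuousLinearMap.inl ℝ X ℝ)

theorem contDiff_partialFst {a : X × ℝ → F} (ha : ContDiff ℝ ∞ a) :
    ContDiff ℝ ∞ (partialFst a) :=
  (ha.fderiv_right (m := ∞) (by simp)).clm_comp contDiff_const

/-- Differentiability in the supremum norm needs an estimate uniform in `τ`. Continuity of the
curried partial derivative supplies it on a ball, and the mean value inequality is applied for each
`τ`. -/
theorem hasFDerivAt_family {a : X × ℝ → F} (ha : ContDiff ℝ ∞ a) (x : X) :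
    HasFDerivAt (family a ha.continuous)
      (pointwiseApply (ContinuousLinearMap.id ℝ (X →L[ℝ] F)) (family (partialFst a) (contDiff_partialFst ha).continuous x)) x := by
  have hd : ∀ (y : X) (τ : ℝ), HasFDerivAt (fun z => a (z, τ)) (partialFst a (y, τ)) y := by
    intro y τ
    have h1 : HasFDerivAt a (fderiv ℝ a (y, τ)) (y, τ) :=
      (ha.differentiable (by simp)).differentiableAt.hasFDerivAt
    exact h1.comp y (hasFDerivAt_prodMk_left y τ)
  rw [hasFDerivAt_iff_isLittleO, Asymptotics.isLittleO_iff]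
  intro c hc
  have hcont := (continuous_family (contDiff_partialFst ha).continuous).continuousAt (x := x)
  obtain ⟨r, hr, hball⟩ := Metric.continuousAt_iff.1 hcont c hc
  filter_upwards [Metric.ball_mem_nhds x hr] with y hy
  rw [ContinuousMap.norm_le _ (by positivity)]
  intro τ
  refine (convex_ball x r).norm_image_sub_le_of_norm_hasFDerivWithin_le' (f := fun z => a (z, τ))
    (fun z _ => (hd z τ).hasFDerivWithinAt) (fun z hz => ?_) (Metric.mem_ball_self hr) hy
  have h1 := ContinuousMap.dist_apply_le_dist
    (f := family (partialFst a) (contDiff_partialFst ha).continuous z)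
    (g := family (partialFst a) (contDiff_partialFst ha).continuous x) τ
  rw [dist_eq_norm] at h1
  exact h1.trans (hball hz).le

end Families

theorem contDiff_clm_comp {X Z Z' : Type*} [NormedAddCommGroup X] [NormedSpace ℝ X]
    [NormedAddCommGroup Z] [NormedSpace ℝ Z] [NormedAddCommGroup Z'] [NormedSpace ℝ Z']
    (T : Z →L[ℝ] Z') {f : X → Z} {n : ℕ} (hf : ContDiff ℝ n f) : ContDiff ℝ n fun x => T (f x) :=
  T.contDiff.comp hf

/-- The derivative of a family is, up to a fixed continuous linear map, again a family, with values
in `X →L[ℝ] F`; hence the target space varies in the induction. -/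
theorem contDiff_family_nat {X : Type} [NormedAddCommGroup X] [NormedSpace ℝ X] (n : ℕ) :
    ∀ {F : Type} [NormedAddCommGroup F] [NormedSpace ℝ F] {a : X × ℝ → F}
      (ha : ContDiff ℝ ∞ a), ContDiff ℝ n (family a ha.continuous) := by
  induction n with
  | zero => intro F _ _ a ha; exact contDiff_zero.2 (continuous_family ha.continuous)
  | succ n ih =>
    intro F _ _ a ha
    refine contDiff_succ_iff_hasFDerivAt.2 ⟨fun x => pointwiseApply (ContinuousLinearMap.id ℝ (X →L[ℝ] F)) (family (partialFst a)
      (contDiff_partialFst ha).continuous x), ?_, hasFDerivAt_family ha⟩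
    have h := ih (contDiff_partialFst ha)
    exact contDiff_clm_comp _ h

theorem contDiff_family {X F : Type} [NormedAddCommGroup X] [NormedSpace ℝ X]
    [NormedAddCommGroup F] [NormedSpace ℝ F] {a : X × ℝ → F} (ha : ContDiff ℝ ∞ a) :
    ContDiff ℝ ∞ (family a ha.continuous) :=
  contDiff_infty.2 fun n => contDiff_family_nat n ha

/-! ### Linear differential equations with parameters -/

section Resolvent

variable {Z : Type*} [NormedAddCommGroup Z] [NormedSpace ℝ Z] [CompleteSpace Z]

/-- The sum `(1 - T)⁻¹` of the Neumann series. -/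
def resolvent (T : Z →L[ℝ] Z) : Z →L[ℝ] Z := Ring.inverse (1 - T)

theorem resolvent_eq {T : Z →L[ℝ] Z} (hT : ‖T‖ < 1) (z : Z) :
    resolvent T z = z + T (resolvent T z) := by
  have h := Ring.mul_inverse_cancel _ (isUnit_one_sub_of_norm_lt_one hT)
  exact sub_eq_iff_eq_add.1 (congrArg (fun S => S z) h)

theorem contDiffAt_resolvent {T : Z →L[ℝ] Z} (hT : ‖T‖ < 1) :
    ContDiffAt ℝ ∞ (resolvent (Z := Z)) T := by
  obtain ⟨v, hv⟩ := isUnit_one_sub_of_norm_lt_one hT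
  have h1 := contDiffAt_ringInverse ℝ v (n := ∞)
  rw [hv] at h1
  exact h1.comp T (contDiffAt_const.sub contDiffAt_id)

end Resolvent

section Volterra

variable {F H : Type} [NormedAddCommGroup F] [NormedSpace ℝ F] [NormedAddCommGroup H]
  [NormedSpace ℝ H]

/-- The extension of a continuous map on the unit interval to the real line. -/
def extend (u : C(Icc (0 : ℝ) 1, F)) (t : ℝ) : F := u (projIcc 0 1 zero_le_one t)

omit [NormedSpace ℝ F] in
theorem continuous_extend (u : C(Icc (0 : ℝ) 1, F)) : Continuous (extend u) :=
  u.continuous.comp continuous_projIcc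

omit [NormedSpace ℝ F] in
theorem extend_of_mem (u : C(Icc (0 : ℝ) 1, F)) {t : ℝ} (ht : t ∈ Icc (0 : ℝ) 1) :
    extend u t = u ⟨t, ht⟩ := by
  rw [extend, projIcc_of_mem zero_le_one ht]

/-- The pointwise application of a path of operators to a path of vectors. -/
def applyPath (B : H →L[ℝ] F →L[ℝ] F) (a : C(Icc (0 : ℝ) 1, H)) (u : C(Icc (0 : ℝ) 1, F)) :
    C(Icc (0 : ℝ) 1, F) := ⟨fun t => B (a t) (u t), by fun_prop⟩

theorem norm_volterra_aux (B : H →L[ℝ] F →L[ℝ] F) (a : C(Icc (0 : ℝ) 1, H)) (u : C(Icc (0 : ℝ) 1, F))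
    (t : Icc (0 : ℝ) 1) : ‖∫ s in (0 : ℝ)..t, extend (applyPath B a u) s‖ ≤ ‖B‖ * ‖a‖ * ‖u‖ := by
  refine (intervalIntegral.norm_integral_le_of_norm_le_const (C := ‖B‖ * ‖a‖ * ‖u‖)
    fun s _ => ?_).trans ?_
  · refine (B.le_opNorm₂ _ _).trans ?_
    gcongr
    · exact a.norm_coe_le_norm _
    · exact u.norm_coe_le_norm _
  · rw [sub_zero, abs_of_nonneg t.2.1]
    exact mul_le_of_le_one_right (by positivity) t.2.2

/-- The bilinear Volterra operator `(a, u) ↦ (t ↦ ∫₀ᵗ a u)`. -/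
def volterra (B : H →L[ℝ] F →L[ℝ] F) :
    C(Icc (0 : ℝ) 1, H) →L[ℝ] C(Icc (0 : ℝ) 1, F) →L[ℝ] C(Icc (0 : ℝ) 1, F) :=
  LinearMap.mkContinuous₂
    (LinearMap.mk₂ ℝ (fun (a : C(Icc (0 : ℝ) 1, H)) (u : C(Icc (0 : ℝ) 1, F)) =>
        (⟨fun t => ∫ s in (0 : ℝ)..t, extend (applyPath B a u) s,
          (intervalIntegral.continuous_primitive
            (fun _ _ => (continuous_extend (applyPath B a u)).intervalIntegrable _ _) 0).comp
              continuous_subtype_val⟩ : C(Icc (0 : ℝ) 1, F)))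
      (fun a a' u => by
        ext t
        simp only [ContinuousMap.coe_mk, ContinuousMap.add_apply]
        rw [← intervalIntegral.integral_add
          ((continuous_extend (applyPath B a u)).intervalIntegrable _ _)
          ((continuous_extend (applyPath B a' u)).intervalIntegrable _ _)]
        simp [extend, applyPath])
      (fun c a u => by
        ext t
        simp only [ContinuousMap.coe_mk, ContinuousMap.smul_apply]
        rw [← intervalIntegral.integral_smul]
        simp [extend, applyPath])
      (fun a u u' => by
        ext t
        simp only [ContinuousMap.coe_mk, ContinuousMap.add_apply]
        rw [← intervalIntegral.integral_add
          ((continuous_extend (applyPath B a u)).intervalIntegrable _ _)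
          ((continuous_extend (applyPath B a u')).intervalIntegrable _ _)]
        simp [extend, applyPath])
      (fun c a u => by
        ext t
        simp only [ContinuousMap.coe_mk, ContinuousMap.smul_apply]
        rw [← intervalIntegral.integral_smul]
        simp [extend, applyPath])) ‖B‖
    (fun a u => by
      rw [ContinuousMap.norm_le _ (by positivity)]
      exact norm_volterra_aux B a u)

theorem volterra_apply (B : H →L[ℝ] F →L[ℝ] F) (a : C(Icc (0 : ℝ) 1, H)) (u : C(Icc (0 : ℝ) 1, F))
    (t : Icc (0 : ℝ) 1) :
    volterra B a u t = ∫ s in (0 : ℝ)..t, extend (applyPath B a u) s := rfl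

/-- Small coefficients suffice for the application, so the crude bound replaces the factorial
estimate of Volterra theory. -/
theorem norm_volterra_lt {B : H →L[ℝ] F →L[ℝ] F} {a : C(Icc (0 : ℝ) 1, H)} (ha : ‖B‖ * ‖a‖ < 1) :
    ‖volterra B a‖ < 1 := by
  refine lt_of_le_of_lt ?_ ha
  refine ContinuousLinearMap.opNorm_le_bound _ (by positivity) fun u => ?_
  rw [ContinuousMap.norm_le _ (by positivity)]
  intro t
  rw [volterra_apply]
  exact norm_volterra_aux B a u t

variable [CompleteSpace F]

/-- The solution `y` of `y' = a y`, `y(0) = ξ`, for small `a`. -/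
def solution (B : H →L[ℝ] F →L[ℝ] F) (a : C(Icc (0 : ℝ) 1, H)) (ξ : F) : C(Icc (0 : ℝ) 1, F) :=
  resolvent (volterra B a) (ContinuousMap.const _ ξ)

theorem solution_eq {B : H →L[ℝ] F →L[ℝ] F} {a : C(Icc (0 : ℝ) 1, H)} (ha : ‖B‖ * ‖a‖ < 1) (ξ : F) :
    solution B a ξ = ContinuousMap.const _ ξ + volterra B a (solution B a ξ) :=
  resolvent_eq (norm_volterra_lt ha) _

variable (F) in
/-- The space of constant paths. -/
def constPath : F →L[ℝ] C(Icc (0 : ℝ) 1, F) :=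
  LinearMap.mkContinuous
    { toFun := fun ξ => ContinuousMap.const _ ξ
      map_add' := fun _ _ => rfl
      map_smul' := fun _ _ => rfl } 1 (fun ξ => by
        rw [one_mul, ContinuousMap.norm_le _ (by positivity)]
        intro t
        exact le_rfl)

theorem contDiffAt_solution_aux {P Z : Type*} [NormedAddCommGroup P] [NormedSpace ℝ P]
    [NormedAddCommGroup Z] [NormedSpace ℝ Z] [CompleteSpace Z] (T : P →L[ℝ] Z →L[ℝ] Z) {a : P}
    (ha : ‖T a‖ < 1) :
    ContDiffAt ℝ ∞ (fun b => resolvent (T b)) a :=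
  ContDiffAt.comp (g := resolvent (Z := Z)) a (contDiffAt_resolvent ha) T.contDiff.contDiffAt

theorem contDiffAt_resolvent_volterra {B : H →L[ℝ] F →L[ℝ] F} {a : C(Icc (0 : ℝ) 1, H)} (ha : ‖B‖ * ‖a‖ < 1) :
    ContDiffAt ℝ ∞ (fun b : C(Icc (0 : ℝ) 1, H) => resolvent (volterra B b)) a :=
  contDiffAt_solution_aux (volterra B) (norm_volterra_lt ha)

end Volterra

end ParametricODE

/-! ### Parallel transport along a family of loops in a chart -/

namespace ParametricODE

open Set

section Solution

variable {F H : Type} [NormedAddCommGroup F] [NormedSpace ℝ F] [NormedAddCommGroup H]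
  [NormedSpace ℝ H] [CompleteSpace F]

/-- The extension of `solution B a ξ` to the real line. -/
def solutionExt (B : H →L[ℝ] F →L[ℝ] F) (a : C(Icc (0 : ℝ) 1, H)) (ξ : F) (t : ℝ) : F :=
  ξ + ∫ s in (0 : ℝ)..t, extend (applyPath B a (solution B a ξ)) s

theorem solutionExt_of_mem {B : H →L[ℝ] F →L[ℝ] F} {a : C(Icc (0 : ℝ) 1, H)}
    (ha : ‖B‖ * ‖a‖ < 1) (ξ : F) {t : ℝ} (ht : t ∈ Icc (0 : ℝ) 1) :
    solutionExt B a ξ t = solution B a ξ ⟨t, ht⟩ := by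
  conv_rhs => rw [solution_eq ha]
  rfl

/-- The integrand is continued by its boundary values, so the derivative is two-sided also at `0`
and `1`, as reparametrised curves require. -/
theorem hasDerivAt_solutionExt {B : H →L[ℝ] F →L[ℝ] F} {a : C(Icc (0 : ℝ) 1, H)}
    (ha : ‖B‖ * ‖a‖ < 1) (ξ : F) {t : ℝ} (ht : t ∈ Icc (0 : ℝ) 1) :
    HasDerivAt (solutionExt B a ξ) (B (a ⟨t, ht⟩) (solutionExt B a ξ t)) t := by
  have h := ((continuous_extend (applyPath B a (solution B a ξ))).integral_hasStrictDerivAt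
    0 t).hasDerivAt
  rw [solutionExt_of_mem ha ξ ht]
  rw [extend_of_mem _ ht] at h
  exact h.const_add ξ

theorem solutionExt_zero (B : H →L[ℝ] F →L[ℝ] F) (a : C(Icc (0 : ℝ) 1, H)) (ξ : F) :
    solutionExt B a ξ 0 = ξ := by
  simp [solutionExt]

variable (F) in
/-- Evaluation of a path at its end point. -/
def evalOne : C(Icc (0 : ℝ) 1, F) →L[ℝ] F :=
  LinearMap.mkContinuous
    { toFun := fun u => u ⟨1, right_mem_Icc.2 zero_le_one⟩
      map_add' := fun _ _ => rfl
      map_smul' := fun _ _ => rfl } 1 (fun u => by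
        rw [one_mul]
        exact u.norm_coe_le_norm _)

/-- The propagator from time `0` to time `1` of `y' = a y`. -/
def propagator (B : H →L[ℝ] F →L[ℝ] F) (a : C(Icc (0 : ℝ) 1, H)) : F →L[ℝ] F :=
  ((evalOne F).comp (resolvent (volterra B a))).comp (constPath F)

theorem propagator_apply (B : H →L[ℝ] F →L[ℝ] F) (a : C(Icc (0 : ℝ) 1, H)) (ξ : F) :
    propagator B a ξ = evalOne F (solution B a ξ) := rfl

theorem solutionExt_one {B : H →L[ℝ] F →L[ℝ] F} {a : C(Icc (0 : ℝ) 1, H)}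
    (ha : ‖B‖ * ‖a‖ < 1) (ξ : F) : solutionExt B a ξ 1 = propagator B a ξ :=
  solutionExt_of_mem ha ξ _

theorem contDiffAt_propagator {B : H →L[ℝ] F →L[ℝ] F} {a : C(Icc (0 : ℝ) 1, H)}
    (ha : ‖B‖ * ‖a‖ < 1) : ContDiffAt ℝ ∞ (propagator B) a :=
  (contDiffAt_const.clm_comp (contDiffAt_resolvent_volterra ha)).clm_comp contDiffAt_const

theorem resolvent_zero {Z : Type*} [NormedAddCommGroup Z] [NormedSpace ℝ Z] [CompleteSpace Z] :
    resolvent (0 : Z →L[ℝ] Z) = 1 := by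
  simp [resolvent]

theorem solution_zero (B : H →L[ℝ] F →L[ℝ] F) (ξ : F) : solution B 0 ξ = constPath F ξ := by
  rw [solution, (volterra B).map_zero, resolvent_zero]
  rfl

theorem propagator_zero (B : H →L[ℝ] F →L[ℝ] F) : propagator B 0 = 1 := by
  ext ξ
  rw [propagator_apply, solution_zero]
  rfl

end Solution

/-- The mixed second derivative of the solution of `r = z + P r` at a zero of `P`. -/
theorem hasDerivAt_fixedPoint {Z : Type*} [NormedAddCommGroup Z] [NormedSpace ℝ Z] {z : Z}
    {P₀ P₁ : ℝ → Z →L[ℝ] Z} {P₀' P₁' : Z →L[ℝ] Z} {r₀ r₁ : ℝ → Z} (h₀ : P₀ 0 = 0)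
    (hP₀ : HasDerivAt P₀ P₀' 0) (hP₁ : HasDerivAt P₁ P₁' 0) (hr₀ : DifferentiableAt ℝ r₀ 0)
    (hr₁ : DifferentiableAt ℝ r₁ 0) (e₀ : ∀ᶠ s in 𝓝 0, r₀ s = z + P₀ s (r₀ s))
    (e₁ : ∀ᶠ s in 𝓝 0, r₁ s = P₁ s (r₀ s) + P₀ s (r₁ s)) :
    HasDerivAt r₁ (P₁' z + P₁ 0 (P₀' z) + P₀' (P₁ 0 z)) 0 := by
  -- As `P₀` vanishes at `0`, both fixed-point equations are explicit there; the product rule then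
  -- yields the three terms.
  have z₀ : r₀ 0 = z := by rw [e₀.self_of_nhds, h₀]; simp
  have z₁ : r₁ 0 = P₁ 0 z := by rw [e₁.self_of_nhds, h₀, z₀]; simp
  have d₀ : HasDerivAt r₀ (P₀' z) 0 := by
    have h := (hP₀.clm_apply hr₀.hasDerivAt).const_add z
    rw [h₀, z₀] at h
    simpa using h.congr_of_eventuallyEq e₀
  have h := (hP₁.clm_apply d₀).add (hP₀.clm_apply hr₁.hasDerivAt)
  rw [h₀, z₀, z₁] at h
  simpa using h.congr_of_eventuallyEq e₁

/-- The mixed second derivative of `(1 - V a)⁻¹ z` at a zero of `a`, if its first derivatives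
vanish on a line. -/
theorem resolvent_mixed_eq_zero {C Z F : Type*} [NormedAddCommGroup C] [NormedSpace ℝ C]
    [NormedAddCommGroup Z] [NormedSpace ℝ Z] [CompleteSpace Z] [NormedAddCommGroup F]
    [NormedSpace ℝ F] (V : C →L[ℝ] Z →L[ℝ] Z) (L : Z →L[ℝ] F) (z : Z) {a : ℝ × ℝ → C}
    {a₁ : ℝ → C} {a₀' a₁' : C} (hac : ContDiff ℝ ∞ a) (ha : a (0, 0) = 0)
    (hA : ∀ s, HasDerivAt (fun ε => a (s, ε)) (a₁ s) 0)
    (h₀ : HasDerivAt (fun s => a (s, 0)) a₀' 0) (h₁ : HasDerivAt a₁ a₁' 0)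
    (hL : ∀ᶠ s in 𝓝 0, deriv (fun ε => L (resolvent (V (a (s, ε))) z)) 0 = 0) :
    L (V a₁' z + V (a₁ 0) (V a₀' z) + V a₀' (V (a₁ 0) z)) = 0 := by
  have hcont : Continuous fun p => ‖V (a p)‖ := (V.continuous.comp hac.continuous).norm
  have hopen : ∀ᶠ p in 𝓝 ((0, 0) : ℝ × ℝ), ‖V (a p)‖ < 1 := by
    refine hcont.continuousAt.eventually_lt continuousAt_const ?_
    rw [ha]; simp
  set r : ℝ × ℝ → Z := fun p => resolvent (V (a p)) z with hr
  have hrs : ∀ p, ‖V (a p)‖ < 1 → ContDiffAt ℝ ∞ r p := fun p hp =>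
    (ContDiffAt.comp (g := fun b => resolvent (V b)) p
      (contDiffAt_solution_aux V hp) hac.contDiffAt).clm_apply contDiffAt_const
  have hfix : ∀ p, ‖V (a p)‖ < 1 → r p = z + V (a p) (r p) := fun p hp => resolvent_eq hp z
  have hline : ∀ s, HasDerivAt (fun ε : ℝ => (s, ε)) ((0, 1) : ℝ × ℝ) 0 :=
    fun s => (hasDerivAt_const _ s).prodMk (hasDerivAt_id _)
  have hline' : HasDerivAt (fun s : ℝ => (s, (0 : ℝ))) ((1, 0) : ℝ × ℝ) 0 :=
    (hasDerivAt_id _).prodMk (hasDerivAt_const _ _)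
  have hR : ∀ s, ‖V (a (s, 0))‖ < 1 →
      HasDerivAt (fun ε => r (s, ε)) (fderiv ℝ r (s, 0) (0, 1)) 0 := fun s hs =>
    HasFDerivAt.comp_hasDerivAt (f := fun ε => (s, ε)) 0
      ((hrs _ hs).differentiableAt (by simp)).hasFDerivAt (hline s)
  have hev : ∀ᶠ s in 𝓝 (0 : ℝ), ‖V (a (s, 0))‖ < 1 := hline'.continuousAt.eventually hopen
  have hd₁ : ContDiffAt ℝ 1 (fun p => fderiv ℝ r p) (0, 0) :=
    (hrs _ hopen.self_of_nhds).fderiv_right (by norm_cast)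
  -- Here `r₀` is the solution on the line `ε = 0` and `r₁` its `ε`-derivative there; the second
  -- equation is the first one differentiated in `ε`.
  have key := hasDerivAt_fixedPoint (z := z) (P₀ := fun s => V (a (s, 0)))
    (P₁ := fun s => V (a₁ s)) (r₀ := fun s => r (s, 0)) (r₁ := fun s => fderiv ℝ r (s, 0) (0, 1))
    (by simp only [ha, map_zero]) (V.hasFDerivAt.comp_hasDerivAt 0 h₀)
    (V.hasFDerivAt.comp_hasDerivAt 0 h₁)
    (DifferentiableAt.comp (g := r) (0 : ℝ)
      ((hrs _ hopen.self_of_nhds).differentiableAt (by simp)) hline'.differentiableAt)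
    ((DifferentiableAt.comp (g := fun p => fderiv ℝ r p) (f := fun s : ℝ => (s, (0 : ℝ))) (0 : ℝ)
      (hd₁.differentiableAt (by simp)) hline'.differentiableAt).clm_apply
        (differentiableAt_const _))
    (hev.mono fun s hs => hfix _ hs)
    (hev.mono fun s hs => by
      have h1 := ((V.hasFDerivAt.comp_hasDerivAt 0 (hA s)).clm_apply (hR s hs)).const_add z
      refine (hR s hs).unique (h1.congr_of_eventuallyEq ?_)
      have : ∀ᶠ ε in 𝓝 (0 : ℝ), ‖V (a (s, ε))‖ < 1 :=
        ContinuousAt.eventually_lt (Continuous.continuousAt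
          (hcont.comp (Continuous.prodMk_right s))) continuousAt_const hs
      exact this.mono fun ε hε => hfix _ hε)
  have hzero : (fun s => L (fderiv ℝ r (s, 0) (0, 1))) =ᶠ[𝓝 0] fun _ => 0 := by
    filter_upwards [hL, hev] with s hs hs'
    rw [← hs]
    exact (L.hasFDerivAt.comp_hasDerivAt 0 (hR s hs')).deriv.symm
  have hE := L.hasFDerivAt.comp_hasDerivAt 0 key
  exact hE.unique ((hasDerivAt_const (0 : ℝ) (0 : F)).congr_of_eventuallyEq hzero)

section Partial

variable {X F : Type} [NormedAddCommGroup X] [NormedSpace ℝ X]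
  [NormedAddCommGroup F] [NormedSpace ℝ F]

/-- The derivative of `a` in the direction `h` of the first variable. -/
def dirFst (h : X) (a : X × ℝ → F) (p : X × ℝ) : F := fderiv ℝ a p (h, 0)

theorem contDiff_dirFst (h : X) {a : X × ℝ → F} (ha : ContDiff ℝ ∞ a) :
    ContDiff ℝ ∞ (dirFst h a) :=
  (ha.fderiv_right (m := ∞) (by simp)).clm_apply contDiff_const

theorem hasDerivAt_family {a : X × ℝ → F} (ha : ContDiff ℝ ∞ a) {x : ℝ → X} {h : X} {t : ℝ}
    (hx : HasDerivAt x h t) :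
    HasDerivAt (fun t => family a ha.continuous (x t))
      (family (dirFst h a) (contDiff_dirFst h ha).continuous (x t)) t :=
  (hasFDerivAt_family ha (x t)).comp_hasDerivAt t hx

theorem dirFst_eq {a : X × ℝ → F} (ha : ContDiff ℝ ∞ a) {x : ℝ → X} {h : X} {t τ : ℝ} {f : F}
    (hx : HasDerivAt x h t) (hf : HasDerivAt (fun t => a (x t, τ)) f t) :
    dirFst h a (x t, τ) = f := by
  have h1 : HasFDerivAt a (fderiv ℝ a (x t, τ)) (x t, τ) :=
    (ha.differentiable (by simp)).differentiableAt.hasFDerivAt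
  have h2 : HasDerivAt (fun t => (x t, τ)) (h, (0 : ℝ)) t := hx.prodMk (hasDerivAt_const t τ)
  exact (h1.comp_hasDerivAt t h2).unique hf

end Partial

/-! ### The transport equation along the paths `sigma` and its mixed second derivative -/

section Loop

variable {E F H : Type} [NormedAddCommGroup E] [NormedSpace ℝ E] [NormedAddCommGroup F]
  [NormedSpace ℝ F] [NormedAddCommGroup H] [NormedSpace ℝ H]

/-- The path `τ ↦ y + s τ u + ε (τ - τ²) v`. -/
def sigma (y u v : E) (s ε τ : ℝ) : E := y + (s * τ) • u + (ε * (τ - τ ^ 2)) • v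

/-- The velocity component `s Wu + ε (1 - 2 τ) Wv` along `sigma`, with the sign of the transport
equation. -/
def loopCoeff (Wu Wv : E → H) (y u v : E) (p : (ℝ × ℝ) × ℝ) : H :=
  -(p.1.1 • Wu (sigma y u v p.1.1 p.1.2 p.2) +
    (p.1.2 * (1 - 2 * p.2)) • Wv (sigma y u v p.1.1 p.1.2 p.2))

variable {Wu Wv : E → H} (hu : ContDiff ℝ ∞ Wu) (hv : ContDiff ℝ ∞ Wv) (y u v : E)

include hu hv in
theorem contDiff_loopCoeff : ContDiff ℝ ∞ (loopCoeff Wu Wv y u v) := by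
  unfold loopCoeff sigma
  fun_prop

/-- The path of coefficients of the transport equation along `sigma`. -/
def loopPath (p : ℝ × ℝ) : C(Icc (0 : ℝ) 1, H) :=
  family (loopCoeff Wu Wv y u v) (contDiff_loopCoeff hu hv y u v).continuous p

theorem contDiff_loopPath : ContDiff ℝ ∞ (loopPath hu hv y u v) :=
  contDiff_family (contDiff_loopCoeff hu hv y u v)

theorem loopPath_apply (s ε : ℝ) (τ : Icc (0 : ℝ) 1) :
    loopPath hu hv y u v (s, ε) τ = loopCoeff Wu Wv y u v ((s, ε), τ) := rfl

theorem loopPath_zero : loopPath hu hv y u v (0, 0) = 0 := by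
  ext τ
  simp [loopPath_apply, loopCoeff]

-- The derivative of `W_v` does not contribute, because that term carries a factor `ε`.
include hu hv in
theorem hasDerivAt_loopCoeff_snd (s τ : ℝ) :
    HasDerivAt (fun ε => loopCoeff Wu Wv y u v ((s, ε), τ))
      (-((s * (τ - τ ^ 2)) • fderiv ℝ Wu (y + (s * τ) • u) v +
        (1 - 2 * τ) • Wv (y + (s * τ) • u))) 0 := by
  have hσ : HasDerivAt (fun ε => sigma y u v s ε τ) ((τ - τ ^ 2) • v) 0 := by
    simpa [sigma] using (((hasDerivAt_id (0 : ℝ)).mul_const (τ - τ ^ 2)).smul_const v).const_add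
      (y + (s * τ) • u)
  have h0 : sigma y u v s 0 τ = y + (s * τ) • u := by simp [sigma]
  have h1 : HasDerivAt (fun ε => Wu (sigma y u v s ε τ))
      (fderiv ℝ Wu (y + (s * τ) • u) ((τ - τ ^ 2) • v)) 0 := by
    have h := (hu.differentiable (by simp) (sigma y u v s 0 τ)).hasFDerivAt.comp_hasDerivAt 0 hσ
    rwa [h0] at h
  have h2 : HasDerivAt (fun ε => Wv (sigma y u v s ε τ))
      (fderiv ℝ Wv (y + (s * τ) • u) ((τ - τ ^ 2) • v)) 0 := by
    have h := (hv.differentiable (by simp) (sigma y u v s 0 τ)).hasFDerivAt.comp_hasDerivAt 0 hσ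
    rwa [h0] at h
  have h3 := ((h1.const_smul s).add
    (((hasDerivAt_id (0 : ℝ)).mul_const (1 - 2 * τ)).smul h2)).neg
  refine h3.congr_deriv ?_
  simp [h0, mul_smul]

include hu hv in
theorem hasDerivAt_loopCoeff_fst (τ : ℝ) :
    HasDerivAt (fun s => loopCoeff Wu Wv y u v ((s, 0), τ)) (-Wu y) 0 := by
  have hσ : HasDerivAt (fun s : ℝ => y + (s * τ) • u) (τ • u) 0 := by
    simpa using (((hasDerivAt_id (0 : ℝ)).mul_const τ).smul_const u).const_add y
  have h0 : y + ((0 : ℝ) * τ) • u = y := by simp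
  have h1 : HasDerivAt (fun s : ℝ => Wu (y + (s * τ) • u)) (fderiv ℝ Wu y (τ • u)) 0 := by
    have h := (hu.differentiable (by simp) (y + ((0 : ℝ) * τ) • u)).hasFDerivAt.comp_hasDerivAt
      0 hσ
    rwa [h0] at h
  have h3 := ((hasDerivAt_id (0 : ℝ)).smul h1).neg
  refine (h3.congr_of_eventuallyEq (.of_forall fun s => ?_)).congr_deriv ?_
  · simp [loopCoeff, sigma]
  · simp

include hu hv in
theorem hasDerivAt_loopCoeff_snd_fst (τ : ℝ) :
    HasDerivAt (fun s : ℝ => -((s * (τ - τ ^ 2)) • fderiv ℝ Wu (y + (s * τ) • u) v +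
        (1 - 2 * τ) • Wv (y + (s * τ) • u)))
      (-((τ - τ ^ 2) • fderiv ℝ Wu y v + ((1 - 2 * τ) * τ) • fderiv ℝ Wv y u)) 0 := by
  have hσ : HasDerivAt (fun s : ℝ => y + (s * τ) • u) (τ • u) 0 := by
    simpa using (((hasDerivAt_id (0 : ℝ)).mul_const τ).smul_const u).const_add y
  have h0 : y + ((0 : ℝ) * τ) • u = y := by simp
  have h2 : HasDerivAt (fun s : ℝ => Wv (y + (s * τ) • u)) (fderiv ℝ Wv y (τ • u)) 0 := by
    have h := (hv.differentiable (by simp) (y + ((0 : ℝ) * τ) • u)).hasFDerivAt.comp_hasDerivAt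
      0 hσ
    rwa [h0] at h
  have hd : ContDiff ℝ ∞ fun x => fderiv ℝ Wu x v :=
    (hu.fderiv_right (m := ∞) (by simp)).clm_apply contDiff_const
  have h1 : HasDerivAt (fun s : ℝ => fderiv ℝ Wu (y + (s * τ) • u) v)
      (fderiv ℝ (fun x => fderiv ℝ Wu x v) y (τ • u)) 0 := by
    have h := (hd.differentiable (by simp) (y + ((0 : ℝ) * τ) • u)).hasFDerivAt.comp_hasDerivAt
      0 hσ
    rwa [h0] at h
  have h3 := (((((hasDerivAt_id (0 : ℝ)).mul_const (τ - τ ^ 2)).smul h1).add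
    (h2.const_smul (1 - 2 * τ)))).neg
  refine h3.congr_deriv ?_
  simp [mul_smul]

variable [CompleteSpace F] (B : H →L[ℝ] F →L[ℝ] F)

theorem volterra_eq {B : H →L[ℝ] F →L[ℝ] F} {a : C(Icc (0 : ℝ) 1, H)} {w : C(Icc (0 : ℝ) 1, F)}
    {f : ℝ → F} (h : ∀ τ : Icc (0 : ℝ) 1, B (a τ) (w τ) = f τ) (t : Icc (0 : ℝ) 1) :
    volterra B a w t = ∫ s in (0 : ℝ)..t, f s := by
  rw [volterra_apply]
  refine intervalIntegral.integral_congr fun s hs => ?_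
  rw [uIcc_of_le t.2.1] at hs
  have hs' : s ∈ Icc (0 : ℝ) 1 := ⟨hs.1, hs.2.trans t.2.2⟩
  simp only [extend_of_mem _ hs']
  exact h ⟨s, hs'⟩

theorem integral_one_sub (t : ℝ) : ∫ s in (0 : ℝ)..t, (1 - 2 * s) = t - t ^ 2 := by
  rw [intervalIntegral.integral_sub (Continuous.intervalIntegrable (by fun_prop) _ _)
      (Continuous.intervalIntegrable (by fun_prop) _ _),
    intervalIntegral.integral_const_mul]
  simp
  ring

theorem integral_sub_sq : ∫ s in (0 : ℝ)..1, (s - s ^ 2) = 1 / 6 := by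
  rw [intervalIntegral.integral_sub (Continuous.intervalIntegrable (by fun_prop) _ _)
      (Continuous.intervalIntegrable (by fun_prop) _ _)]
  norm_num

/-- Opposite to the integral of `s - s²`, by partial integration. This is why the first-order terms
appear as the difference `∂_u W_v - ∂_v W_u`. -/
theorem integral_one_sub_mul : ∫ s in (0 : ℝ)..1, (1 - 2 * s) * s = -(1 / 6) := by
  have : ∀ s : ℝ, (1 - 2 * s) * s = s - 2 * s ^ 2 := fun s => by ring
  simp_rw [this]
  rw [intervalIntegral.integral_sub (Continuous.intervalIntegrable (by fun_prop) _ _)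
      (Continuous.intervalIntegrable (by fun_prop) _ _),
    intervalIntegral.integral_const_mul]
  norm_num

/-- The derivative of the solution in the direction of `ε`. -/
theorem hasDerivAt_evalOne_fixedPoint {a₁ a₀' a₁' : C(Icc (0 : ℝ) 1, H)} {wu wv du dv : H}
    {r : C(Icc (0 : ℝ) 1, F)} {ξ : F}
    (h₁ : ∀ τ : Icc (0 : ℝ) 1, a₁ τ = -((1 - 2 * (τ : ℝ)) • wv))
    (h₀' : ∀ τ, a₀' τ = -wu)
    (h₁' : ∀ τ : Icc (0 : ℝ) 1, a₁' τ =
      -(((τ : ℝ) - (τ : ℝ) ^ 2) • dv + ((1 - 2 * (τ : ℝ)) * τ) • du))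
    (hr : r = volterra B a₁' (constPath F ξ) + volterra B a₁ (volterra B a₀' (constPath F ξ)) +
      volterra B a₀' (volterra B a₁ (constPath F ξ))) :
    evalOne F r = (1 / 6 : ℝ) • (B du ξ - B dv ξ + B wu (B wv ξ) - B wv (B wu ξ)) := by
  have c : ∀ τ, constPath F ξ τ = ξ := fun _ => rfl
  -- The inner Volterra integrals are explicit; inserted into the outer ones they give the two
  -- quadratic curvature terms with weights `1/6` and `-1/6`.
  have k₀ : ∀ τ : Icc (0 : ℝ) 1, volterra B a₀' (constPath F ξ) τ = -((τ : ℝ) • B wu ξ) := by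
    intro τ
    rw [volterra_eq (f := fun _ => -B wu ξ) (fun t => by rw [h₀', c]; simp)]
    simp
  have k₁ : ∀ τ : Icc (0 : ℝ) 1, volterra B a₁ (constPath F ξ) τ =
      -(((τ : ℝ) - (τ : ℝ) ^ 2) • B wv ξ) := by
    intro τ
    rw [volterra_eq (f := fun t => (1 - 2 * t) • -B wv ξ) (fun t => by rw [h₁, c]; simp),
      intervalIntegral.integral_smul_const, integral_one_sub, smul_neg]
  have e : ∀ w : C(Icc (0 : ℝ) 1, F), evalOne F w = w ⟨1, right_mem_Icc.2 zero_le_one⟩ :=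
    fun _ => rfl
  rw [hr, map_add, map_add, e, e, e,
    volterra_eq (a := a₁') (f := fun t => (t - t ^ 2) • -B dv ξ + ((1 - 2 * t) * t) • -B du ξ)
      (fun t => by rw [h₁', c]; simp [add_comm]),
    volterra_eq (a := a₁) (f := fun t => ((1 - 2 * t) * t) • B wv (B wu ξ))
      (fun t => by rw [h₁, k₀]; simp [smul_smul]),
    volterra_eq (a := a₀') (f := fun t => (t - t ^ 2) • B wu (B wv ξ))
      (fun t => by rw [h₀', k₁]; simp),
    intervalIntegral.integral_add (Continuous.intervalIntegrable (by fun_prop) _ _)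
      (Continuous.intervalIntegrable (by fun_prop) _ _)]
  simp only [intervalIntegral.integral_smul_const, integral_sub_sq, integral_one_sub_mul]
  module

/-- Parallel transport along a two-parameter family of paths, smooth in the parameters, and the
appearance of the curvature. -/
theorem exists_propagator (hu : ContDiff ℝ ∞ Wu) (hv : ContDiff ℝ ∞ Wv) :
    ∃ δ > 0, ∃ G : ℝ → ℝ → F →L[ℝ] F,
      (∀ s ε, |s| < δ → |ε| < δ → ∀ ξ, ∃ w : ℝ → F, w 0 = ξ ∧ w 1 = G s ε ξ ∧
        ∀ τ ∈ Icc (0 : ℝ) 1,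
          HasDerivAt w (B (loopCoeff Wu Wv y u v ((s, ε), τ)) (w τ)) τ) ∧
      (∀ s, |s| < δ → IsUnit (G s 0)) ∧
      (∀ s ε, |s| < δ → |ε| < δ → ContDiffAt ℝ ∞ (G s) ε) ∧
      ∀ ξ, (∀ᶠ s in 𝓝 0, deriv (G s) 0 ξ = 0) →
        B (fderiv ℝ Wv y u) ξ - B (fderiv ℝ Wu y v) ξ + B (Wu y) (B (Wv y) ξ) -
          B (Wv y) (B (Wu y) ξ) = 0 := by
  set a := loopPath hu hv y u v with ha
  have hac : ContDiff ℝ ∞ a := contDiff_loopPath hu hv y u v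
  have ha0 : a (0, 0) = 0 := loopPath_zero hu hv y u v
  have hopen : ∀ᶠ p in 𝓝 ((0, 0) : ℝ × ℝ), ‖B‖ * ‖a p‖ < 1 := by
    refine ContinuousAt.eventually_lt (Continuous.continuousAt ?_) continuousAt_const ?_
    · exact continuous_const.mul hac.continuous.norm
    · rw [ha0]; simp
  have hsmooth : ∀ p, ‖B‖ * ‖a p‖ < 1 → ContDiffAt ℝ ∞ (fun p => propagator B (a p)) p :=
    fun p hp => ContDiffAt.comp (g := propagator B) p (contDiffAt_propagator hp) hac.contDiffAt
  -- The propagator for zero coefficients is the identity, and the units form an open set.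
  -- Invertibility is needed for transport back along the path.
  have hunit : ∀ᶠ p in 𝓝 ((0, 0) : ℝ × ℝ), IsUnit (propagator B (a p)) := by
    have h1 := (hsmooth (0, 0) hopen.self_of_nhds).continuousAt
    refine h1.eventually (p := fun x => IsUnit x) ?_
    simp only [ha0, propagator_zero]
    exact Units.isOpen.mem_nhds isUnit_one
  obtain ⟨δ, hδ, hball⟩ := Metric.eventually_nhds_iff.1 (hopen.and hunit)
  have hb : ∀ s ε : ℝ, |s| < δ → |ε| < δ → dist (s, ε) ((0, 0) : ℝ × ℝ) < δ := by
    intro s ε hs hε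
    rw [Prod.dist_eq]
    simpa using ⟨hs, hε⟩
  refine ⟨δ, hδ, fun s ε => propagator B (a (s, ε)), fun s ε hs hε ξ => ?_, fun s hs => ?_,
    fun s ε hs hε => ?_, fun ξ hξ => ?_⟩
  · have hlt := (hball (hb s ε hs hε)).1
    exact ⟨solutionExt B (a (s, ε)) ξ, solutionExt_zero _ _ _, solutionExt_one hlt ξ,
      fun τ hτ => hasDerivAt_solutionExt hlt ξ hτ⟩
  · exact (hball (hb s 0 hs (by simpa using hδ))).2
  · exact ContDiffAt.comp (g := fun p => propagator B (a p)) ε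
      (hsmooth _ (hball (hb s ε hs hε)).1) (by fun_prop)
  · have hline : ∀ s, HasDerivAt (fun ε : ℝ => (s, ε)) ((0, 1) : ℝ × ℝ) 0 :=
      fun s => (hasDerivAt_const _ s).prodMk (hasDerivAt_id _)
    have hline' : HasDerivAt (fun s : ℝ => (s, (0 : ℝ))) ((1, 0) : ℝ × ℝ) 0 :=
      (hasDerivAt_id _).prodMk (hasDerivAt_const _ _)
    have hlc := contDiff_loopCoeff hu hv y u v
    have hlc₁ := contDiff_dirFst ((0, 1) : ℝ × ℝ) hlc
    have key := resolvent_mixed_eq_zero (volterra B) (evalOne F) (constPath F ξ) hac ha0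
      (fun s => hasDerivAt_family hlc (hline s)) (hasDerivAt_family hlc hline')
      (hasDerivAt_family hlc₁ hline') ?_
    · rw [hasDerivAt_evalOne_fixedPoint (wu := Wu y) (wv := Wv y) (dv := fderiv ℝ Wu y v)
        (du := fderiv ℝ Wv y u) (ξ := ξ) B (fun τ => ?_) (fun τ => ?_) (fun τ => ?_) rfl] at key
      · simpa using key
      · have h := hasDerivAt_loopCoeff_snd hu hv y u v 0 τ
        exact (dirFst_eq hlc (hline 0) h).trans (by simp)
      · exact dirFst_eq (x := fun s : ℝ => (s, (0 : ℝ))) hlc hline'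
          (hasDerivAt_loopCoeff_fst hu hv y u v τ)
      · refine dirFst_eq (x := fun s : ℝ => (s, (0 : ℝ))) hlc₁ hline'
          ((hasDerivAt_loopCoeff_snd_fst hu hv y u v τ).congr_of_eventuallyEq
            (.of_forall fun s => ?_))
        exact dirFst_eq (x := fun ε : ℝ => (s, ε)) (t := 0) hlc (hline s)
          (hasDerivAt_loopCoeff_snd hu hv y u v s τ)
    · have hev : ∀ᶠ s in 𝓝 (0 : ℝ), ‖B‖ * ‖a (s, 0)‖ < 1 := hline'.continuousAt.eventually hopen
      filter_upwards [hξ, hev] with s hs hs'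
      rw [← hs]
      have h2 : DifferentiableAt ℝ (fun ε => propagator B (a (s, ε))) 0 :=
        (ContDiffAt.comp (g := fun p => propagator B (a p)) (0 : ℝ)
          (hsmooth (s, 0) hs') (by fun_prop)).differentiableAt (n := ∞) (by simp)
      exact (h2.hasDerivAt.clm_apply (hasDerivAt_const 0 ξ)).deriv.trans (by simp)

end Loop

end ParametricODE

/-! ### Coordinate vector fields -/

section ConstField

variable {E : Type*} [NormedAddCommGroup E] [NormedSpace ℝ E]

/-- A constant vector field on a normed space. -/
def constField (u : E) (y : E) : TangentSpace 𝓘(ℝ, E) y := u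

theorem contMDiffAt_constField (u y : E) :
    ContMDiffAt 𝓘(ℝ, E) 𝓘(ℝ, E).tangent ∞
      (fun x => (⟨x, constField u x⟩ : TangentBundle 𝓘(ℝ, E) E)) y :=
  contMDiffAt_vectorSpace_iff_contDiffAt.2 contDiffAt_const

theorem mlieBracket_constField (u v y : E) :
    VectorField.mlieBracket 𝓘(ℝ, E) (constField u) (constField v) y = 0 := by
  have h0 : VectorField.lieBracketWithin ℝ (fun _ : E => u) (fun _ => v) Set.univ y = 0 := by
    simp [VectorField.lieBracketWithin]
  rw [← VectorField.mlieBracketWithin_univ, VectorField.mlieBracketWithin_eq_lieBracketWithin]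
  exact h0

end ConstField

section Coordinates

variable {M : Type*} [TopologicalSpace M] [ChartedSpace (EuclideanSpace ℝ (Fin 7)) M]
  [IsManifold (𝓡 7) ∞ M]

/-- The vector field with constant coefficients `u` in the chart at `p`. -/
def coordField (p : M) (u : EuclideanSpace ℝ (Fin 7)) : ∀ x : M, TangentSpace (𝓡 7) x :=
  VectorField.mpullback (𝓡 7) 𝓘(ℝ, EuclideanSpace ℝ (Fin 7)) (extChartAt (𝓡 7) p)
    (constField u)

theorem coordField_apply (p : M) (u : EuclideanSpace ℝ (Fin 7)) (x : M) :
    coordField p u x =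
      (mfderiv (𝓡 7) 𝓘(ℝ, EuclideanSpace ℝ (Fin 7)) (extChartAt (𝓡 7) p) x).inverse u := rfl

theorem coordField_add (p : M) (u v : EuclideanSpace ℝ (Fin 7)) (x : M) :
    coordField p (u + v) x = coordField p u x + coordField p v x := by
  rw [coordField_apply, coordField_apply, coordField_apply]
  exact map_add _ u v

theorem coordField_smul (p : M) (c : ℝ) (u : EuclideanSpace ℝ (Fin 7)) (x : M) :
    coordField p (c • u) x = c • coordField p u x := by
  rw [coordField_apply, coordField_apply]
  exact map_smul _ c u

theorem mem_extChartAt_source_iff {p x : M} :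
    x ∈ (extChartAt (𝓡 7) p).source ↔ x ∈ (chartAt (EuclideanSpace ℝ (Fin 7)) p).source := by
  rw [extChartAt_source]

theorem contMDiffAt_coordField {p x : M} (u : EuclideanSpace ℝ (Fin 7))
    (hx : x ∈ (extChartAt (𝓡 7) p).source) :
    ContMDiffAt (𝓡 7) (𝓡 7).tangent ∞
      (fun y => (⟨y, coordField p u y⟩ : TangentBundle (𝓡 7) M)) x :=
  ContMDiffAt.mpullback_vectorField_preimage (n := ∞) (m := ∞) (contMDiffAt_constField u _)
    (contMDiffAt_extChartAt' (mem_extChartAt_source_iff.1 hx))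
    (isInvertible_mfderiv_extChartAt hx) (by simp)

/-- Brackets are natural under pullback by the chart, and constant fields commute. -/
theorem mlieBracket_coordField {p x : M} (u v : EuclideanSpace ℝ (Fin 7))
    (hx : x ∈ (extChartAt (𝓡 7) p).source) :
    VectorField.mlieBracket (𝓡 7) (coordField p u) (coordField p v) x = 0 := by
  have : IsManifold (𝓡 7) (minSmoothness ℝ 2) M := by
    rw [minSmoothness_of_isRCLikeNormedField]
    exact IsManifold.of_le (n := ∞) (by norm_cast)
  have : IsManifold (𝓡 7) (minSmoothness ℝ 3) M := by
    rw [minSmoothness_of_isRCLikeNormedField]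
    exact IsManifold.of_le (n := ∞) (by norm_cast)
  have h := VectorField.mpullback_mlieBracket (n := ∞) (I := 𝓡 7)
    (I' := 𝓘(ℝ, EuclideanSpace ℝ (Fin 7))) (f := extChartAt (𝓡 7) p) (x₀ := x)
    ((contMDiffAt_constField u _).mdifferentiableAt (by simp))
    ((contMDiffAt_constField v _).mdifferentiableAt (by simp))
    (contMDiffAt_extChartAt' (mem_extChartAt_source_iff.1 hx))
    (by rw [minSmoothness_of_isRCLikeNormedField]; norm_cast)
  refine h.symm.trans ?_
  exact (congrArg _ (mlieBracket_constField u v _)).trans (map_zero _)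

theorem coordField_mfderiv {p x : M} (v : TangentSpace (𝓡 7) x)
    (hx : x ∈ (extChartAt (𝓡 7) p).source) :
    coordField p (mfderiv (𝓡 7) 𝓘(ℝ, EuclideanSpace ℝ (Fin 7)) (extChartAt (𝓡 7) p) x v) x = v :=
  (isInvertible_mfderiv_extChartAt hx).inverse_apply_self v

theorem mdifferentiableAt_extChartAt_symm {p : M} {y : EuclideanSpace ℝ (Fin 7)}
    (hy : y ∈ (extChartAt (𝓡 7) p).target) :
    MDifferentiableAt 𝓘(ℝ, EuclideanSpace ℝ (Fin 7)) (𝓡 7) (extChartAt (𝓡 7) p).symm y := by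
  have h := mdifferentiableWithinAt_extChartAt_symm (I := 𝓡 7) hy
  rwa [ModelWithCorners.range_eq_univ, mdifferentiableWithinAt_univ] at h

theorem mfderiv_extChartAt_symm {p : M} {y : EuclideanSpace ℝ (Fin 7)}
    (hy : y ∈ (extChartAt (𝓡 7) p).target) (u : EuclideanSpace ℝ (Fin 7)) :
    mfderiv 𝓘(ℝ, EuclideanSpace ℝ (Fin 7)) (𝓡 7) (extChartAt (𝓡 7) p).symm y u =
      coordField p u ((extChartAt (𝓡 7) p).symm y) := by
  have hx := (extChartAt (𝓡 7) p).map_target hy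
  have h := mfderiv_extChartAt_comp_mfderivWithin_extChartAt_symm (I := 𝓡 7) hy
  rw [ModelWithCorners.range_eq_univ, mfderivWithin_univ] at h
  have h1 := coordField_mfderiv (mfderiv 𝓘(ℝ, EuclideanSpace ℝ (Fin 7)) (𝓡 7)
    (extChartAt (𝓡 7) p).symm y u) hx
  rw [← h1]
  congr 1
  exact congrArg (fun T => T u) h

theorem hasFDerivAt_comp_extChartAt_symm {G : Type*} [NormedAddCommGroup G] [NormedSpace ℝ G]
    {p : M} {f : M → G} {y : EuclideanSpace ℝ (Fin 7)} (hy : y ∈ (extChartAt (𝓡 7) p).target)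
    (hf : MDifferentiableAt (𝓡 7) 𝓘(ℝ, G) f ((extChartAt (𝓡 7) p).symm y))
    (u : EuclideanSpace ℝ (Fin 7)) :
    DifferentiableAt ℝ (f ∘ (extChartAt (𝓡 7) p).symm) y ∧
    mvfderiv (𝓡 7) f ((extChartAt (𝓡 7) p).symm y) (coordField p u ((extChartAt (𝓡 7) p).symm y))
      = fderiv ℝ (f ∘ (extChartAt (𝓡 7) p).symm) y u := by
  have hs := mdifferentiableAt_extChartAt_symm hy
  refine ⟨(hf.comp y hs).differentiableAt, ?_⟩
  rw [← mfderiv_extChartAt_symm hy u, ← mfderiv_eq_fderiv, mfderiv_comp y hf hs]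
  rfl

theorem velocity_extChartAt_symm {p : M} {σ : ℝ → EuclideanSpace ℝ (Fin 7)}
    {σ' : EuclideanSpace ℝ (Fin 7)} {t : ℝ} (hy : σ t ∈ (extChartAt (𝓡 7) p).target)
    (hσ : HasDerivAt σ σ' t) :
    velocity (fun t => (extChartAt (𝓡 7) p).symm (σ t)) t =
      coordField p σ' ((extChartAt (𝓡 7) p).symm (σ t)) := by
  have hs := mdifferentiableAt_extChartAt_symm hy
  have h1 : MDifferentiableAt 𝓘(ℝ, ℝ) 𝓘(ℝ, EuclideanSpace ℝ (Fin 7)) σ t :=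
    hσ.differentiableAt.mdifferentiableAt
  have h2 := mfderiv_comp t hs h1
  have h3 : mfderiv 𝓘(ℝ, ℝ) 𝓘(ℝ, EuclideanSpace ℝ (Fin 7)) σ t (1 : ℝ) = σ' := by
    rw [mfderiv_eq_fderiv]
    exact fderiv_apply_one_eq_deriv.trans hσ.deriv
  rw [← mfderiv_extChartAt_symm hy]
  unfold velocity
  refine (congrArg (fun T => T (1 : ℝ)) h2).trans ?_
  exact congrArg (mfderiv 𝓘(ℝ, EuclideanSpace ℝ (Fin 7)) (𝓡 7) (extChartAt (𝓡 7) p).symm (σ t)) h3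

end Coordinates

/-! ### Adapted frames of an oriented Euclidean space of dimension seven -/

namespace G2

open Matrix

section Adapted

variable {V : Type*} [NormedAddCommGroup V] [InnerProductSpace ℝ V]

/-- The frame `e` is orthonormal, and `α` has in it the coefficients of the standard form. -/
def IsAdapted (α : V [⋀^Fin 3]→L[ℝ] ℝ) (e : Fin 7 → V) : Prop :=
  (∀ i j, inner ℝ (e i) (e j) = if i = j then (1 : ℝ) else 0) ∧
    ∀ i : Fin 3 → Fin 7, α (fun a => e (i a)) = stdForm (fun a => Pi.single (i a) 1)

/-- The coordinates of a vector in an orthonormal frame. -/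
def coords (e : Fin 7 → V) (v : V) : Fin 7 → ℝ := fun i => inner ℝ (e i) v

theorem coords_smul (e : Fin 7 → V) (c : ℝ) (v : V) : coords e (c • v) = c • coords e v := by
  ext i
  simp [coords, inner_smul_right]

theorem coords_sub (e : Fin 7 → V) (u v : V) : coords e (u - v) = coords e u - coords e v := by
  ext i
  simp [coords, inner_sub_right]

theorem coords_neg (e : Fin 7 → V) (v : V) : coords e (-v) = -coords e v := by
  ext i
  simp [coords]

theorem coords_sum {ι : Type*} (s : Finset ι) (e : Fin 7 → V) (v : ι → V) :
    coords e (∑ k ∈ s, v k) = ∑ k ∈ s, coords e (v k) := by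
  ext i
  simp [coords, inner_sum]

variable {e : Fin 7 → V} (he : ∀ i j, inner ℝ (e i) (e j) = if i = j then (1 : ℝ) else 0)
  (hV : Module.finrank ℝ V = 7)

include he in
theorem coords_self (j : Fin 7) : coords e (e j) = Pi.single j 1 := by
  ext i
  simp [coords, he, Pi.single_apply]

include he in
theorem coords_sum_smul (a : Fin 7 → ℝ) : coords e (∑ i, a i • e i) = a := by
  rw [coords_sum]
  simp_rw [coords_smul, coords_self he]
  ext i
  simp [Finset.sum_apply, Pi.single_apply]

include he hV in
theorem sum_coords_smul (v : V) : ∑ i, coords e v i • e i = v := by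
  have : FiniteDimensional ℝ V := Module.finite_of_finrank_pos (by omega)
  have ho : Orthonormal ℝ e := orthonormal_iff_ite.2 he
  have hb : ⊤ ≤ Submodule.span ℝ (Set.range e) :=
    (ho.linearIndependent.span_eq_top_of_card_eq_finrank' (by simp [hV])).ge
  have h := (OrthonormalBasis.mk ho hb).sum_repr' v
  simpa [coords] using h

include he hV in
theorem inner_eq_coords (u v : V) : inner ℝ u v = coords e u ⬝ᵥ coords e v := by
  conv_lhs => rw [← sum_coords_smul he hV u]
  simp [sum_inner, inner_smul_left, dotProduct, coords]

include he hV in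
theorem coords_injective : Function.Injective (coords e) := fun u v h => by
  rw [← sum_coords_smul he hV u, h, sum_coords_smul he hV v]

theorem IsAdapted.apply_eq {α : V [⋀^Fin 3]→L[ℝ] ℝ} (ha : IsAdapted α e)
    (hV : Module.finrank ℝ V = 7) (v : Fin 3 → V) :
    α v = cross (coords e (v 0)) (coords e (v 1)) ⬝ᵥ coords e (v 2) := by
  have h1 : α v = ∑ r : Fin 3 → Fin 7, (∏ a, coords e (v a) (r a)) • α (fun a => e (r a)) := by
    conv_lhs => rw [show v = fun a => ∑ i, coords e (v a) i • e i from
      funext fun a => (sum_coords_smul ha.1 hV (v a)).symm]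
    refine (α.toMultilinearMap.map_sum (fun a i => coords e (v a) i • e i)).trans ?_
    exact Finset.sum_congr rfl fun r _ => α.toMultilinearMap.map_smul_univ _ _
  rw [h1]
  simp_rw [ha.2, stdForm_single]
  -- The sum over maps `Fin 3 → Fin 7` is unrolled into a triple sum to match the coordinate
  -- expansion of the cross product.
  rw [← (Fin.consEquiv fun _ => Fin 7).sum_comp, Fintype.sum_prod_type]
  simp_rw [← (Fin.consEquiv fun _ => Fin 7).sum_comp, Fintype.sum_prod_type]
  simp_rw [← (Fin.consEquiv fun _ => Fin 7).sum_comp, Fintype.sum_prod_type]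
  simp only [dotProduct, cross_eq_sum, Finset.sum_mul]
  simp only [Fin.consEquiv_apply, Fin.prod_univ_three, Fin.cons_zero, Fin.cons_one,
    Fintype.sum_unique, smul_eq_mul]
  rw [Finset.sum_comm]
  conv_rhs => rw [Finset.sum_comm]
  rw [Finset.sum_comm]
  refine Finset.sum_congr rfl fun i _ => ?_
  rw [Finset.sum_comm]
  conv_rhs => rw [Finset.sum_comm]
  rw [Finset.sum_comm]
  refine Finset.sum_congr rfl fun j _ => Finset.sum_congr rfl fun k _ => ?_
  change coords e (v 0) i * coords e (v 1) j * coords e (v 2) k * coeff i j k = _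
  ring

theorem isAdapted_iff_coords {α : V [⋀^Fin 3]→L[ℝ] ℝ} (ha : IsAdapted α e)
    (hV : Module.finrank ℝ V = 7) (e' : Fin 7 → V) :
    IsAdapted α e' ↔
      (∀ i j, coords e (e' i) ⬝ᵥ coords e (e' j) = if i = j then (1 : ℝ) else 0) ∧
      ∀ i : Fin 3 → Fin 7, stdForm (fun a => coords e (e' (i a))) =
        stdForm (fun a => Pi.single (i a) 1) := by
  simp_rw [IsAdapted, inner_eq_coords ha.1 hV, ha.apply_eq hV, stdForm_eq]

/-- The matrix of an adapted frame `e'` in an adapted frame `e`. -/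
def changeMatrix (e e' : Fin 7 → V) : Matrix (Fin 7) (Fin 7) ℝ := Matrix.of fun i j => inner ℝ (e i) (e' j)

theorem coords_changeMatrix (a : Fin 7 → ℝ) (e' : Fin 7 → V) :
    coords e (∑ i, a i • e' i) = changeMatrix e e' *ᵥ a := by
  rw [coords_sum]
  ext i
  simp [coords_smul, changeMatrix, mulVec, dotProduct, coords, mul_comm]

include he hV in
theorem eq_sum_changeMatrix (e' : Fin 7 → V) (j : Fin 7) :
    e' j = ∑ i, changeMatrix e e' i j • e i := (sum_coords_smul he hV (e' j)).symm

theorem IsAdapted.transpose_mul_changeMatrix {α : V [⋀^Fin 3]→L[ℝ] ℝ} {e e' : Fin 7 → V}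
    (ha : IsAdapted α e) (ha' : IsAdapted α e') (hV : Module.finrank ℝ V = 7) :
    (changeMatrix e e')ᵀ * changeMatrix e e' = 1 := by
  ext i j
  have := inner_eq_coords ha.1 hV (e' i) (e' j)
  rw [ha'.1] at this
  rw [Matrix.one_apply, this]
  rfl

/-- Both frames compute the same form, so the matrix preserves `φ`; being orthogonal, it preserves
the cross product dual to `φ`. -/
theorem IsAdapted.changeMatrix_cross {α : V [⋀^Fin 3]→L[ℝ] ℝ} {e e' : Fin 7 → V}
    (ha : IsAdapted α e) (ha' : IsAdapted α e') (hV : Module.finrank ℝ V = 7) (a b : Fin 7 → ℝ) :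
    changeMatrix e e' *ᵥ cross a b = cross (changeMatrix e e' *ᵥ a) (changeMatrix e e' *ᵥ b) := by
  set h := changeMatrix e e' with hh
  have h1 := ha.transpose_mul_changeMatrix ha' hV
  have h2 : h * hᵀ = 1 := mul_eq_one_comm.1 h1
  have key : ∀ a b c : Fin 7 → ℝ, cross (h *ᵥ a) (h *ᵥ b) ⬝ᵥ (h *ᵥ c) = cross a b ⬝ᵥ c := by
    intro a b c
    have e1 := ha.apply_eq hV ![∑ i, a i • e' i, ∑ i, b i • e' i, ∑ i, c i • e' i]
    have e2 := ha'.apply_eq hV ![∑ i, a i • e' i, ∑ i, b i • e' i, ∑ i, c i • e' i]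
    simp only [Matrix.cons_val, coords_changeMatrix, coords_sum_smul ha'.1] at e1 e2
    rw [← hh] at e1
    exact e1.symm.trans e2
  refine dotProduct_eq _ _ fun x => ?_
  have hx : x = h *ᵥ (hᵀ *ᵥ x) := by rw [mulVec_mulVec, h2, one_mulVec]
  conv_rhs => rw [hx, key]
  rw [dotProduct_comm, dotProduct_mulVec, dotProduct_comm, ← mulVec_transpose]

/-- The cross product of a vector space of dimension seven, written in an orthonormal frame. -/
def crossVec (α : V [⋀^Fin 3]→L[ℝ] ℝ) (f : Fin 7 → V) (u v : V) : V :=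
  ∑ k, α ![u, v, f k] • f k

/-- `crossVec` does not depend on the orthonormal frame `f`. Hence a smooth orthonormal frame, not
yet adapted, already exhibits the cross product as smooth. -/
theorem IsAdapted.coords_crossVec {α : V [⋀^Fin 3]→L[ℝ] ℝ} (ha : IsAdapted α e)
    (hV : Module.finrank ℝ V = 7) {f : Fin 7 → V}
    (hf : ∀ i j, inner ℝ (f i) (f j) = if i = j then (1 : ℝ) else 0) (u v : V) :
    coords e (crossVec α f u v) = cross (coords e u) (coords e v) := by
  have h1 : crossVec α f u v = ∑ i, cross (coords e u) (coords e v) i • e i := by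
    set w := ∑ i, cross (coords e u) (coords e v) i • e i with hw
    rw [← sum_coords_smul hf hV w, crossVec]
    refine Finset.sum_congr rfl fun k _ => ?_
    rw [ha.apply_eq hV, coords, inner_eq_coords ha.1 hV, hw, coords_sum_smul ha.1, dotProduct_comm]
    rfl
  rw [h1, coords_sum_smul ha.1]

/-- The adapted frame determined by three orthonormal vectors. -/
def adaptedOf (α : V [⋀^Fin 3]→L[ℝ] ℝ) (f : Fin 7 → V) (a b d : V) : Fin 7 → V :=
  ![a, b, d, crossVec α f (crossVec α f a b) d, crossVec α f a d, -crossVec α f b d,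
    crossVec α f a b]

theorem IsAdapted.coords_adaptedOf {α : V [⋀^Fin 3]→L[ℝ] ℝ} (ha : IsAdapted α e)
    (hV : Module.finrank ℝ V = 7) {f : Fin 7 → V}
    (hf : ∀ i j, inner ℝ (f i) (f j) = if i = j then (1 : ℝ) else 0) (a b d : V) (j : Fin 7) :
    coords e (adaptedOf α f a b d j) = frameOf (coords e a) (coords e b) (coords e d) j := by
  fin_cases j <;> simp [adaptedOf, frameOf, ha.coords_crossVec hV hf, coords_neg]

theorem IsAdapted.isAdapted_adaptedOf {α : V [⋀^Fin 3]→L[ℝ] ℝ} (ha : IsAdapted α e)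
    (hV : Module.finrank ℝ V = 7) {f : Fin 7 → V}
    (hf : ∀ i j, inner ℝ (f i) (f j) = if i = j then (1 : ℝ) else 0) {a b d : V}
    (haa : inner ℝ a a = (1 : ℝ)) (hbb : inner ℝ b b = (1 : ℝ)) (hdd : inner ℝ d d = (1 : ℝ))
    (hab : inner ℝ a b = (0 : ℝ)) (had : inner ℝ a d = (0 : ℝ)) (hbd : inner ℝ b d = (0 : ℝ))
    (hc : inner ℝ (crossVec α f a b) d = (0 : ℝ)) : IsAdapted α (adaptedOf α f a b d) := by
  simp only [inner_eq_coords ha.1 hV, ha.coords_crossVec hV hf] at haa hbb hdd hab had hbd hc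
  refine (isAdapted_iff_coords ha hV _).2 ⟨fun i j => ?_, fun i => ?_⟩
  · rw [ha.coords_adaptedOf hV hf, ha.coords_adaptedOf hV hf]
    exact frameOf_dotProduct haa hbb hdd hab had hbd hc i j
  · simp_rw [ha.coords_adaptedOf hV hf]
    exact stdForm_frameOf haa hbb hdd hab had hbd hc i

theorem frameOf_single (j : Fin 7) :
    frameOf (Pi.single 0 1) (Pi.single 1 1) (Pi.single 2 1) j = Pi.single j 1 := by
  ext k
  fin_cases j <;> fin_cases k <;> simp [frameOf, cross]

/-- Guarantees that the local frame built below takes the prescribed value at the base point. -/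
theorem IsAdapted.adaptedOf_self {α : V [⋀^Fin 3]→L[ℝ] ℝ} (ha : IsAdapted α e)
    (hV : Module.finrank ℝ V = 7) : adaptedOf α e (e 0) (e 1) (e 2) = e := by
  ext1 j
  refine coords_injective ha.1 hV ?_
  rw [ha.coords_adaptedOf hV ha.1, coords_self ha.1, coords_self ha.1, coords_self ha.1,
    frameOf_single, coords_self ha.1]

theorem IsAdapted.crossVec_self {α : V [⋀^Fin 3]→L[ℝ] ℝ} (ha : IsAdapted α e)
    (hV : Module.finrank ℝ V = 7) : crossVec α e (e 0) (e 1) = e 6 :=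
  congrFun (ha.adaptedOf_self hV) 6

end Adapted

end G2

/-! ### Smooth local frames -/

section LocalFrames

variable {M : Type*} [TopologicalSpace M] [ChartedSpace (EuclideanSpace ℝ (Fin 7)) M]
  [IsManifold (𝓡 7) ∞ M]

theorem finrank_tangentSpace (x : M) : Module.finrank ℝ (TangentSpace (𝓡 7) x) = 7 :=
  finrank_euclideanSpace_fin (𝕜 := ℝ) (n := 7)

/-- The vector field `X` is smooth at all points near `p`. -/
def FieldSmoothNear (p : M) (X : ∀ x : M, TangentSpace (𝓡 7) x) : Prop :=
  ∀ᶠ y in 𝓝 p, ContMDiffAt (𝓡 7) (𝓡 7).tangent ∞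
    (fun x => (⟨x, X x⟩ : TangentBundle (𝓡 7) M)) y

/-- The function `f` is smooth at all points near `p`. -/
def FunSmoothNear (p : M) (f : M → ℝ) : Prop :=
  ∀ᶠ y in 𝓝 p, ContMDiffAt (𝓡 7) 𝓘(ℝ, ℝ) ∞ f y

variable {p : M} {X Y : ∀ x : M, TangentSpace (𝓡 7) x} {f g : M → ℝ}

theorem FieldSmoothNear.sub (hX : FieldSmoothNear p X) (hY : FieldSmoothNear p Y) :
    FieldSmoothNear p fun x => X x - Y x :=
  (Filter.Eventually.and hX hY).mono fun _ h => h.1.sub_section h.2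

theorem FieldSmoothNear.neg (hX : FieldSmoothNear p X) : FieldSmoothNear p fun x => -X x :=
  Filter.Eventually.mono hX fun _ h => h.neg_section

theorem FieldSmoothNear.smul (hf : FunSmoothNear p f) (hX : FieldSmoothNear p X) :
    FieldSmoothNear p fun x => f x • X x :=
  (Filter.Eventually.and hf hX).mono fun _ h => h.1.smul_section h.2

theorem FieldSmoothNear.sum {ι : Type*} {s : Finset ι} {X : ι → ∀ x : M, TangentSpace (𝓡 7) x}
    (hX : ∀ i ∈ s, FieldSmoothNear p (X i)) : FieldSmoothNear p fun x => ∑ i ∈ s, X i x := by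
  have h := (Filter.eventually_all_finset s).2 hX
  exact h.mono fun _ h => ContMDiffAt.sum_section h

theorem FunSmoothNear.div (hf : FunSmoothNear p f) (hg : FunSmoothNear p g) (h0 : g p ≠ 0) :
    FunSmoothNear p fun x => f x / g x := by
  have hc : ContinuousAt g p := hg.self_of_nhds.continuousAt
  exact ((Filter.Eventually.and hf hg).and (hc.eventually_ne h0)).mono fun _ h => h.1.1.div₀ h.1.2 h.2

theorem FunSmoothNear.sqrt (hf : FunSmoothNear p f) (h0 : f p ≠ 0) :
    FunSmoothNear p fun x => √(f x) := by
  have hc : ContinuousAt f p := hf.self_of_nhds.continuousAt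
  exact (Filter.Eventually.and hf (hc.eventually_ne h0)).mono fun x h =>
    (Real.contDiffAt_sqrt h.2).contMDiffAt.comp x h.1

theorem FunSmoothNear.const (c : ℝ) : FunSmoothNear p fun _ => c :=
  .of_forall fun _ => contMDiffAt_const

variable [RiemannianBundle (TangentSpace (𝓡 7) : M → Type _)]
    [IsContMDiffRiemannianBundle (𝓡 7) ∞ (EuclideanSpace ℝ (Fin 7))
      (TangentSpace (𝓡 7) : M → Type _)]

theorem FieldSmoothNear.inner (hX : FieldSmoothNear p X) (hY : FieldSmoothNear p Y) :
    FunSmoothNear p fun x => inner ℝ (X x) (Y x) :=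
  (Filter.Eventually.and hX hY).mono fun _ h => h.1.inner_bundle h.2

theorem FieldSmoothNear.normalize (hX : FieldSmoothNear p X) (h0 : X p ≠ 0) :
    FieldSmoothNear p fun x => ‖X x‖⁻¹ • X x := by
  have h1 : FunSmoothNear p fun x => 1 / √(Inner.inner ℝ (X x) (X x)) :=
    (FunSmoothNear.const 1).div ((hX.inner hX).sqrt (by simpa using h0)) (by
      rw [← norm_eq_sqrt_real_inner]; simpa using h0)
  simpa [← norm_eq_sqrt_real_inner] using FieldSmoothNear.smul h1 hX

/-- Orthonormality at `p` makes the process trivial at `p`, so the denominators are non-zero there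
and hence nearby. -/
theorem FieldSmoothNear.gramSchmidt {X : Fin 7 → ∀ x : M, TangentSpace (𝓡 7) x}
    (hX : ∀ i, FieldSmoothNear p (X i)) (ho : Orthonormal ℝ fun i => X i p) (i : Fin 7) :
    FieldSmoothNear p fun x => InnerProductSpace.gramSchmidt ℝ (fun k => X k x) i := by
  have hp : InnerProductSpace.gramSchmidt ℝ (fun k => X k p) = fun k => X k p :=
    InnerProductSpace.gramSchmidt_of_orthogonal ℝ ho.2
  induction i using WellFoundedLT.induction with
  | ind i ih =>
    have h1 : ∀ x, InnerProductSpace.gramSchmidt ℝ (fun k => X k x) i = X i x -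
        ∑ j ∈ Finset.Iio i, (Inner.inner ℝ (InnerProductSpace.gramSchmidt ℝ (fun k => X k x) j)
          (X i x) / Inner.inner ℝ (InnerProductSpace.gramSchmidt ℝ (fun k => X k x) j)
            (InnerProductSpace.gramSchmidt ℝ (fun k => X k x) j)) •
              InnerProductSpace.gramSchmidt ℝ (fun k => X k x) j := by
      intro x
      rw [eq_sub_iff_add_eq]
      conv_rhs => rw [InnerProductSpace.gramSchmidt_def'' ℝ (fun k => X k x) i]
      simp
    simp_rw [h1]
    refine (hX i).sub (FieldSmoothNear.sum fun j hj => ?_)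
    have hj' := ih j (Finset.mem_Iio.1 hj)
    refine FieldSmoothNear.smul ((hj'.inner (hX i)).div (hj'.inner hj') ?_) hj'
    rw [hp]
    simp [ho.1 j]

theorem exists_orthonormal_near (e₀ : Fin 7 → TangentSpace (𝓡 7) p) (ho : Orthonormal ℝ e₀) :
    ∃ f : Fin 7 → ∀ x : M, TangentSpace (𝓡 7) x, (∀ i, f i p = e₀ i) ∧
      (∀ i, FieldSmoothNear p (f i)) ∧
      ∀ᶠ x in 𝓝 p, ∀ i j, inner ℝ (f i x) (f j x) = if i = j then (1 : ℝ) else 0 := by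
  set X : Fin 7 → ∀ x : M, TangentSpace (𝓡 7) x := fun k => coordField p
    (mfderiv (𝓡 7) 𝓘(ℝ, EuclideanSpace ℝ (Fin 7)) (extChartAt (𝓡 7) p) p (e₀ k)) with hX
  have hXp : ∀ k, X k p = e₀ k := fun k => coordField_mfderiv _ (mem_extChartAt_source p)
  have hXs : ∀ k, FieldSmoothNear p (X k) := fun k =>
    Filter.Eventually.mono (extChartAt_source_mem_nhds (I := 𝓡 7) p) fun y hy =>
      contMDiffAt_coordField _ hy
  have hXo : Orthonormal ℝ fun i => X i p := by simpa only [hXp] using ho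
  set g : Fin 7 → ∀ x : M, TangentSpace (𝓡 7) x :=
    fun i x => InnerProductSpace.gramSchmidt ℝ (fun k => X k x) i with hg
  have hgs : ∀ i, FieldSmoothNear p (g i) := FieldSmoothNear.gramSchmidt hXs hXo
  have hgp : ∀ i, g i p = e₀ i := fun i => by
    rw [← hXp]
    exact congrFun (InnerProductSpace.gramSchmidt_of_orthogonal ℝ hXo.2) i
  have hn : ∀ i, ‖g i p‖ = 1 := fun i => by rw [hgp, ho.1]
  have hne : ∀ i, g i p ≠ 0 := fun i h => by simpa [h] using hn i
  refine ⟨fun i x => ‖g i x‖⁻¹ • g i x, fun i => ?_, fun i => (hgs i).normalize (hne i), ?_⟩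
  · simp only [hgp, ho.1]; simp
  · have h1 : ∀ᶠ x in 𝓝 p, ∀ i, inner ℝ (g i x) (g i x) ≠ (0 : ℝ) := by
      refine Filter.eventually_all.2 fun i => ?_
      have hc : ContinuousAt (fun x => (inner ℝ (g i x) (g i x) : ℝ)) p :=
        ((hgs i).inner (hgs i)).self_of_nhds.continuousAt
      exact hc.eventually_ne (by simpa using hne i)
    filter_upwards [h1] with x hx i j
    have hxi : ∀ i, ‖g i x‖ ≠ 0 := fun i => by simpa using hx i
    rw [inner_smul_left, inner_smul_right]
    split_ifs with hij
    · subst hij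
      rw [real_inner_self_eq_norm_sq]
      have := hxi i
      simp only [conj_trivial]
      field_simp
    · rw [InnerProductSpace.gramSchmidt_orthogonal ℝ _ hij]
      simp

variable {φ : ∀ x : M, (TangentSpace (𝓡 7) x) [⋀^Fin 3]→L[ℝ] ℝ}

theorem isAdaptedFrame_iff {x : M} {e : Fin 7 → TangentSpace (𝓡 7) x} :
    IsAdaptedFrame φ x e ↔ G2.IsAdapted (φ x) e := Iff.rfl

theorem IsG2Structure.funSmoothNear (hφ : IsG2Structure φ)
    {X : Fin 3 → ∀ x : M, TangentSpace (𝓡 7) x} (hX : ∀ k, FieldSmoothNear p (X k)) :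
    FunSmoothNear p fun x => φ x fun k => X k x := by
  obtain ⟨U, hU, hUo, hpU⟩ := eventually_nhds_iff.1 (Filter.eventually_all.2 hX)
  have h := hφ.smooth U X hUo fun k x hx => (hU x hx k).contMDiffWithinAt
  exact Filter.mem_of_superset (hUo.mem_nhds hpU) fun x hx => h.contMDiffAt (hUo.mem_nhds hx)

theorem IsG2Structure.crossVec (hφ : IsG2Structure φ) {f : Fin 7 → ∀ x : M, TangentSpace (𝓡 7) x}
    (hf : ∀ k, FieldSmoothNear p (f k)) (hX : FieldSmoothNear p X) (hY : FieldSmoothNear p Y) :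
    FieldSmoothNear p fun x => G2.crossVec (φ x) (fun k => f k x) (X x) (Y x) := by
  refine FieldSmoothNear.sum fun k _ => FieldSmoothNear.smul ?_ (hf k)
  have h := hφ.funSmoothNear (X := ![X, Y, f k]) (p := p) fun i => by
    fin_cases i
    exacts [hX, hY, hf k]
  refine h.mono fun x hx => hx.congr_of_eventuallyEq (.of_forall fun y => ?_)
  have h1 : (fun i => (![X, Y, f k] : Fin 3 → ∀ x : M, TangentSpace (𝓡 7) x) i y) =
      ![X y, Y y, f k y] := by
    funext i
    fin_cases i <;> rfl
  exact congrArg (φ y) h1.symm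

/-- An adapted frame is determined by three orthonormal vectors with the third orthogonal to the
product of the first two. Such a triple is obtained from a smooth orthonormal frame by correcting
its third vector alone. -/
theorem exists_adapted_near (hφ : IsG2Structure φ) {e₀ : Fin 7 → TangentSpace (𝓡 7) p}
    (he₀ : IsAdaptedFrame φ p e₀) :
    ∃ e : Fin 7 → ∀ x : M, TangentSpace (𝓡 7) x, (∀ i, e i p = e₀ i) ∧
      (∀ i, FieldSmoothNear p (e i)) ∧ ∀ᶠ x in 𝓝 p, IsAdaptedFrame φ x fun i => e i x := by
  obtain ⟨f, hfp, hfs, hfo⟩ := exists_orthonormal_near e₀ (orthonormal_iff_ite.2 he₀.1)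
  set c : ∀ x : M, TangentSpace (𝓡 7) x :=
    fun x => G2.crossVec (φ x) (fun k => f k x) (f 0 x) (f 1 x) with hc
  have hcs : FieldSmoothNear p c := hφ.crossVec hfs (hfs 0) (hfs 1)
  -- Since `c = f 0 × f 1` is orthogonal to `f 0` and `f 1`, this projection keeps the third vector
  -- orthogonal to both.
  set d' : ∀ x : M, TangentSpace (𝓡 7) x :=
    fun x => f 2 x - (inner ℝ (c x) (f 2 x) : ℝ) • c x with hd'
  have hd's : FieldSmoothNear p d' := (hfs 2).sub (FieldSmoothNear.smul (hcs.inner (hfs 2)) hcs)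
  have hcp : c p = e₀ 6 := by
    simp only [hc, hfp]
    exact G2.IsAdapted.crossVec_self (isAdaptedFrame_iff.1 he₀) (finrank_tangentSpace p)
  have hd'p : d' p = e₀ 2 := by
    simp only [hd', hcp, hfp, he₀.1]
    simp
  have hne : d' p ≠ 0 := fun h => by
    have := he₀.1 2 2
    rw [← hd'p, h] at this
    simp at this
  set d : ∀ x : M, TangentSpace (𝓡 7) x := fun x => ‖d' x‖⁻¹ • d' x with hd
  have hds : FieldSmoothNear p d := hd's.normalize hne
  have hn : ‖e₀ 2‖ = 1 := (orthonormal_iff_ite.2 he₀.1).1 2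
  have hdp : d p = e₀ 2 := by simp [hd, hd'p, hn]
  refine ⟨fun i x => G2.adaptedOf (φ x) (fun k => f k x) (f 0 x) (f 1 x) (d x) i, fun i => ?_,
    fun i => ?_, ?_⟩
  · simp only [hfp, hdp]
    exact congrFun (G2.IsAdapted.adaptedOf_self (isAdaptedFrame_iff.1 he₀)
      (finrank_tangentSpace p)) i
  · fin_cases i
    exacts [hfs 0, hfs 1, hds, hφ.crossVec hfs hcs hds, hφ.crossVec hfs (hfs 0) hds,
      (hφ.crossVec hfs (hfs 1) hds).neg, hcs]
  · have h1 : ∀ᶠ x in 𝓝 p, inner ℝ (d' x) (d' x) ≠ (0 : ℝ) := by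
      have hcont : ContinuousAt (fun x => (inner ℝ (d' x) (d' x) : ℝ)) p :=
        (hd's.inner hd's).self_of_nhds.continuousAt
      exact hcont.eventually_ne (by simpa using hne)
    filter_upwards [h1, hfo] with x hx hox
    obtain ⟨g, hg⟩ := hφ.exists_adaptedFrame x
    have hV := finrank_tangentSpace x
    have hg' := isAdaptedFrame_iff.1 hg
    have hcc := hg'.coords_crossVec hV hox (f 0 x) (f 1 x)
    have hi := fun u v => G2.inner_eq_coords hg'.1 hV u v
    have h0 : inner ℝ (f 0 x) (c x) = (0 : ℝ) := by
      rw [hi, hcc, dotProduct_comm, G2.cross_dotProduct_left]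
    have h2 : inner ℝ (f 1 x) (c x) = (0 : ℝ) := by
      rw [hi, hcc, dotProduct_comm, G2.cross_dotProduct_right]
    have h3 : inner ℝ (c x) (c x) = (1 : ℝ) := by
      rw [hi, hcc, G2.cross_dotProduct_cross, ← hi, ← hi, ← hi, hox, hox, hox]
      simp
    refine hg'.isAdapted_adaptedOf hV hox (by rw [hox]; simp) (by rw [hox]; simp) ?_
      (by rw [hox]; simp) ?_ ?_ ?_
    · have hxn : ‖d' x‖ ≠ 0 := by simpa using hx
      simp only [hd, inner_smul_left, inner_smul_right, real_inner_self_eq_norm_sq, conj_trivial]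
      field_simp
    · simp only [hd, hd', inner_smul_right, inner_sub_right, h0, hox]
      simp
    · simp only [hd, hd', inner_smul_right, inner_sub_right, h2, hox]
      simp
    · change inner ℝ (c x) (d x) = (0 : ℝ)
      simp only [hd, hd', inner_smul_right, inner_sub_right, h3]
      simp

/-- Every adapted frame of a tangent space extends to a local adapted frame which consists of
global smooth vector fields. -/
theorem exists_isLocalAdaptedFrame [T2Space M] (hφ : IsG2Structure φ)
    {e₀ : Fin 7 → TangentSpace (𝓡 7) p} (he₀ : IsAdaptedFrame φ p e₀) :
    ∃ (U : Set M) (e : Fin 7 → ∀ x : M, TangentSpace (𝓡 7) x), p ∈ U ∧ (∀ i, e i p = e₀ i) ∧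
      IsLocalAdaptedFrame φ U e ∧ ∀ i, ContMDiff (𝓡 7) (𝓡 7).tangent ∞
        (fun x => (⟨x, e i x⟩ : TangentBundle (𝓡 7) M)) := by
  obtain ⟨e, hep, hes, hea⟩ := exists_adapted_near hφ he₀
  obtain ⟨V, hV, hVo, hpV⟩ := eventually_nhds_iff.1 ((Filter.eventually_all.2 hes).and hea)
  obtain ⟨ψ, -, hψ⟩ := (SmoothBumpFunction.nhds_basis_tsupport (I := 𝓡 7) p).mem_iff.1
    (hVo.mem_nhds hpV)
  -- The bump function makes the fields globally smooth, the form in which smoothness of the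
  -- connection is applied to them.
  have hs : ∀ i, ContMDiff (𝓡 7) (𝓡 7).tangent ∞
      (fun x => (⟨x, ψ x • e i x⟩ : TangentBundle (𝓡 7) M)) := fun i =>
    ContMDiffOn.smul_section_of_tsupport ψ.contMDiff.contMDiffOn hVo hψ
      fun x hx => ((hV x hx).1 i).contMDiffWithinAt
  obtain ⟨U, hU, hUo, hpU⟩ := eventually_nhds_iff.1 ψ.eventuallyEq_one
  refine ⟨U ∩ V, fun i x => ψ x • e i x, ⟨hpU, hpV⟩, fun i => ?_, ⟨hUo.inter hVo,
    fun i => (hs i).contMDiffOn, fun x hx => ?_⟩, hs⟩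
  · simp [hep]
  · have h := (hV x hx.2).2
    simpa [hU x hx.1] using h

end LocalFrames

/-! ### The first Bianchi identity in a chart -/

namespace G2

open Matrix

/-- The action of matrices on vectors as a continuous bilinear map. -/
def mulVecL : (Fin 7 → Fin 7 → ℝ) →L[ℝ] (Fin 7 → ℝ) →L[ℝ] Fin 7 → ℝ :=
  LinearMap.toContinuousLinearMap
    ((LinearMap.toContinuousLinearMap : ((Fin 7 → ℝ) →ₗ[ℝ] Fin 7 → ℝ) ≃ₗ[ℝ] _).toLinearMap ∘ₗ
      LinearMap.mk₂ ℝ (fun (A : Fin 7 → Fin 7 → ℝ) v => Matrix.of A *ᵥ v)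
        (fun _ _ _ => add_mulVec (Matrix.of _) (Matrix.of _) _)
        (fun c A v => smul_mulVec c (Matrix.of A) v)
        (fun _ v w => mulVec_add _ v w) (fun c _ v => mulVec_smul _ c v))

theorem mulVecL_apply (A : Fin 7 → Fin 7 → ℝ) (v : Fin 7 → ℝ) :
    mulVecL A v = Matrix.of A *ᵥ v := rfl

/-- The cross product as a continuous bilinear map. -/
def crossL : (Fin 7 → ℝ) →L[ℝ] (Fin 7 → ℝ) →L[ℝ] Fin 7 → ℝ :=
  LinearMap.toContinuousLinearMap
    ((LinearMap.toContinuousLinearMap : ((Fin 7 → ℝ) →ₗ[ℝ] Fin 7 → ℝ) ≃ₗ[ℝ] _).toLinearMap ∘ₗ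
      LinearMap.mk₂ ℝ (fun a b : Fin 7 → ℝ => cross a b) cross_add_left
        (fun c a b => cross_smul_left c a b) cross_add_right (fun c a b => cross_smul_right c a b))

theorem crossL_apply (a b : Fin 7 → ℝ) : crossL a b = cross a b := rfl

section Curvature

variable {E : Type} [NormedAddCommGroup E] [NormedSpace ℝ E]

/-- The curvature of the connection `d + W` on a trivial vector bundle, applied to `ξ`. -/
def curv (W : E → E → Fin 7 → Fin 7 → ℝ) (u v y : E) (ξ : Fin 7 → ℝ) : Fin 7 → ℝ :=
  mulVecL (fderiv ℝ (W v) y u) ξ - mulVecL (fderiv ℝ (W u) y v) ξ +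
    mulVecL (W u y) (mulVecL (W v y) ξ) - mulVecL (W v y) (mulVecL (W u y) ξ)

theorem fderiv_bilinear {F G K : Type*} [NormedAddCommGroup F] [NormedSpace ℝ F]
    [NormedAddCommGroup G] [NormedSpace ℝ G] [NormedAddCommGroup K] [NormedSpace ℝ K]
    (B : F →L[ℝ] G →L[ℝ] K) {f : E → F} {g : E → G} {y : E} (hf : DifferentiableAt ℝ f y)
    (hg : DifferentiableAt ℝ g y) :
    DifferentiableAt ℝ (fun z => B (f z) (g z)) y ∧
      ∀ u, fderiv ℝ (fun z => B (f z) (g z)) y u =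
        B (fderiv ℝ f y u) (g y) + B (f y) (fderiv ℝ g y u) := by
  have h := B.hasFDerivAt_of_bilinear hf.hasFDerivAt hg.hasFDerivAt
  refine ⟨h.differentiableAt, fun u => ?_⟩
  rw [h.fderiv]
  simp [add_comm]

theorem fderiv_fderiv_comm {F : Type*} [NormedAddCommGroup F] [NormedSpace ℝ F] {f : E → F} {y : E}
    (hf : ContDiffAt ℝ ∞ f y) (u v : E) :
    fderiv ℝ (fun z => fderiv ℝ f z v) y u = fderiv ℝ (fun z => fderiv ℝ f z u) y v := by
  have hd : DifferentiableAt ℝ (fderiv ℝ f) y :=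
    (hf.fderiv_right (m := 1) (by norm_cast)).differentiableAt (by simp)
  have h : ∀ w, fderiv ℝ (fun z => fderiv ℝ f z w) y = (fderiv ℝ (fderiv ℝ f) y).flip w := by
    intro w
    ext x
    rw [fderiv_clm_apply hd (differentiableAt_const w)]
    simp
  rw [h, h]
  exact (hf.isSymmSndFDerivAt (by rw [minSmoothness_of_isRCLikeNormedField]; norm_cast)) u v

theorem differentiableAt_fderiv_apply {F : Type*} [NormedAddCommGroup F] [NormedSpace ℝ F]
    {f : E → F} {y : E} (hf : ContDiffAt ℝ ∞ f y) (v : E) :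
    DifferentiableAt ℝ (fun z => fderiv ℝ f z v) y :=
  ((hf.fderiv_right (m := 1) (by norm_cast)).differentiableAt (by simp)).clm_apply
    (differentiableAt_const v)

variable {W : E → E → Fin 7 → Fin 7 → ℝ} {b : E → E → Fin 7 → ℝ} {y : E} {c : ℝ}

/-- A parallel section lies in the kernel of the curvature. -/
theorem curv_eq_zero_of_parallel {ξ : E → Fin 7 → ℝ} (hW : ∀ u, ContDiffAt ℝ ∞ (W u) y)
    (hξ : ContDiffAt ℝ ∞ ξ y)
    (hp : ∀ᶠ z in 𝓝 y, ∀ u, fderiv ℝ ξ z u + mulVecL (W u z) (ξ z) = 0) (u v : E) :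
    curv W u v y (ξ y) = 0 := by
  have hWd : ∀ u, DifferentiableAt ℝ (W u) y := fun u => (hW u).differentiableAt (by simp)
  have hξd : DifferentiableAt ℝ ξ y := hξ.differentiableAt (by simp)
  have h1 : ∀ u, fderiv ℝ ξ y u = -mulVecL (W u y) (ξ y) := fun u =>
    eq_neg_of_add_eq_zero_left (hp.self_of_nhds u)
  have h2 : ∀ u v, fderiv ℝ (fun z => fderiv ℝ ξ z v) y u =
      -(mulVecL (fderiv ℝ (W v) y u) (ξ y) + mulVecL (W v y) (fderiv ℝ ξ y u)) := by
    intro u v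
    have he : (fun z => fderiv ℝ ξ z v) =ᶠ[𝓝 y] fun z => -mulVecL (W v z) (ξ z) :=
      hp.mono fun z hz => eq_neg_of_add_eq_zero_left (hz v)
    rw [he.fderiv_eq, fderiv_fun_neg, _root_.neg_apply, (fderiv_bilinear mulVecL (hWd v) hξd).2 u]
  have h3 := fderiv_fderiv_comm hξ u v
  rw [h2, h2, h1, h1, map_neg, map_neg] at h3
  rw [curv]
  linear_combination -h3

/-- The algebra behind the first Bianchi identity: `W`, `B` are bilinear, `d i j` stands for the
derivative of `b j` in the direction `i`, `D i j` for that of `W j`, and `s i j k` for the second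
derivative of `b k` in the directions `i`, `j`. -/
theorem bianchi_algebra {A V : Type*} [AddCommGroup A] [Module ℝ A] [AddCommGroup V] [Module ℝ V]
    (m : A →ₗ[ℝ] V →ₗ[ℝ] V) (x : V →ₗ[ℝ] V →ₗ[ℝ] V) (c : ℝ) (b : Fin 3 → V) (W : Fin 3 → A)
    (d : Fin 3 → Fin 3 → V) (D : Fin 3 → Fin 3 → A) (s : Fin 3 → Fin 3 → Fin 3 → V)
    (hx : ∀ a b, x a b = -x b a) (hs : ∀ i j k, s i j k = s j i k)
    (h1 : ∀ i j, d i j - d j i + m (W i) (b j) - m (W j) (b i) = c • x (b i) (b j))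
    (h2 : ∀ k i j, s k i j - s k j i + (m (D k i) (b j) + m (W i) (d k j)) -
      (m (D k j) (b i) + m (W j) (d k i)) = c • (x (d k i) (b j) + x (b i) (d k j)))
    (hW : ∀ i a b, m (W i) (x a b) = x (m (W i) a) b + x a (m (W i) b)) :
    (m (D 0 1) (b 2) - m (D 1 0) (b 2) + m (W 0) (m (W 1) (b 2)) - m (W 1) (m (W 0) (b 2))) +
    (m (D 1 2) (b 0) - m (D 2 1) (b 0) + m (W 1) (m (W 2) (b 0)) - m (W 2) (m (W 1) (b 0))) +
    (m (D 2 0) (b 1) - m (D 0 2) (b 1) + m (W 2) (m (W 0) (b 1)) - m (W 0) (m (W 2) (b 1))) =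
    (c ^ 2) • (x (x (b 0) (b 1)) (b 2) + x (x (b 1) (b 2)) (b 0) + x (x (b 2) (b 0)) (b 1)) := by
  -- Three consequences of the structure equation: `W_k` applied to it (`k1`, using the derivation
  -- rule), its product with `b_k` (`k2`), and its derivative (`k3`). In the cyclic sum the second
  -- derivatives cancel, and `c` times `k2` produces the Jacobiator with factor `c²`.
  have k1 : ∀ i j k, m (W k) (d i j) - m (W k) (d j i) + m (W k) (m (W i) (b j)) -
      m (W k) (m (W j) (b i)) = c • (x (m (W k) (b i)) (b j) - x (m (W k) (b j)) (b i)) := by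
    intro i j k
    have := congrArg (m (W k)) (h1 i j)
    rw [map_smul, hW, hx (b i), ← sub_eq_add_neg] at this
    simpa only [map_sub, map_add] using this
  have k2 : ∀ i j k, x (d i j) (b k) - x (d j i) (b k) + x (m (W i) (b j)) (b k) -
      x (m (W j) (b i)) (b k) = c • x (x (b i) (b j)) (b k) := fun i j k => by
    simpa only [map_sub, map_add, map_smul, LinearMap.sub_apply, LinearMap.add_apply,
      LinearMap.smul_apply] using congrArg (fun y => x y (b k)) (h1 i j)
  have k3 : ∀ k i j, s k i j - s k j i + (m (D k i) (b j) + m (W i) (d k j)) -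
      (m (D k j) (b i) + m (W j) (d k i)) = c • (x (d k i) (b j) - x (d k j) (b i)) := by
    intro k i j
    rw [h2, hx (b i), sub_eq_add_neg]
  linear_combination (norm := module) k3 0 1 2 + k3 1 2 0 + k3 2 0 1 + k1 0 1 2 + k1 1 2 0 + k1 2 0 1 +
    c • (k2 0 1 2 + k2 1 2 0 + k2 2 0 1) - hs 0 1 2 - hs 1 2 0 - hs 2 0 1

/-- The first Bianchi identity for a connection with torsion `c` times the cross product. -/
theorem sum_curv_eq (hW : ∀ u, ContDiffAt ℝ ∞ (W u) y) (hb : ∀ u, ContDiffAt ℝ ∞ (b u) y)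
    (hG : ∀ u, IsG2Matrix (Matrix.of (W u y)))
    (hs : ∀ᶠ z in 𝓝 y, ∀ u v, fderiv ℝ (b v) z u - fderiv ℝ (b u) z v + mulVecL (W u z) (b v z) -
      mulVecL (W v z) (b u z) = c • crossL (b u z) (b v z)) (u v w : E) :
    curv W u v y (b w y) + curv W v w y (b u y) + curv W w u y (b v y) =
      (c ^ 2) • (cross (cross (b u y) (b v y)) (b w y) + cross (cross (b v y) (b w y)) (b u y) +
        cross (cross (b w y) (b u y)) (b v y)) := by
  have hWd : ∀ u, DifferentiableAt ℝ (W u) y := fun u => (hW u).differentiableAt (by simp)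
  have hbd : ∀ u, DifferentiableAt ℝ (b u) y := fun u => (hb u).differentiableAt (by simp)
  have hd2 : ∀ u v, DifferentiableAt ℝ (fun z => fderiv ℝ (b v) z u) y :=
    fun u v => differentiableAt_fderiv_apply (hb v) u
  have h1 : ∀ u v, fderiv ℝ (b v) y u - fderiv ℝ (b u) y v + mulVecL (W u y) (b v y) -
      mulVecL (W v y) (b u y) = c • crossL (b u y) (b v y) := fun u v => hs.self_of_nhds u v
  have h2 : ∀ w u v, fderiv ℝ (fun z => fderiv ℝ (b v) z u) y w -
      fderiv ℝ (fun z => fderiv ℝ (b u) z v) y w +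
      (mulVecL (fderiv ℝ (W u) y w) (b v y) + mulVecL (W u y) (fderiv ℝ (b v) y w)) -
      (mulVecL (fderiv ℝ (W v) y w) (b u y) + mulVecL (W v y) (fderiv ℝ (b u) y w)) =
      c • (crossL (fderiv ℝ (b u) y w) (b v y) + crossL (b u y) (fderiv ℝ (b v) y w)) := by
    intro w u v
    have hm := fun u v => fderiv_bilinear mulVecL (hWd u) (hbd v)
    have hc := fderiv_bilinear crossL (hbd u) (hbd v)
    have he := Filter.EventuallyEq.fderiv_eq (𝕜 := ℝ) (hs.mono fun z hz => hz u v)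
    have hL := (((hd2 u v).hasFDerivAt.fun_sub (hd2 v u).hasFDerivAt).fun_add
      (hm u v).1.hasFDerivAt).fun_sub (hm v u).1.hasFDerivAt
    have hR := hc.1.hasFDerivAt.fun_const_smul c
    have he' := congrArg (fun T => T w) ((hL.fderiv.symm.trans he).trans hR.fderiv)
    simpa [(hm u v).2, (hm v u).2, hc.2] using he'
  have hder : ∀ u a d, mulVecL (W u y) (crossL a d) =
      crossL (mulVecL (W u y) a) d + crossL a (mulVecL (W u y) d) := fun u a d => by
    simpa only [mulVecL_apply, crossL_apply] using (hG u).derivation a d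
  exact bianchi_algebra (ContinuousLinearMap.coeLM ℝ ∘ₗ mulVecL.toLinearMap)
    (ContinuousLinearMap.coeLM ℝ ∘ₗ crossL.toLinearMap) c
    (fun i => b (![u, v, w] i) y) (fun i => W (![u, v, w] i) y)
    (fun i j => fderiv ℝ (b (![u, v, w] j)) y (![u, v, w] i))
    (fun i j => fderiv ℝ (W (![u, v, w] j)) y (![u, v, w] i))
    (fun i j k => fderiv ℝ (fun z => fderiv ℝ (b (![u, v, w] k)) z (![u, v, w] j)) y
      (![u, v, w] i))
    (fun a d => cross_swap a d) (fun i j k => fderiv_fderiv_comm (hb _) _ _)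
    (fun i j => h1 _ _) (fun k i j => h2 _ _ _) (fun i a d => hder _ a d)

theorem fderiv_apply_apply {f : E → Fin 7 → Fin 7 → ℝ} (hf : DifferentiableAt ℝ f y) (u : E)
    (i j : Fin 7) : fderiv ℝ f y u i j = fderiv ℝ (fun z => f z i j) y u := by
  have h1 := fderiv_apply hf i
  have h2 := fderiv_apply (differentiableAt_pi.1 hf i) j
  rw [h2]
  simp [h1]

/-- Differentiating the skew-symmetric matrices `W u` gives skew-symmetric ones, and so does the
commutator. -/
theorem curv_dotProduct (hW : ∀ u, DifferentiableAt ℝ (W u) y)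
    (hG : ∀ᶠ z in 𝓝 y, ∀ u, IsG2Matrix (Matrix.of (W u z))) (u v : E) (a ξ : Fin 7 → ℝ) :
    curv W u v y a ⬝ᵥ ξ = -(a ⬝ᵥ curv W u v y ξ) := by
  have h1 : ∀ u v, (Matrix.of (fderiv ℝ (W v) y u))ᵀ = -Matrix.of (fderiv ℝ (W v) y u) := by
    intro u v
    ext i j
    change fderiv ℝ (W v) y u j i = -(fderiv ℝ (W v) y u i j)
    rw [fderiv_apply_apply (hW v), fderiv_apply_apply (hW v), ← _root_.neg_apply, ← fderiv_fun_neg]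
    congr 1
    refine Filter.EventuallyEq.fderiv_eq (hG.mono fun z hz => ?_)
    exact congrFun (congrFun (hz v).skew i) j
  have h2 : ∀ u a ξ, (Matrix.of (W u y) *ᵥ a) ⬝ᵥ ξ = -(a ⬝ᵥ (Matrix.of (W u y) *ᵥ ξ)) :=
    fun u a ξ => mulVec_dotProduct_of_skew (hG.self_of_nhds u).skew a ξ
  simp only [curv, mulVecL_apply, sub_dotProduct, add_dotProduct, dotProduct_sub, dotProduct_add,
    mulVec_dotProduct_of_skew (h1 _ _), h2]
  ring

/-- A connection with values in `𝔤₂` whose torsion is a non-zero multiple of the cross product has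
no vector in the kernel of its curvature. -/
theorem eq_zero_of_curv_eq_zero (hc : c ≠ 0) (hW : ∀ u, ContDiffAt ℝ ∞ (W u) y)
    (hb : ∀ u, ContDiffAt ℝ ∞ (b u) y)
    (hG : ∀ᶠ z in 𝓝 y, ∀ u, IsG2Matrix (Matrix.of (W u z)))
    (hs : ∀ᶠ z in 𝓝 y, ∀ u v, fderiv ℝ (b v) z u - fderiv ℝ (b u) z v + mulVecL (W u z) (b v z) -
      mulVecL (W v z) (b u z) = c • crossL (b u z) (b v z))
    (hsurj : ∀ a, ∃ u, b u y = a) {ξ : Fin 7 → ℝ} (hξ : ∀ u v, curv W u v y ξ = 0) : ξ = 0 := by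
  refine sum_cross_cross_dotProduct_eq_zero fun a₁ a₂ a₃ => ?_
  obtain ⟨u, rfl⟩ := hsurj a₁
  obtain ⟨v, rfl⟩ := hsurj a₂
  obtain ⟨w, rfl⟩ := hsurj a₃
  -- Pairing the Bianchi identity with `ξ`: skew-symmetry moves each curvature onto `ξ`, where it
  -- vanishes, and `c² ≠ 0` can be cancelled.
  have h := congrArg (fun x => x ⬝ᵥ ξ) (sum_curv_eq hW hb hG.self_of_nhds hs u v w)
  have hd := fun u v a => curv_dotProduct (fun u => (hW u).differentiableAt (by simp)) hG u v a ξ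
  simp only [add_dotProduct, hd, hξ, dotProduct_zero, smul_dotProduct, smul_eq_mul] at h
  have h' := h.symm
  simp only [neg_zero, add_zero, mul_eq_zero, pow_eq_zero_iff, ne_eq, OfNat.ofNat_ne_zero,
    not_false_eq_true, hc, false_or] at h'
  simpa only [add_dotProduct] using h'

end Curvature

end G2

/-! ### The characteristic connection in a local adapted frame -/

section Connection

open Matrix

variable {M : Type*} [TopologicalSpace M] [ChartedSpace (EuclideanSpace ℝ (Fin 7)) M]
  [IsManifold (𝓡 7) ∞ M]

theorem mvfderiv_eq_zero_of_eventually {G : Type*} [NormedAddCommGroup G] [NormedSpace ℝ G]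
    {f : M → G} {x : M} {a : G} (h : ∀ᶠ y in 𝓝 x, f y = a) : mvfderiv (𝓡 7) f x = 0 := by
  have h1 : mfderiv (𝓡 7) 𝓘(ℝ, G) f x = mfderiv (𝓡 7) 𝓘(ℝ, G) (fun _ => a) x :=
    Filter.EventuallyEq.mfderiv_eq h
  ext v
  have h3 := congrArg (fun T => T v) h1
  rw [mfderiv_const] at h3
  exact h3

variable [RiemannianBundle (TangentSpace (𝓡 7) : M → Type _)]
  {φ : ∀ x : M, (TangentSpace (𝓡 7) x) [⋀^Fin 3]→L[ℝ] ℝ}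
  {cov : CovariantDerivative (𝓡 7) (EuclideanSpace ℝ (Fin 7)) (TangentSpace (𝓡 7) : M → Type _)}

variable (cov) in
/-- The connection matrix in the frame `e`. -/
def connMatrix (e : Fin 7 → ∀ x : M, TangentSpace (𝓡 7) x) (x : M) (v : TangentSpace (𝓡 7) x) :
    Fin 7 → Fin 7 → ℝ := fun i j => inner ℝ (e i x) (cov (e j) x v)

/-- The components of a vector field in the frame `e`. -/
def frameCoords (e : Fin 7 → ∀ x : M, TangentSpace (𝓡 7) x) (x : M) (v : TangentSpace (𝓡 7) x) :
    Fin 7 → ℝ := G2.coords (fun i => e i x) v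

theorem frameCoords_apply (e : Fin 7 → ∀ x : M, TangentSpace (𝓡 7) x) (x : M)
    (v : TangentSpace (𝓡 7) x) (i : Fin 7) : frameCoords e x v i = inner ℝ (e i x) v := rfl

variable {U : Set M} {e : Fin 7 → ∀ x : M, TangentSpace (𝓡 7) x} {x : M}

theorem IsLocalAdaptedFrame.mdifferentiableAt (hU : IsLocalAdaptedFrame φ U e) (hx : x ∈ U)
    (i : Fin 7) : MDifferentiableAt (𝓡 7) (𝓡 7).tangent
      (fun y => (⟨y, e i y⟩ : TangentBundle (𝓡 7) M)) x :=
  ((hU.smooth i).contMDiffAt (hU.isOpen.mem_nhds hx)).mdifferentiableAt (by simp)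

theorem IsLocalAdaptedFrame.isAdapted (hU : IsLocalAdaptedFrame φ U e) (hx : x ∈ U) :
    G2.IsAdapted (φ x) fun i => e i x := hU.adapted x hx

theorem IsLocalAdaptedFrame.sum_smul (hU : IsLocalAdaptedFrame φ U e) (hx : x ∈ U)
    (v : TangentSpace (𝓡 7) x) : ∑ i, frameCoords e x v i • e i x = v :=
  G2.sum_coords_smul (hU.isAdapted hx).1 (finrank_tangentSpace x) v

theorem IsLocalAdaptedFrame.inner_eq (hU : IsLocalAdaptedFrame φ U e) (hx : x ∈ U)
    (u v : TangentSpace (𝓡 7) x) : inner ℝ u v = frameCoords e x u ⬝ᵥ frameCoords e x v :=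
  G2.inner_eq_coords (hU.isAdapted hx).1 (finrank_tangentSpace x) u v

theorem IsLocalAdaptedFrame.frameCoords_self (hU : IsLocalAdaptedFrame φ U e) (hx : x ∈ U)
    (i : Fin 7) : frameCoords e x (e i x) = Pi.single i 1 :=
  G2.coords_self (hU.isAdapted hx).1 i

theorem IsLocalAdaptedFrame.form_eq (hU : IsLocalAdaptedFrame φ U e) (hx : x ∈ U)
    (v : Fin 3 → TangentSpace (𝓡 7) x) : φ x v =
      G2.cross (frameCoords e x (v 0)) (frameCoords e x (v 1)) ⬝ᵥ frameCoords e x (v 2) :=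
  (hU.isAdapted hx).apply_eq (finrank_tangentSpace x) v

theorem frameCoords_cov (j : Fin 7) (v : TangentSpace (𝓡 7) x) :
    frameCoords e x (cov (e j) x v) = Matrix.of (connMatrix cov e x v) *ᵥ Pi.single j 1 := by
  rw [Matrix.mulVec_single_one]
  rfl

theorem IsMetric.connMatrix_skew (hm : IsMetric cov) (hU : IsLocalAdaptedFrame φ U e) (hx : x ∈ U)
    (v : TangentSpace (𝓡 7) x) :
    (Matrix.of (connMatrix cov e x v)).transpose = -Matrix.of (connMatrix cov e x v) := by
  ext i j
  have h := hm x (e i) (e j) (hU.mdifferentiableAt hx i) (hU.mdifferentiableAt hx j) v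
  rw [mvfderiv_eq_zero_of_eventually (a := if i = j then 1 else 0) (Filter.mem_of_superset
    (hU.isOpen.mem_nhds hx) fun y hy => (hU.adapted y hy).1 i j)] at h
  change (0 : ℝ) = _ at h
  change inner ℝ (e j x) (cov (e i) x v) = -inner ℝ (e i x) (cov (e j) x v)
  rw [real_inner_comm]
  linarith

/-- The functions `g(e_i, e_j)` and `φ(e_i, e_j, e_k)` are constant in an adapted frame;
differentiating them by `∇g = 0` and `∇φ = 0` leaves the two defining conditions of `𝔤₂`. -/
theorem IsCharacteristicConnection.isG2Matrix (hcov : IsCharacteristicConnection φ cov)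
    (hU : IsLocalAdaptedFrame φ U e) (hx : x ∈ U) (v : TangentSpace (𝓡 7) x) :
    G2.IsG2Matrix (Matrix.of (connMatrix cov e x v)) := by
  refine G2.isG2Matrix_of_form (hcov.metric.connMatrix_skew hU hx v) fun i j k => ?_
  have h := hcov.parallel x (fun l => e (![i, j, k] l)) (fun l => hU.mdifferentiableAt hx _) v
  rw [mvfderiv_eq_zero_of_eventually (Filter.mem_of_superset
    (hU.isOpen.mem_nhds hx) fun y hy => (hU.adapted y hy).2 ![i, j, k])] at h
  change (0 : ℝ) = _ at h
  rw [Fin.sum_univ_three] at h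
  simp only [hU.form_eq hx] at h
  simp only [Function.update, Fin.isValue, frameCoords_cov, eq_rec_constant, dite_eq_ite,
    ite_true, ite_false, Fin.reduceEq, hU.frameCoords_self hx] at h
  exact h.symm

/-- The components of the covariant derivative of a vector field. -/
theorem IsMetric.mvfderiv_frameCoords (hm : IsMetric cov) (hU : IsLocalAdaptedFrame φ U e)
    (hx : x ∈ U) {Y : ∀ x : M, TangentSpace (𝓡 7) x}
    (hY : MDifferentiableAt (𝓡 7) (𝓡 7).tangent
      (fun y => (⟨y, Y y⟩ : TangentBundle (𝓡 7) M)) x) (v : TangentSpace (𝓡 7) x) (i : Fin 7) :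
    mvfderiv (𝓡 7) (fun y => frameCoords e y (Y y) i) x v +
      (Matrix.of (connMatrix cov e x v) *ᵥ frameCoords e x (Y x)) i =
        frameCoords e x (cov Y x v) i := by
  have h := hm x (e i) Y (hU.mdifferentiableAt hx i) hY v
  have hs := G2.mulVec_dotProduct_of_skew (hm.connMatrix_skew hU hx v) (Pi.single i 1)
    (frameCoords e x (Y x))
  rw [← frameCoords_cov, ← hU.inner_eq hx, single_dotProduct, one_mul] at hs
  rw [hs] at h
  change mvfderiv (𝓡 7) (fun y => (inner ℝ (e i y) (Y y) : ℝ)) x v + _ = inner ℝ (e i x) (cov Y x v)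
  rw [h]
  ring

end Connection

/-! ### The torsion of the characteristic connection -/

namespace G2

open Matrix

theorem IsG2Matrix.form_cyclic {W : Matrix (Fin 7) (Fin 7) ℝ} (hW : IsG2Matrix W)
    (a b c : Fin 7 → ℝ) :
    cross (W *ᵥ a) b ⬝ᵥ c - cross (W *ᵥ b) a ⬝ᵥ c + cross (W *ᵥ c) a ⬝ᵥ b = 0 := by
  have h1 := congrArg (· ⬝ᵥ c) (hW.derivation a b)
  have h2 := mulVec_dotProduct_of_skew hW.skew (cross a b) c
  have h3 := cross_dotProduct_rotate (W *ᵥ c) a b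
  have h4 := cross_dotProduct_rotate a b (W *ᵥ c)
  rw [cross_swap (W *ᵥ b) a, neg_dotProduct, h3]
  simp only [add_dotProduct] at h1
  linarith

/-- The wedge product of torsion and the standard form. -/
theorem wedge_eq_torsionWedge {W : Fin 7 → Matrix (Fin 7) (Fin 7) ℝ} (hW : ∀ i, IsG2Matrix (W i))
    (t : Fin 7 → Fin 7 → Fin 7 → ℝ) {B : Fin 7 → Fin 7 → Fin 7 → ℝ}
    (hB : ∀ i j, B i j = W i *ᵥ Pi.single j 1 - W j *ᵥ Pi.single i 1 - t i j) (i j k l : Fin 7) :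
    -(cross (B i j) (Pi.single k 1) ⬝ᵥ Pi.single l 1 - cross (B i k) (Pi.single j 1) ⬝ᵥ Pi.single l 1
      + cross (B i l) (Pi.single j 1) ⬝ᵥ Pi.single k 1 + cross (B j k) (Pi.single i 1) ⬝ᵥ Pi.single l 1
      - cross (B j l) (Pi.single i 1) ⬝ᵥ Pi.single k 1
      + cross (B k l) (Pi.single i 1) ⬝ᵥ Pi.single j 1) = torsionWedge t coeff i j k l := by
  have key : ∀ (x : Fin 7 → ℝ) (k l : Fin 7), cross x (Pi.single k 1) ⬝ᵥ Pi.single l 1 =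
      ∑ m, x m * coeff m k l := fun x k l => by
    rw [dotProduct_single, mul_one, cross_eq_sum]
    refine Finset.sum_congr rfl fun m _ => ?_
    rw [Finset.sum_eq_single k (fun b _ hb => by simp [hb]) (by simp)]
    simp
  -- Invariance of `φ` under each of the four connection matrices removes the connection terms of
  -- the brackets; the torsion terms remain.
  have h0 := (hW i).form_cyclic (Pi.single j 1) (Pi.single k 1) (Pi.single l 1)
  have h1 := (hW j).form_cyclic (Pi.single i 1) (Pi.single k 1) (Pi.single l 1)
  have h2 := (hW k).form_cyclic (Pi.single i 1) (Pi.single j 1) (Pi.single l 1)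
  have h3 := (hW l).form_cyclic (Pi.single i 1) (Pi.single j 1) (Pi.single k 1)
  rw [torsionWedge]
  simp only [Finset.sum_add_distrib, Finset.sum_sub_distrib, ← key]
  simp only [hB, cross_sub_left, sub_dotProduct]
  linarith

theorem cross_coeff_bilinear {T : (Fin 7 → ℝ) → (Fin 7 → ℝ) → Fin 7 → ℝ} {c : ℝ}
    (hT : ∀ a b k, T a b k = ∑ i, ∑ j, a i * b j * (c * coeff i j k)) (a b : Fin 7 → ℝ) :
    T a b = c • cross a b := by
  ext k
  rw [hT, Pi.smul_apply, cross_eq_sum, smul_eq_mul, Finset.mul_sum]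
  refine Finset.sum_congr rfl fun i _ => ?_
  rw [Finset.mul_sum]
  exact Finset.sum_congr rfl fun j _ => by ring

end G2

section Torsion

open Matrix

variable {M : Type*} [TopologicalSpace M] [ChartedSpace (EuclideanSpace ℝ (Fin 7)) M]
  [IsManifold (𝓡 7) ∞ M]
  [RiemannianBundle (TangentSpace (𝓡 7) : M → Type _)]
  {φ : ∀ x : M, (TangentSpace (𝓡 7) x) [⋀^Fin 3]→L[ℝ] ℝ}
  {cov : CovariantDerivative (𝓡 7) (EuclideanSpace ℝ (Fin 7)) (TangentSpace (𝓡 7) : M → Type _)}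
  {U : Set M} {e : Fin 7 → ∀ x : M, TangentSpace (𝓡 7) x} {x : M}

theorem frameCoords_sub (x : M) (u v : TangentSpace (𝓡 7) x) :
    frameCoords e x (u - v) = frameCoords e x u - frameCoords e x v := G2.coords_sub _ _ _

/-- The derivative terms of `dφ` vanish because `φ` has constant coefficients in the frame, and
`[e_a, e_b] = ∇_{e_a} e_b - ∇_{e_b} e_a - T(e_a, e_b)` is inserted into the bracket terms. -/
theorem IsCharacteristicConnection.extDerivThree_frame (hcov : IsCharacteristicConnection φ cov)
    (hU : IsLocalAdaptedFrame φ U e) (hx : x ∈ U) (i j k l : Fin 7) :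
    extDerivThree φ (fun a => e (![i, j, k, l] a)) x =
      G2.torsionWedge (fun a b c => torsionForm cov x (e a x) (e b x) (e c x)) G2.coeff i j k l := by
  have hB : ∀ a b, frameCoords e x (VectorField.mlieBracket (𝓡 7) (e a) (e b) x) =
      Matrix.of (connMatrix cov e x (e a x)) *ᵥ Pi.single b 1 -
        Matrix.of (connMatrix cov e x (e b x)) *ᵥ Pi.single a 1 -
          fun c => torsionForm cov x (e a x) (e b x) (e c x) := fun a b => by
    have h := cov.torsion_apply (hU.mdifferentiableAt hx a) (hU.mdifferentiableAt hx b)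
    have h1 : (fun c => torsionForm cov x (e a x) (e b x) (e c x)) =
        frameCoords e x (cov.torsion x (e a x) (e b x)) := by
      ext c
      exact real_inner_comm _ _
    rw [h1, h, frameCoords_sub, frameCoords_sub, frameCoords_cov, frameCoords_cov]
    abel
  rw [← G2.wedge_eq_torsionWedge (fun a => hcov.isG2Matrix hU hx (e a x)) _ hB, extDerivThree]
  have h0 : ∀ a : Fin 4, mvfderiv (𝓡 7) (fun y => φ y (a.removeNth fun k' => e (![i, j, k, l] k') y))
      x = 0 := fun a => mvfderiv_eq_zero_of_eventually (Filter.mem_of_superset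
    (hU.isOpen.mem_nhds hx) fun y hy => (hU.adapted y hy).2 (a.removeNth ![i, j, k, l]))
  rw [Finset.sum_eq_zero fun a _ => by rw [h0]; exact mul_zero _]
  have hI0 : Finset.Ici (0 : Fin 3) = {0, 1, 2} := rfl
  have hI1 : Finset.Ici (1 : Fin 3) = {1, 2} := rfl
  have hI2 : Finset.Ici (2 : Fin 3) = {2} := rfl
  rw [Fin.sum_univ_three, hI0, hI1, hI2, Finset.sum_insert (by decide),
    Finset.sum_insert (by decide), Finset.sum_singleton, Finset.sum_insert (by decide),
    Finset.sum_singleton, Finset.sum_singleton]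
  simp only [hU.form_eq hx, ← hU.frameCoords_self hx]
  let F (a b c d : Fin 7) : ℝ :=
    G2.cross (frameCoords e x (VectorField.mlieBracket (𝓡 7) (e a) (e b) x))
      (frameCoords e x (e c x)) ⬝ᵥ frameCoords e x (e d x)
  change 0 - ((-1) ^ 0 * F i j k l + ((-1) ^ 1 * F i k j l + (-1) ^ 2 * F i l j k)
    + ((-1) ^ 2 * F j k i l + (-1) ^ 3 * F j l i k) + (-1) ^ 4 * F k l i j) =
      -(F i j k l - F i k j l + F i l j k + F j k i l - F j l i k + F k l i j)
  ring


/-- Both `T` and `(μ/6) φ` are sent to `μ ⋆φ` by the injective map `t ↦ ∑ (e_m ⌟ t) ∧ (e_m ⌟ φ)`;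
the 6 comes from `φ ↦ 6 ⋆φ`. -/
theorem IsCharacteristicConnection.torsion_frame
    (hcov : IsCharacteristicConnection φ cov) {μ : ℝ}
    (hμ : ∀ (x : M) (X : Fin 4 → ∀ x : M, TangentSpace (𝓡 7) x),
    (∀ k, MDifferentiableAt (𝓡 7) (𝓡 7).tangent
      (fun y => (⟨y, X k y⟩ : TangentBundle (𝓡 7) M)) x) →
    ∀ e, IsAdaptedFrame φ x e →
      extDerivThree φ X x = μ * hodgeStarThree e (φ x) (fun k => X k x))
    (hU : IsLocalAdaptedFrame φ U e) (hx : x ∈ U) (i j k : Fin 7) :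
    torsionForm cov x (e i x) (e j x) (e k x) = (μ / 6) * G2.coeff i j k := by
  refine G2.eq_smul_coeff (t := fun i j k => torsionForm cov x (e i x) (e j x) (e k x)) (fun i j k => ?_) (fun i j k => hcov.torsion_skew x _ _ _ ) _
    (fun i j k l hij hjk hkl => ?_) i j k
  · rw [torsionForm, CovariantDerivative.torsion_antisymm, inner_neg_left]; rfl
  · rw [← hcov.extDerivThree_frame hU hx, hμ x _ (fun a => hU.mdifferentiableAt hx _) _
      (hU.adapted x hx), hodgeStarThree, G2.torsionWedge_coeff hij hjk hkl]
    rw [← mul_assoc, mul_one_div]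
    congr 1
    refine Finset.sum_congr rfl fun a _ => ?_
    rw [(hU.adapted x hx).2, G2.stdForm_single]
    congr 2
    ext m n
    simp only [Matrix.of_apply]
    rw [← (hU.adapted x hx).1 m (![a 0, a 1, a 2, i, j, k, l] n)]
    congr 1
    fin_cases n <;> rfl

theorem IsLocalAdaptedFrame.frameCoords_torsion {c : ℝ}
    (hU : IsLocalAdaptedFrame φ U e) (hx : x ∈ U)
    (h : ∀ i j k, torsionForm cov x (e i x) (e j x) (e k x) = c * G2.coeff i j k) (u v) :
    frameCoords e x (cov.torsion x u v) = c • G2.cross (frameCoords e x u) (frameCoords e x v) := by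
  rw [← G2.cross_coeff_bilinear (T := fun a b k => ∑ i, ∑ j, a i * b j * (c * G2.coeff i j k))
    (fun _ _ _ => rfl)]
  ext k
  conv_lhs => rw [← hU.sum_smul hx u, ← hU.sum_smul hx v]
  simp only [← h, torsionForm, frameCoords_apply e x (cov.torsion x _ _)]
  simp only [map_sum, map_smul, _root_.sum_apply, _root_.smul_apply,
    inner_sum, real_inner_smul_right]
  rw [Finset.sum_comm]
  refine Finset.sum_congr rfl fun i _ => ?_
  rw [Finset.mul_sum]
  refine Finset.sum_congr rfl fun j _ => ?_
  rw [real_inner_comm]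
  ring

end Torsion

/-! ### The characteristic connection in a chart -/

section ChartModel

open Matrix

variable {M : Type*} [TopologicalSpace M] [ChartedSpace (EuclideanSpace ℝ (Fin 7)) M]
  [IsManifold (𝓡 7) ∞ M]

/-- The points of the chart at `p` which correspond to points of `U`. -/
def chartDomain (p : M) (U : Set M) : Set (EuclideanSpace ℝ (Fin 7)) :=
  (extChartAt (𝓡 7) p).target ∩ (extChartAt (𝓡 7) p).symm ⁻¹' U

theorem isOpen_chartDomain (p : M) {U : Set M} (hU : IsOpen U) : IsOpen (chartDomain p U) :=
  (continuousOn_extChartAt_symm p).isOpen_inter_preimage (isOpen_extChartAt_target p) hU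

theorem mem_chartDomain_self {p : M} {U : Set M} (hp : p ∈ U) :
    extChartAt (𝓡 7) p p ∈ chartDomain p U :=
  ⟨mem_extChartAt_target p, by rwa [Set.mem_preimage, extChartAt_to_inv]⟩

theorem contMDiffAt_extChartAt_symm {p : M} {y : EuclideanSpace ℝ (Fin 7)}
    (hy : y ∈ (extChartAt (𝓡 7) p).target) :
    ContMDiffAt 𝓘(ℝ, EuclideanSpace ℝ (Fin 7)) (𝓡 7) ∞ (extChartAt (𝓡 7) p).symm y :=
  (contMDiffOn_extChartAt_symm p).contMDiffAt ((isOpen_extChartAt_target p).mem_nhds hy)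

variable [RiemannianBundle (TangentSpace (𝓡 7) : M → Type _)]
  {φ : ∀ x : M, (TangentSpace (𝓡 7) x) [⋀^Fin 3]→L[ℝ] ℝ}
  (cov : CovariantDerivative (𝓡 7) (EuclideanSpace ℝ (Fin 7)) (TangentSpace (𝓡 7) : M → Type _))
  (e : Fin 7 → ∀ x : M, TangentSpace (𝓡 7) x) (p : M)

/-- The connection form in the frame `e` and in the chart at `p`. -/
def chartConn (u y : EuclideanSpace ℝ (Fin 7)) : Fin 7 → Fin 7 → ℝ :=
  connMatrix cov e ((extChartAt (𝓡 7) p).symm y) (coordField p u ((extChartAt (𝓡 7) p).symm y))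

/-- The coframe dual to the frame `e` in the chart at `p`. -/
def chartCoframe (u y : EuclideanSpace ℝ (Fin 7)) : Fin 7 → ℝ :=
  frameCoords e ((extChartAt (𝓡 7) p).symm y) (coordField p u ((extChartAt (𝓡 7) p).symm y))

theorem chartConn_add (u v y : EuclideanSpace ℝ (Fin 7)) :
    chartConn cov e p (u + v) y = chartConn cov e p u y + chartConn cov e p v y := by
  ext i j
  simp only [chartConn, connMatrix, coordField_add]
  exact (congrArg _ (map_add _ _ _)).trans (inner_add_right _ _ _)

theorem chartConn_smul (c : ℝ) (u y : EuclideanSpace ℝ (Fin 7)) :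
    chartConn cov e p (c • u) y = c • chartConn cov e p u y := by
  ext i j
  simp only [chartConn, connMatrix, coordField_smul]
  exact (congrArg _ (map_smul _ _ _)).trans (real_inner_smul_right _ _ _)

variable {cov e p} {U : Set M} {y : EuclideanSpace ℝ (Fin 7)}

theorem IsLocalAdaptedFrame.exists_chartCoframe_eq (hU : IsLocalAdaptedFrame φ U e)
    (hy : y ∈ chartDomain p U) (a : Fin 7 → ℝ) : ∃ u, chartCoframe e p u y = a := by
  refine ⟨mfderiv (𝓡 7) 𝓘(ℝ, EuclideanSpace ℝ (Fin 7)) (extChartAt (𝓡 7) p)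
    ((extChartAt (𝓡 7) p).symm y) (∑ i, a i • e i ((extChartAt (𝓡 7) p).symm y)), ?_⟩
  refine (congrArg (frameCoords e _)
    (coordField_mfderiv _ ((extChartAt (𝓡 7) p).map_target hy.1))).trans ?_
  exact G2.coords_sum_smul (hU.adapted _ hy.2).1 a

section Smooth

variable [IsContMDiffRiemannianBundle (𝓡 7) ∞ (EuclideanSpace ℝ (Fin 7))
      (TangentSpace (𝓡 7) : M → Type _)]

theorem contDiffAt_chartConn (hcov : CovariantDerivative.ContMDiffCovariantDerivative cov ∞)
    (he : ∀ i, ContMDiff (𝓡 7) (𝓡 7).tangent ∞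
        (fun x => (⟨x, e i x⟩ : TangentBundle (𝓡 7) M)))
    (hy : y ∈ (extChartAt (𝓡 7) p).target) (u : EuclideanSpace ℝ (Fin 7)) :
    ContDiffAt ℝ ∞ (chartConn cov e p u) y := by
  refine contDiffAt_pi.2 fun i => contDiffAt_pi.2 fun j => contMDiffAt_iff_contDiffAt.1 ?_
  have hx := (extChartAt (𝓡 7) p).map_target hy
  have h1 := hcov.contMDiff.contMDiff (σ := e j) (by simpa using (he j).contMDiffOn)
  have h2 := (h1.contMDiffAt Filter.univ_mem).clm_bundle_apply (contMDiffAt_coordField u hx)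
  exact ((he i).contMDiffAt.inner_bundle h2).comp y (contMDiffAt_extChartAt_symm hy)

theorem contDiffAt_chartCoframe (he : ∀ i, ContMDiff (𝓡 7) (𝓡 7).tangent ∞
        (fun x => (⟨x, e i x⟩ : TangentBundle (𝓡 7) M)))
    (hy : y ∈ (extChartAt (𝓡 7) p).target) (u : EuclideanSpace ℝ (Fin 7)) :
    ContDiffAt ℝ ∞ (chartCoframe e p u) y := by
  refine contDiffAt_pi.2 fun i => contMDiffAt_iff_contDiffAt.1 ?_
  have hx := (extChartAt (𝓡 7) p).map_target hy
  exact ((he i).contMDiffAt.inner_bundle (contMDiffAt_coordField u hx)).comp y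
    (contMDiffAt_extChartAt_symm hy)

/-- The first structure equation in a chart. -/
theorem IsMetric.structure_equation (hm : IsMetric cov) (hU : IsLocalAdaptedFrame φ U e)
    (he : ∀ i, ContMDiff (𝓡 7) (𝓡 7).tangent ∞
        (fun x => (⟨x, e i x⟩ : TangentBundle (𝓡 7) M))) {c : ℝ}
    (hT : ∀ x ∈ U, ∀ u v, frameCoords e x (cov.torsion x u v) =
      c • G2.cross (frameCoords e x u) (frameCoords e x v))
    (hy : y ∈ chartDomain p U) (u v : EuclideanSpace ℝ (Fin 7)) :
    fderiv ℝ (chartCoframe e p v) y u - fderiv ℝ (chartCoframe e p u) y v +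
      G2.mulVecL (chartConn cov e p u y) (chartCoframe e p v y) -
      G2.mulVecL (chartConn cov e p v y) (chartCoframe e p u y) =
        c • G2.crossL (chartCoframe e p u y) (chartCoframe e p v y) := by
  have hx := (extChartAt (𝓡 7) p).map_target hy.1
  have hd := fun w => (contMDiffAt_coordField w hx).mdifferentiableAt (n := ∞) (by simp)
  -- The `i`-th frame component of `∇_u ∂_v`, for the coordinate fields. Antisymmetrising gives the
  -- torsion, as coordinate fields commute.
  have key : ∀ u v i, fderiv ℝ (chartCoframe e p v) y u i +
      G2.mulVecL (chartConn cov e p u y) (chartCoframe e p v y) i =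
      frameCoords e ((extChartAt (𝓡 7) p).symm y) (cov (coordField p v)
        ((extChartAt (𝓡 7) p).symm y) (coordField p u ((extChartAt (𝓡 7) p).symm y))) i := by
    intro u v i
    rw [← hm.mvfderiv_frameCoords hU hy.2 (hd v)]
    have hf : MDifferentiableAt (𝓡 7) 𝓘(ℝ, ℝ) (fun x => frameCoords e x (coordField p v x) i)
        ((extChartAt (𝓡 7) p).symm y) :=
      ((he i).contMDiffAt.inner_bundle (contMDiffAt_coordField v hx)).mdifferentiableAt (by simp)
    rw [(hasFDerivAt_comp_extChartAt_symm hy.1 hf u).2]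
    have h1 := ((contDiffAt_chartCoframe he hy.1 v).differentiableAt (by simp)).hasFDerivAt
    have h2 := (hasFDerivAt_pi'.1 h1 i).fderiv
    have h3 := congrArg (fun T => T u) h2
    rw [show (fun x => frameCoords e x (coordField p v x) i) ∘ (extChartAt (𝓡 7) p).symm =
      fun z => chartCoframe e p v z i from rfl, h2]
    rfl
  ext i
  have h1 := key u v i
  have h2 := key v u i
  have h3 := cov.torsion_apply (hd u) (hd v)
  rw [mlieBracket_coordField u v hx, sub_zero] at h3
  have h4 := hT _ hy.2 (coordField p u ((extChartAt (𝓡 7) p).symm y))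
    (coordField p v ((extChartAt (𝓡 7) p).symm y))
  rw [h3, frameCoords_sub] at h4
  have h5 := congrFun h4 i
  rw [Pi.sub_apply, ← h1, ← h2] at h5
  refine Eq.trans ?_ h5
  simp only [Pi.add_apply, Pi.sub_apply]
  ring

/-- No nonzero vector is annihilated by the curvature. -/
theorem IsCharacteristicConnection.eq_zero_of_curv_eq_zero
    (hcov : IsCharacteristicConnection φ cov) (hU : IsLocalAdaptedFrame φ U e)
    (he : ∀ i, ContMDiff (𝓡 7) (𝓡 7).tangent ∞
        (fun x => (⟨x, e i x⟩ : TangentBundle (𝓡 7) M))) {c : ℝ} (hc : c ≠ 0)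
    (hT : ∀ x ∈ U, ∀ u v, frameCoords e x (cov.torsion x u v) =
      c • G2.cross (frameCoords e x u) (frameCoords e x v))
    (hy : y ∈ chartDomain p U) {ξ : Fin 7 → ℝ}
    (hξ : ∀ u v, G2.curv (chartConn cov e p) u v y ξ = 0) : ξ = 0 := by
  have hO : ∀ᶠ z in 𝓝 y, z ∈ chartDomain p U := (isOpen_chartDomain p hU.isOpen).mem_nhds hy
  exact G2.eq_zero_of_curv_eq_zero hc (fun u => contDiffAt_chartConn hcov.smooth he hy.1 u)
    (fun u => contDiffAt_chartCoframe he hy.1 u)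
    (hO.mono fun z hz u => hcov.isG2Matrix hU hz.2 _)
    (hO.mono fun z hz u v => hcov.metric.structure_equation hU he hT hz u v)
    (fun a => hU.exists_chartCoframe_eq hy a) hξ

end Smooth

/-- The factor `μ/6` is the same in all frames. If it were zero, the torsion would vanish at every
point, since every point has a local adapted frame around it. -/
theorem IsCharacteristicConnection.exists_torsion_eq (hcov : IsCharacteristicConnection φ cov)
    (hφ : IsG2Structure φ) (hnp : IsNearlyParallel φ) [T2Space M]
    [IsContMDiffRiemannianBundle (𝓡 7) ∞ (EuclideanSpace ℝ (Fin 7))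
      (TangentSpace (𝓡 7) : M → Type _)] (hT : torsionForm cov ≠ 0) :
    ∃ c : ℝ, c ≠ 0 ∧ ∀ (U : Set M) (e : Fin 7 → ∀ x : M, TangentSpace (𝓡 7) x),
      IsLocalAdaptedFrame φ U e → ∀ x ∈ U, ∀ u v, frameCoords e x (cov.torsion x u v) =
        c • G2.cross (frameCoords e x u) (frameCoords e x v) := by
  obtain ⟨μ, hμ⟩ := hnp
  have h : ∀ (U : Set M) (e : Fin 7 → ∀ x : M, TangentSpace (𝓡 7) x),
      IsLocalAdaptedFrame φ U e → ∀ x ∈ U, ∀ u v, frameCoords e x (cov.torsion x u v) =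
        (μ / 6) • G2.cross (frameCoords e x u) (frameCoords e x v) := fun U e hU x hx u v =>
    hU.frameCoords_torsion hx (hcov.torsion_frame hμ hU hx) u v
  refine ⟨μ / 6, fun h0 => hT ?_, h⟩
  ext x u v w
  obtain ⟨e₀, he₀⟩ := hφ.exists_adaptedFrame x
  obtain ⟨U, e, hxU, -, hU, -⟩ := exists_isLocalAdaptedFrame hφ he₀
  rw [torsionForm, hU.inner_eq hxU, h U e hU x hxU, h0, zero_smul, zero_dotProduct]
  rfl

end ChartModel

/-! ### Parallel spinors -/

section Spinors

open Matrix

namespace G2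

/-- The vector part of a spinor, as a continuous linear map. -/
def vecOfL : (Fin 8 → ℝ) →L[ℝ] Fin 7 → ℝ :=
  LinearMap.toContinuousLinearMap
    { toFun := vecOf
      map_add' := fun x y => by ext; simp [vecOf]
      map_smul' := fun r x => by ext; simp [vecOf] }

theorem vecOfL_apply (ψ : Fin 8 → ℝ) : vecOfL ψ = vecOf ψ := rfl

theorem vecOf_spinorOf (a : ℝ) (v : Fin 7 → ℝ) : vecOf (spinorOf a v) = v :=
  (spinorOf_inj (spinorOf_vecOf (spinorOf a v))).2

theorem spinorOf_zero_right (a : ℝ) : spinorOf a 0 = a • basisSpinor 0 := by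
  simp [spinorOf, cliffVec]

end G2

variable {M : Type*} [TopologicalSpace M] [ChartedSpace (EuclideanSpace ℝ (Fin 7)) M]
  [IsManifold (𝓡 7) ∞ M] [RiemannianBundle (TangentSpace (𝓡 7) : M → Type _)]
  {φ : ∀ x : M, (TangentSpace (𝓡 7) x) [⋀^Fin 3]→L[ℝ] ℝ}
  {cov : CovariantDerivative (𝓡 7) (EuclideanSpace ℝ (Fin 7)) (TangentSpace (𝓡 7) : M → Type _)}

open Classical in
variable (φ) in
/-- The spinor field which is equal to `ψ₁` in every adapted frame. -/
def invariantSpinor : SpinorField φ where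
  toFun x e := if IsAdaptedFrame φ x e then G2.basisSpinor 0 else 0
  eq_zero _ _ h := if_neg h
  equivariant x e e' h s he he' _ hs := by rw [if_pos he, if_pos he', hs.2.2]
  smooth U e hU := contMDiffOn_const.congr fun x hx => if_pos (hU.adapted x hx)

theorem invariantSpinor_toFun {x : M} {e : Fin 7 → TangentSpace (𝓡 7) x}
    (he : IsAdaptedFrame φ x e) : (invariantSpinor φ).toFun x e = G2.basisSpinor 0 := if_pos he

/-- The coordinates are constant, and the `𝔤₂`-valued connection matrix annihilates `ψ₁`. -/
theorem IsCharacteristicConnection.isParallel_invariantSpinor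
    (hcov : IsCharacteristicConnection φ cov) : (invariantSpinor φ).IsParallel cov := by
  intro U e hU x hx v
  rw [mvfderiv_eq_zero_of_eventually (Filter.mem_of_superset (hU.isOpen.mem_nhds hx)
    fun y hy => invariantSpinor_toFun (hU.adapted y hy)), invariantSpinor_toFun (hU.adapted x hx)]
  exact (zero_add _).trans (hcov.isG2Matrix hU hx v).spinAction_basisSpinor

variable {U : Set M} {e : Fin 7 → ∀ x : M, TangentSpace (𝓡 7) x} {p : M}
  {y : EuclideanSpace ℝ (Fin 7)}

/-- A spinor field in a local frame and in the chart at `p`. -/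
def SpinorField.inChart (Ψ : SpinorField φ) (e : Fin 7 → ∀ x : M, TangentSpace (𝓡 7) x) (p : M)
    (y : EuclideanSpace ℝ (Fin 7)) : Fin 8 → ℝ :=
  Ψ.toFun ((extChartAt (𝓡 7) p).symm y) fun i => e i ((extChartAt (𝓡 7) p).symm y)

theorem SpinorField.contDiffAt_inChart (Ψ : SpinorField φ) (hU : IsLocalAdaptedFrame φ U e)
    (hy : y ∈ chartDomain p U) : ContDiffAt ℝ ∞ (Ψ.inChart e p) y :=
  contMDiffAt_iff_contDiffAt.1 (((Ψ.smooth U e hU).contMDiffAt (hU.isOpen.mem_nhds hy.2)).comp y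
    (contMDiffAt_extChartAt_symm hy.1))

theorem SpinorField.IsParallel.fderiv_inChart {Ψ : SpinorField φ} (hΨ : Ψ.IsParallel cov)
    (hcov : IsCharacteristicConnection φ cov) (hU : IsLocalAdaptedFrame φ U e)
    (hy : y ∈ chartDomain p U) (u : EuclideanSpace ℝ (Fin 7)) :
    fderiv ℝ (Ψ.inChart e p) y u +
      G2.spinorOf 0 (G2.mulVecL (chartConn cov e p u y) (G2.vecOf (Ψ.inChart e p y))) = 0 := by
  have h := hΨ U e hU _ hy.2 (coordField p u ((extChartAt (𝓡 7) p).symm y))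
  have hd : MDifferentiableAt (𝓡 7) 𝓘(ℝ, Fin 8 → ℝ) (fun y => Ψ.toFun y fun i => e i y)
      ((extChartAt (𝓡 7) p).symm y) :=
    ((Ψ.smooth U e hU).contMDiffAt (hU.isOpen.mem_nhds hy.2)).mdifferentiableAt (by simp)
  rw [(hasFDerivAt_comp_extChartAt_symm hy.1 hd u).2,
    ← G2.spinorOf_vecOf (Ψ.toFun ((extChartAt (𝓡 7) p).symm y) _)] at h
  have hG : G2.IsG2Matrix (Matrix.of (chartConn cov e p u y)) := hcov.isG2Matrix hU hy.2 _
  rw [G2.mulVecL_apply, ← hG.spinAction_spinorOf (Ψ.inChart e p y 0)]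
  exact h

variable [IsContMDiffRiemannianBundle (𝓡 7) ∞ (EuclideanSpace ℝ (Fin 7))
      (TangentSpace (𝓡 7) : M → Type _)]

/-- The vector part satisfies `dv + W v = 0`, so it lies in the kernel of the curvature, which is
trivial. -/
theorem SpinorField.IsParallel.vecOf_inChart {Ψ : SpinorField φ} (hΨ : Ψ.IsParallel cov)
    (hcov : IsCharacteristicConnection φ cov) (hU : IsLocalAdaptedFrame φ U e)
    (he : ∀ i, ContMDiff (𝓡 7) (𝓡 7).tangent ∞
        (fun x => (⟨x, e i x⟩ : TangentBundle (𝓡 7) M))) {c : ℝ} (hc : c ≠ 0)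
    (hT : ∀ x ∈ U, ∀ u v, frameCoords e x (cov.torsion x u v) =
      c • G2.cross (frameCoords e x u) (frameCoords e x v))
    (hy : y ∈ chartDomain p U) : G2.vecOf (Ψ.inChart e p y) = 0 := by
  have hO : ∀ᶠ z in 𝓝 y, z ∈ chartDomain p U := (isOpen_chartDomain p hU.isOpen).mem_nhds hy
  refine hcov.eq_zero_of_curv_eq_zero hU he hc hT hy fun u v =>
    G2.curv_eq_zero_of_parallel (ξ := fun z => G2.vecOfL (Ψ.inChart e p z))
      (fun u => contDiffAt_chartConn hcov.smooth he hy.1 u)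
      (G2.vecOfL.contDiff.contDiffAt.comp y (Ψ.contDiffAt_inChart hU hy)) (hO.mono fun z hz u => ?_)
      u v
  have h1 := ((Ψ.contDiffAt_inChart hU hz).differentiableAt (by simp)).hasFDerivAt
  have h2 := (G2.vecOfL.hasFDerivAt.comp z h1).fderiv
  have h3 := congrArg G2.vecOfL (hΨ.fderiv_inChart hcov hU hz u)
  rw [map_add, map_zero, G2.vecOfL_apply (G2.spinorOf _ _), G2.vecOf_spinorOf] at h3
  rw [← h3]
  exact congrArg (· + _) (congrArg (fun T => T u) h2)

theorem SpinorField.IsParallel.fderiv_inChart_eq_zero {Ψ : SpinorField φ} (hΨ : Ψ.IsParallel cov)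
    (hcov : IsCharacteristicConnection φ cov) (hU : IsLocalAdaptedFrame φ U e)
    (he : ∀ i, ContMDiff (𝓡 7) (𝓡 7).tangent ∞
        (fun x => (⟨x, e i x⟩ : TangentBundle (𝓡 7) M))) {c : ℝ} (hc : c ≠ 0)
    (hT : ∀ x ∈ U, ∀ u v, frameCoords e x (cov.torsion x u v) =
      c • G2.cross (frameCoords e x u) (frameCoords e x v))
    (hy : y ∈ chartDomain p U) : fderiv ℝ (Ψ.inChart e p) y = 0 := by
  ext1 u
  have h := hΨ.fderiv_inChart hcov hU hy u
  rw [hΨ.vecOf_inChart hcov hU he hc hT hy, map_zero, G2.spinorOf_zero_right, zero_smul,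
    add_zero] at h
  exact h

/-- A spinor field that is a multiple of `ψ₁` has the same coordinates in all adapted frames. -/
theorem SpinorField.toFun_eq (Ψ : SpinorField φ) {x : M} {e e' : Fin 7 → TangentSpace (𝓡 7) x}
    (he : IsAdaptedFrame φ x e) (he' : IsAdaptedFrame φ x e')
    (h : G2.vecOf (Ψ.toFun x e') = 0) : Ψ.toFun x e = Ψ.toFun x e' := by
  have hV := finrank_tangentSpace x
  obtain ⟨s, hs, hs'⟩ := G2.exists_isSpinLift (G2.IsAdapted.transpose_mul_changeMatrix he he' hV)
    (G2.IsAdapted.changeMatrix_cross he he' hV)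
  rw [← Ψ.equivariant x e e' _ s he he' (G2.eq_sum_changeMatrix he.1 hV e') hs,
    ← G2.spinorOf_vecOf (Ψ.toFun x e'), h, hs', mulVec_zero]

/-- Without vector part, the coordinates do not depend on the adapted frame and define a function on
`M`. In a chart its derivative is zero, so it is locally constant, hence constant. -/
theorem SpinorField.IsParallel.eq_smul_invariantSpinor [T2Space M] [ConnectedSpace M]
    (hφ : IsG2Structure φ) {Ψ : SpinorField φ} (hΨ : Ψ.IsParallel cov)
    (hcov : IsCharacteristicConnection φ cov) {c : ℝ} (hc : c ≠ 0)
    (hT : ∀ (U : Set M) (e : Fin 7 → ∀ x : M, TangentSpace (𝓡 7) x),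
      IsLocalAdaptedFrame φ U e → ∀ x ∈ U, ∀ u v, frameCoords e x (cov.torsion x u v) =
        c • G2.cross (frameCoords e x u) (frameCoords e x v)) :
    ∃ a : ℝ, Ψ.toFun = a • (invariantSpinor φ).toFun := by
  have hvec : ∀ x e, IsAdaptedFrame φ x e → G2.vecOf (Ψ.toFun x e) = 0 := by
    intro x e₀ he₀
    obtain ⟨U, e, hxU, hex, hU, he⟩ := exists_isLocalAdaptedFrame hφ he₀
    have h := hΨ.vecOf_inChart hcov hU he hc (hT U e hU) (mem_chartDomain_self hxU)
    have hx : Ψ.inChart e x (extChartAt (𝓡 7) x x) = Ψ.toFun x fun i => e i x := by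
      rw [SpinorField.inChart, extChartAt_to_inv]
    rw [hx, funext hex] at h
    exact h
  -- No continuity of the chosen frames is required, because the values do not depend on them.
  choose f hf using hφ.exists_adaptedFrame
  have hloc : IsLocallyConstant fun x => Ψ.toFun x (f x) := by
    refine IsLocallyConstant.iff_eventually_eq _ |>.2 fun p => ?_
    obtain ⟨U, e, hpU, hep, hU, he⟩ := exists_isLocalAdaptedFrame hφ (hf p)
    obtain ⟨r, hr, hB⟩ := Metric.isOpen_iff.1 (isOpen_chartDomain p hU.isOpen) _
      (mem_chartDomain_self hpU)
    have hfe : ∀ x ∈ U, Ψ.toFun x (f x) = Ψ.toFun x fun i => e i x := fun x hx =>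
      Ψ.toFun_eq (hf x) (hU.adapted x hx) (hvec x _ (hU.adapted x hx))
    have hchart : ∀ x ∈ (extChartAt (𝓡 7) p).source,
        Ψ.inChart e p (extChartAt (𝓡 7) p x) = Ψ.toFun x fun i => e i x := fun x hx => by
      rw [SpinorField.inChart, (extChartAt (𝓡 7) p).left_inv hx]
    have hc : ∀ z ∈ Metric.ball (extChartAt (𝓡 7) p p) r,
        Ψ.inChart e p z = Ψ.inChart e p (extChartAt (𝓡 7) p p) := fun z hz =>
      Metric.isOpen_ball.is_const_of_fderiv_eq_zero (𝕜 := ℝ) (convex_ball _ _).isPreconnected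
        (fun z hz => ((Ψ.contDiffAt_inChart hU (hB hz)).differentiableAt
          (by simp)).differentiableWithinAt)
        (fun z hz => hΨ.fderiv_inChart_eq_zero hcov hU he hc (hT U e hU) (hB hz)) hz
        (Metric.mem_ball_self hr)
    filter_upwards [extChartAt_source_mem_nhds (I := 𝓡 7) p, hU.isOpen.mem_nhds hpU,
      (continuousAt_extChartAt (I := 𝓡 7) p).preimage_mem_nhds (Metric.ball_mem_nhds _ hr)] with x hx hxU hxB
    rw [hfe x hxU, hfe p hpU, ← hchart x hx, ← hchart p (mem_extChartAt_source p), hc _ hxB]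
  obtain ⟨x₀⟩ : Nonempty M := inferInstance
  refine ⟨Ψ.toFun x₀ (f x₀) 0, ?_⟩
  ext1 x
  ext1 e
  rw [Pi.smul_apply, Pi.smul_apply]
  by_cases he : IsAdaptedFrame φ x e
  · rw [invariantSpinor_toFun he, Ψ.toFun_eq he (hf x) (hvec x _ (hf x)),
      hloc.apply_eq_of_preconnectedSpace x x₀, ← G2.spinorOf_zero_right,
      ← hvec x₀ _ (hf x₀), G2.spinorOf_vecOf]
  · rw [Ψ.eq_zero x e he, (invariantSpinor φ).eq_zero x e he, smul_zero]

end Spinors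

/-! ### Parallel transport in a local frame -/

namespace G2

variable {V : Type*} [NormedAddCommGroup V] [InnerProductSpace ℝ V]

/-- The endomorphism which is given by `Q` in the frame `e`. -/
def frameEnd (e : Fin 7 → V) (Q : (Fin 7 → ℝ) →L[ℝ] Fin 7 → ℝ) : V →L[ℝ] V :=
  ∑ i, ((ContinuousLinearMap.proj i ∘L Q) ∘L
    ContinuousLinearMap.pi fun j => innerSL ℝ (e j)).smulRight (e i)

theorem frameEnd_apply (e : Fin 7 → V) (Q : (Fin 7 → ℝ) →L[ℝ] Fin 7 → ℝ) (v : V) :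
    frameEnd e Q v = ∑ i, Q (coords e v) i • e i := by
  rw [frameEnd, sum_apply]
  rfl

/-- `frameEnd` as a continuous linear map. -/
def frameEndL (e : Fin 7 → V) : ((Fin 7 → ℝ) →L[ℝ] Fin 7 → ℝ) →L[ℝ] V →L[ℝ] V :=
  LinearMap.toContinuousLinearMap
    { toFun := frameEnd e
      map_add' := fun P Q => by
        ext1 v
        simp [frameEnd_apply, add_smul, Finset.sum_add_distrib]
      map_smul' := fun c Q => by
        ext1 v
        simp [frameEnd_apply, mul_smul, Finset.smul_sum] }

theorem contDiff_frameEnd (e : Fin 7 → V) {g : ℝ → (Fin 7 → ℝ) →L[ℝ] Fin 7 → ℝ}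
    (hg : ContDiff ℝ 1 g) : ContDiff ℝ 1 fun t => frameEnd e (g t) :=
  (frameEndL e).contDiff.comp hg

theorem hasDerivAt_frameEnd (e : Fin 7 → V) {g : ℝ → (Fin 7 → ℝ) →L[ℝ] Fin 7 → ℝ}
    {g' : (Fin 7 → ℝ) →L[ℝ] Fin 7 → ℝ} {t : ℝ} (hg : HasDerivAt g g' t) :
    HasDerivAt (fun t => frameEnd e (g t)) (frameEnd e g') t :=
  (frameEndL e).hasFDerivAt.comp_hasDerivAt t hg

end G2

section Transport

variable {M : Type*} [TopologicalSpace M] [ChartedSpace (EuclideanSpace ℝ (Fin 7)) M]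
  [IsManifold (𝓡 7) ∞ M] [RiemannianBundle (TangentSpace (𝓡 7) : M → Type _)]
  {φ : ∀ x : M, (TangentSpace (𝓡 7) x) [⋀^Fin 3]→L[ℝ] ℝ}
  {cov : CovariantDerivative (𝓡 7) (EuclideanSpace ℝ (Fin 7)) (TangentSpace (𝓡 7) : M → Type _)}

/-- The linear map between two tangent spaces which is given by `Q` in the frame `e`. -/
def frameMap (e : Fin 7 → ∀ x : M, TangentSpace (𝓡 7) x) (x y : M)
    (Q : (Fin 7 → ℝ) →L[ℝ] Fin 7 → ℝ) : TangentSpace (𝓡 7) x →L[ℝ] TangentSpace (𝓡 7) y :=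
  ∑ i, ((ContinuousLinearMap.proj i ∘L Q) ∘L
    ContinuousLinearMap.pi fun j => innerSL ℝ (e j x)).smulRight (e i y)

theorem frameMap_apply (e : Fin 7 → ∀ x : M, TangentSpace (𝓡 7) x) (x y : M)
    (Q : (Fin 7 → ℝ) →L[ℝ] Fin 7 → ℝ) (v : TangentSpace (𝓡 7) x) :
    frameMap e x y Q v = ∑ i, Q (frameCoords e x v) i • e i y := by
  rw [frameMap, sum_apply]
  rfl

variable {U : Set M} {e : Fin 7 → ∀ x : M, TangentSpace (𝓡 7) x}

theorem IsLocalAdaptedFrame.frameCoords_sum (hU : IsLocalAdaptedFrame φ U e) {x : M} (hx : x ∈ U)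
    (a : Fin 7 → ℝ) : frameCoords e x (∑ i, a i • e i x) = a :=
  G2.coords_sum_smul (hU.adapted x hx).1 a

theorem IsLocalAdaptedFrame.frameMap_comp (hU : IsLocalAdaptedFrame φ U e) {x y z : M} (hy : y ∈ U)
    (P Q : (Fin 7 → ℝ) →L[ℝ] Fin 7 → ℝ) :
    (frameMap e y z P).comp (frameMap e x y Q) = frameMap e x z (P ∘L Q) := by
  ext1 v
  refine (congrArg (frameMap e y z P) (frameMap_apply e x y Q v)).trans ?_
  refine (frameMap_apply e y z P _).trans ?_
  rw [hU.frameCoords_sum hy]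
  exact (frameMap_apply e x z (P ∘L Q) v).symm

theorem IsLocalAdaptedFrame.frameMap_id (hU : IsLocalAdaptedFrame φ U e) {x : M} (hx : x ∈ U) :
    frameMap e x x (ContinuousLinearMap.id ℝ _) = ContinuousLinearMap.id ℝ _ := by
  ext1 v
  exact (frameMap_apply e x x _ v).trans (hU.sum_smul hx v)

open Matrix in
theorem IsLocalAdaptedFrame.frameMatrix_frameMap (hU : IsLocalAdaptedFrame φ U e) {x : M}
    (hx : x ∈ U) (Q : (Fin 7 → ℝ) →L[ℝ] Fin 7 → ℝ) (j : Fin 7) :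
    frameMatrix (fun i => e i x) (frameMap e x x Q) *ᵥ Pi.single j 1 = Q (Pi.single j 1) := by
  rw [Matrix.mulVec_single_one, ← hU.frameCoords_self hx j]
  refine Eq.trans ?_ (hU.frameCoords_sum hx (Q (frameCoords e x (e j x))))
  exact congrArg (frameCoords e x) (frameMap_apply e x x Q (e j x))

variable {p : M}

/-- At a single point `frameMap` unfolds to `frameEnd`, whose dependence on the matrix is linear; a
curve of matrices thus yields a curve of endomorphisms of `T_p M`. -/
theorem frameMap_mem_holonomyAlgebra {g : ℝ → (Fin 7 → ℝ) →L[ℝ] Fin 7 → ℝ}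
    {g' : (Fin 7 → ℝ) →L[ℝ] Fin 7 → ℝ} (hg : ContDiff ℝ 1 g) (hg' : HasDerivAt g g' 0)
    (h0 : frameMap e p p (g 0) = ContinuousLinearMap.id ℝ _)
    (h1 : ∀ t, frameMap e p p (g t) ∈ holonomyGroup cov p) :
    frameMap e p p g' ∈ holonomyAlgebra cov p :=
  ⟨fun t => frameMap e p p (g t), G2.contDiff_frameEnd (fun i => e i p) hg, h0, h1,
    G2.hasDerivAt_frameEnd (fun i => e i p) hg'⟩

/-- The equation `a' = -W(σ') a` is parallelism in the frame; the frame itself and the coefficients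
`a` are the witnesses. -/
theorem IsLocalAdaptedFrame.hasCovDerivAlong_zero (hU : IsLocalAdaptedFrame φ U e)
    {σ : ℝ → EuclideanSpace ℝ (Fin 7)} {σ' : EuclideanSpace ℝ (Fin 7)} {a : ℝ → Fin 7 → ℝ} {t : ℝ}
    (hσ : HasDerivAt σ σ' t) (ht : σ t ∈ chartDomain p U)
    (ha : HasDerivAt a (-G2.mulVecL (chartConn cov e p σ' (σ t)) (a t)) t) :
    HasCovDerivAlong cov (fun t => (extChartAt (𝓡 7) p).symm (σ t))
      (fun t => ∑ i, a t i • e i ((extChartAt (𝓡 7) p).symm (σ t))) t 0 := by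
  refine ⟨e, fun i t => a t i, -G2.mulVecL (chartConn cov e p σ' (σ t)) (a t),
    fun i => (hU.smooth i).contMDiffAt (hU.isOpen.mem_nhds ht.2), hasDerivAt_pi.1 ha,
    .of_forall fun _ => rfl, ?_⟩
  rw [velocity_extChartAt_symm ht.1 hσ, Finset.sum_add_distrib]
  have h : ∀ j, cov (e j) ((extChartAt (𝓡 7) p).symm (σ t))
      (coordField p σ' ((extChartAt (𝓡 7) p).symm (σ t))) =
      ∑ i, chartConn cov e p σ' (σ t) i j • e i ((extChartAt (𝓡 7) p).symm (σ t)) := fun j =>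
    (hU.sum_smul ht.2 _).symm
  simp only [h, Finset.smul_sum]
  rw [Finset.sum_comm (f := fun x i => a t x • chartConn cov e p σ' (σ t) i x •
    e i ((extChartAt (𝓡 7) p).symm (σ t))), ← Finset.sum_add_distrib]
  symm
  refine Finset.sum_eq_zero fun i _ => ?_
  simp only [smul_smul, ← Finset.sum_smul, ← add_smul]
  have h0 : (-G2.mulVecL (chartConn cov e p σ' (σ t)) (a t)) i +
      ∑ j, a t j * chartConn cov e p σ' (σ t) i j = 0 := by
    rw [Pi.neg_apply, G2.mulVecL_apply, Matrix.mulVec, dotProduct, neg_add_eq_zero]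
    exact Finset.sum_congr rfl fun j _ => mul_comm _ _
  rw [h0, zero_smul]

/-- Parallel transport along a reparametrized curve in a chart. -/
theorem IsLocalAdaptedFrame.isTransport_frameMap (hU : IsLocalAdaptedFrame φ U e)
    {σ : ℝ → EuclideanSpace ℝ (Fin 7)} {σ' : ℝ → EuclideanSpace ℝ (Fin 7)} {f : ℝ → ℝ}
    (hσs : ContDiff ℝ ∞ σ) (hσ : ∀ t, HasDerivAt σ (σ' t) t)
    (hσU : ∀ t ∈ Set.Icc (0 : ℝ) 1, σ t ∈ chartDomain p U)
    (hf : ContDiff ℝ ∞ f) (hf01 : ∀ t, f t ∈ Set.Icc (0 : ℝ) 1) {Q : (Fin 7 → ℝ) →L[ℝ] Fin 7 → ℝ}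
    (hQ : ∀ ξ, ∃ w : ℝ → Fin 7 → ℝ, w (f 0) = ξ ∧ w (f 1) = Q ξ ∧ ∀ t ∈ Set.Icc (0 : ℝ) 1,
      HasDerivAt w (-G2.mulVecL (chartConn cov e p (σ' t) (σ t)) (w t)) t) {x y : M}
    (hx : (extChartAt (𝓡 7) p).symm (σ (f 0)) = x) (hy : (extChartAt (𝓡 7) p).symm (σ (f 1)) = y) :
    IsTransport cov x y (frameMap e x y Q) := by
  subst hx hy
  -- A transport curve must be smooth and its field parallel on all of `ℝ`, whereas the equation is
  -- solved on `[0, 1]` only. As `f` takes values there, `w ∘ f` is a solution at all times.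
  refine IsTransport.smooth (fun t => (extChartAt (𝓡 7) p).symm (σ (f t))) (fun t => ?_) _ fun v => ?_
  · exact ContMDiffAt.comp t (contMDiffAt_extChartAt_symm (hσU _ (hf01 t)).1)
      (hσs.comp hf).contMDiff.contMDiffAt
  · obtain ⟨w, h0, h1, hw⟩ := hQ (frameCoords e _ v)
    refine ⟨fun t => ∑ i, w (f t) i • e i ((extChartAt (𝓡 7) p).symm (σ (f t))), fun t => ?_, ?_, ?_⟩
    · have hft : HasDerivAt f (deriv f t) t := (hf.differentiable (by simp) t).hasDerivAt
      refine hU.hasCovDerivAlong_zero (σ := fun t => σ (f t)) (a := fun t => w (f t))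
        ((hσ (f t)).scomp t hft) (hσU _ (hf01 t)) ?_
      refine ((hw (f t) (hf01 t)).scomp t hft).congr_deriv ?_
      rw [chartConn_smul, map_smul, smul_neg]
      rfl
    · change ∑ i, w (f 0) i • e i ((extChartAt (𝓡 7) p).symm (σ (f 0))) = v
      rw [h0]
      exact hU.sum_smul (hσU _ (hf01 0)).2 v
    · change ∑ i, w (f 1) i • e i ((extChartAt (𝓡 7) p).symm (σ (f 1))) = _
      rw [h1]
      exact (frameMap_apply e _ _ Q v).symm

end Transport

/-! ### Holonomy and curvature -/

section Holonomy

/-- A cut-off: connection forms are smooth only over the chart domain, while `exists_propagator`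
asks for globally smooth coefficients. -/
theorem exists_contDiff_eventuallyEq {E F : Type*} [NormedAddCommGroup E] [NormedSpace ℝ E]
    [FiniteDimensional ℝ E] [HasContDiffBump E] [NormedAddCommGroup F] [NormedSpace ℝ F]
    {W : E → F} {O : Set E} {y : E}
    (hO : IsOpen O) (hy : y ∈ O) (hW : ∀ z ∈ O, ContDiffAt ℝ ∞ W z) :
    ∃ W' : E → F, ContDiff ℝ ∞ W' ∧ W' =ᶠ[𝓝 y] W := by
  obtain ⟨r, hr, hrO⟩ := Metric.nhds_basis_closedBall.mem_iff.1 (hO.mem_nhds hy)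
  let f : ContDiffBump y := ⟨r / 2, r, by positivity, by linarith⟩
  refine ⟨fun z => f z • W z, contDiff_iff_contDiffAt.2 fun z => ?_, ?_⟩
  · by_cases hz : z ∈ O
    · exact f.contDiff.contDiffAt.smul (hW z hz)
    · have hz' : z ∉ tsupport f := by
        rw [f.tsupport_eq]
        exact fun h => hz (hrO h)
      refine (contDiffAt_const (c := (0 : F))).congr_of_eventuallyEq ?_
      filter_upwards [notMem_tsupport_iff_eventuallyEq.1 hz'] with x hx
      rw [hx, Pi.zero_apply, zero_smul]
  · filter_upwards [f.eventuallyEq_one] with x hx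
    rw [hx, Pi.one_apply, one_smul]

namespace ParametricODE

variable {E : Type} [NormedAddCommGroup E] [NormedSpace ℝ E]

theorem sigma_zero_right (y u v : E) (s ε : ℝ) : sigma y u v s ε 0 = y := by simp [sigma]

/-- The end point does not involve `ε`, so one can return along the path with `ε = 0` and close up a
loop. -/
theorem sigma_one_right (y u v : E) (s ε : ℝ) : sigma y u v s ε 1 = y + s • u := by simp [sigma]

theorem contDiff_sigma (y u v : E) (s ε : ℝ) : ContDiff ℝ ∞ (sigma y u v s ε) := by
  unfold sigma
  fun_prop

theorem hasDerivAt_sigma (y u v : E) (s ε τ : ℝ) :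
    HasDerivAt (sigma y u v s ε) (s • u + (ε * (1 - 2 * τ)) • v) τ := by
  have h1 : HasDerivAt (fun τ : ℝ => s * τ) s τ := by
    simpa using (hasDerivAt_id τ).const_mul s
  have h2 : HasDerivAt (fun τ : ℝ => ε * (τ - τ ^ 2)) (ε * (1 - 2 * τ)) τ := by
    simpa using ((hasDerivAt_id τ).fun_sub (hasDerivAt_pow 2 τ)).const_mul ε
  exact ((h1.smul_const u).const_add y).fun_add (h2.smul_const v)

theorem exists_sigma_mem_ball (y u v : E) {r : ℝ} (hr : 0 < r) : ∃ η > 0, ∀ s ε τ : ℝ, |s| < η →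
    |ε| < η → τ ∈ Set.Icc (0 : ℝ) 1 → sigma y u v s ε τ ∈ Metric.ball y r := by
  have hpos : 0 < ‖u‖ + ‖v‖ + 1 := by positivity
  refine ⟨r / (‖u‖ + ‖v‖ + 1), by positivity, fun s ε τ hs hε hτ => ?_⟩
  have h0 : sigma y u v s ε τ - y = (s * τ) • u + (ε * (τ - τ ^ 2)) • v := by
    rw [sigma]; abel
  have h1 : |τ| ≤ 1 := abs_le.2 ⟨by linarith [hτ.1], hτ.2⟩
  have h2 : |τ - τ ^ 2| ≤ 1 := abs_le.2 ⟨by nlinarith [hτ.1, hτ.2], by nlinarith [hτ.1, hτ.2]⟩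
  rw [mem_ball_iff_norm, h0]
  have h3 : ‖(s * τ) • u‖ ≤ r / (‖u‖ + ‖v‖ + 1) * ‖u‖ := by
    rw [norm_smul, Real.norm_eq_abs, abs_mul]
    gcongr
    nlinarith [abs_nonneg s, abs_nonneg τ]
  have h4 : ‖(ε * (τ - τ ^ 2)) • v‖ ≤ r / (‖u‖ + ‖v‖ + 1) * ‖v‖ := by
    rw [norm_smul, Real.norm_eq_abs, abs_mul]
    gcongr
    nlinarith [abs_nonneg ε, abs_nonneg (τ - τ ^ 2)]
  have h5 : r / (‖u‖ + ‖v‖ + 1) * (‖u‖ + ‖v‖ + 1) = r := div_mul_cancel₀ _ hpos.ne'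
  have h6 : 0 < r / (‖u‖ + ‖v‖ + 1) := by positivity
  linarith [norm_add_le ((s * τ) • u) ((ε * (τ - τ ^ 2)) • v)]

end ParametricODE

open ParametricODE

variable {M : Type*} [TopologicalSpace M] [ChartedSpace (EuclideanSpace ℝ (Fin 7)) M]
  [IsManifold (𝓡 7) ∞ M] [RiemannianBundle (TangentSpace (𝓡 7) : M → Type _)]
  {φ : ∀ x : M, (TangentSpace (𝓡 7) x) [⋀^Fin 3]→L[ℝ] ℝ}
  {cov : CovariantDerivative (𝓡 7) (EuclideanSpace ℝ (Fin 7)) (TangentSpace (𝓡 7) : M → Type _)}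
  {U : Set M} {e : Fin 7 → ∀ x : M, TangentSpace (𝓡 7) x} {p : M}

/-- Transport along the curve `sigma`, if its coefficients agree with the connection. -/
theorem IsLocalAdaptedFrame.isTransport_sigma (hU : IsLocalAdaptedFrame φ U e)
    {y u v : EuclideanSpace ℝ (Fin 7)} {Wu Wv : EuclideanSpace ℝ (Fin 7) → Fin 7 → Fin 7 → ℝ}
    {s ε : ℝ} (hσ : ∀ τ ∈ Set.Icc (0 : ℝ) 1, sigma y u v s ε τ ∈ chartDomain p U ∧
      Wu (sigma y u v s ε τ) = chartConn cov e p u (sigma y u v s ε τ) ∧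
      Wv (sigma y u v s ε τ) = chartConn cov e p v (sigma y u v s ε τ))
    {f : ℝ → ℝ} (hf : ContDiff ℝ ∞ f) (hf01 : ∀ t, f t ∈ Set.Icc (0 : ℝ) 1)
    {Q : (Fin 7 → ℝ) →L[ℝ] Fin 7 → ℝ}
    (hQ : ∀ ξ, ∃ w : ℝ → Fin 7 → ℝ, w (f 0) = ξ ∧ w (f 1) = Q ξ ∧ ∀ t ∈ Set.Icc (0 : ℝ) 1,
      HasDerivAt w (G2.mulVecL (loopCoeff Wu Wv y u v ((s, ε), t)) (w t)) t) {x z : M}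
    (hx : (extChartAt (𝓡 7) p).symm (sigma y u v s ε (f 0)) = x)
    (hz : (extChartAt (𝓡 7) p).symm (sigma y u v s ε (f 1)) = z) :
    IsTransport cov x z (frameMap e x z Q) := by
  refine hU.isTransport_frameMap (contDiff_sigma y u v s ε) (hasDerivAt_sigma y u v s ε)
    (fun τ hτ => (hσ τ hτ).1) hf hf01 (fun ξ => ?_) hx hz
  obtain ⟨w, h0, h1, hw⟩ := hQ ξ
  refine ⟨w, h0, h1, fun τ hτ => (hw τ hτ).congr_deriv ?_⟩
  rw [loopCoeff, (hσ τ hτ).2.1, (hσ τ hτ).2.2, chartConn_add, chartConn_smul, chartConn_smul,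
    map_neg]
  rfl

/-- The velocity of a smooth curve of holonomies given in a frame. -/
theorem IsLocalAdaptedFrame.mem_holonomyAlgebra (hU : IsLocalAdaptedFrame φ U e) (hp : p ∈ U)
    {η : ℝ} (hη : 0 < η) {G : ℝ → (Fin 7 → ℝ) →L[ℝ] Fin 7 → ℝ} {R : (Fin 7 → ℝ) →L[ℝ] Fin 7 → ℝ}
    (hG : ∀ ε, |ε| < η → ContDiffAt ℝ ∞ G ε) (hRG : R ∘L G 0 = ContinuousLinearMap.id ℝ _)
    (hloop : ∀ ε, |ε| < η → frameMap e p p (R ∘L G ε) ∈ holonomyGroup cov p) :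
    frameMap e p p (R ∘L ((η / 2) • deriv G 0)) ∈ holonomyAlgebra cov p := by
  -- The holonomy algebra is defined by curves on all of `ℝ`. The parameter `ε = (η/2) sin t` stays
  -- in the admissible range and has velocity `η/2` at `0`.
  have hsin : ∀ t, |η / 2 * Real.sin t| < η := fun t => by
    rw [abs_mul, abs_of_pos (by positivity)]
    nlinarith [Real.abs_sin_le_one t]
  have hG0 : HasDerivAt G (deriv G 0) 0 :=
    ((hG 0 (by simpa using hη)).differentiableAt (by simp)).hasDerivAt
  have hsin' : HasDerivAt (fun t => η / 2 * Real.sin t) (η / 2) 0 := by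
    simpa using (Real.hasDerivAt_sin 0).const_mul (η / 2)
  have hder : HasDerivAt (fun t => G (η / 2 * Real.sin t)) ((η / 2) • deriv G 0) 0 :=
    HasDerivAt.scomp_of_eq (h := fun t => η / 2 * Real.sin t) 0 hG0 hsin' (by simp)
  refine frameMap_mem_holonomyAlgebra (g := fun t => R ∘L G (η / 2 * Real.sin t)) ?_ ?_ ?_
    fun t => hloop _ (hsin t)
  · refine contDiff_const.clm_comp (contDiff_iff_contDiffAt.2 fun t => ?_)
    exact ((hG _ (hsin t)).of_le (by norm_cast)).comp t
      (contDiffAt_const.mul Real.contDiff_sin.contDiffAt)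
  · exact (ContinuousLinearMap.compL ℝ (Fin 7 → ℝ) (Fin 7 → ℝ) (Fin 7 → ℝ)
      R).hasFDerivAt.comp_hasDerivAt 0 hder
  · rw [Real.sin_zero, mul_zero, hRG, hU.frameMap_id hp]

/-- The holonomies of the loops which run along `sigma` for the parameters `(s, ε)` and back for the
parameters `(s, 0)`. -/
theorem IsLocalAdaptedFrame.loop_mem_holonomyGroup (hU : IsLocalAdaptedFrame φ U e)
    {u v : EuclideanSpace ℝ (Fin 7)} {Wu Wv : EuclideanSpace ℝ (Fin 7) → Fin 7 → Fin 7 → ℝ}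
    {s ε : ℝ} (hσ : ∀ a, a = ε ∨ a = 0 → ∀ τ ∈ Set.Icc (0 : ℝ) 1,
      sigma (extChartAt (𝓡 7) p p) u v s a τ ∈ chartDomain p U ∧
      Wu (sigma (extChartAt (𝓡 7) p p) u v s a τ) =
        chartConn cov e p u (sigma (extChartAt (𝓡 7) p p) u v s a τ) ∧
      Wv (sigma (extChartAt (𝓡 7) p p) u v s a τ) =
        chartConn cov e p v (sigma (extChartAt (𝓡 7) p p) u v s a τ))
    {G : ℝ → (Fin 7 → ℝ) →L[ℝ] Fin 7 → ℝ} {R : (Fin 7 → ℝ) →L[ℝ] Fin 7 → ℝ}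
    (hG : ∀ a, a = ε ∨ a = 0 → ∀ ξ, ∃ w : ℝ → Fin 7 → ℝ, w 0 = ξ ∧ w 1 = G a ξ ∧
      ∀ t ∈ Set.Icc (0 : ℝ) 1, HasDerivAt w
        (G2.mulVecL (loopCoeff Wu Wv (extChartAt (𝓡 7) p p) u v ((s, a), t)) (w t)) t)
    (hGR : G 0 ∘L R = ContinuousLinearMap.id ℝ _) :
    frameMap e p p (R ∘L G ε) ∈ holonomyGroup cov p := by
  have hp0 : (extChartAt (𝓡 7) p).symm (extChartAt (𝓡 7) p p) = p := extChartAt_to_inv p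
  set q := (extChartAt (𝓡 7) p).symm (extChartAt (𝓡 7) p p + s • u) with hq
  have hqU : q ∈ U := by
    have := (hσ ε (.inl rfl) 1 (by simp)).1.2
    rwa [sigma_one_right] at this
  -- A smooth reparametrisation from `0` to `1` with values in `[0, 1]`; its complement `1 - f`
  -- traverses the return path.
  have hst := Real.smoothTransition.contDiff (n := ⊤)
  have hst01 : ∀ t, Real.smoothTransition t ∈ Set.Icc (0 : ℝ) 1 := fun t =>
    ⟨Real.smoothTransition.nonneg t, Real.smoothTransition.le_one t⟩
  have hforward : IsTransport cov p q (frameMap e p q (G ε)) :=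
    hU.isTransport_sigma (hσ ε (.inl rfl)) hst hst01 (fun ξ => by
      rw [Real.smoothTransition.zero, Real.smoothTransition.one]
      exact hG ε (.inl rfl) ξ)
      (by rw [Real.smoothTransition.zero, sigma_zero_right, hp0])
      (by rw [Real.smoothTransition.one, sigma_one_right])
  have hback : IsTransport cov q p (frameMap e q p R) :=
    hU.isTransport_sigma (f := fun t => 1 - Real.smoothTransition t) (hσ 0 (.inr rfl))
      (contDiff_const.sub hst) (fun t => ⟨by linarith [(hst01 t).2], by linarith [(hst01 t).1]⟩)
      (fun ξ => by
        -- Backward transport of `ξ`: the solution starting at `R ξ` arrives at `G 0 (R ξ) = ξ`.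
        obtain ⟨w, h0, h1, hw⟩ := hG 0 (.inr rfl) (R ξ)
        refine ⟨w, ?_, ?_, hw⟩
        · simp only [Real.smoothTransition.zero, sub_zero, h1]
          exact congrArg (fun T => T ξ) hGR
        · simp only [Real.smoothTransition.one, sub_self, h0])
      (by simp only [Real.smoothTransition.zero, sub_zero, sigma_one_right, hq])
      (by simp only [Real.smoothTransition.one, sub_self, sigma_zero_right, hp0])
  rw [← hU.frameMap_comp hqU]
  exact IsTransport.trans _ _ _ _ _ hforward hback

variable [IsContMDiffRiemannianBundle (𝓡 7) ∞ (EuclideanSpace ℝ (Fin 7))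
      (TangentSpace (𝓡 7) : M → Type _)]

/-- For fixed small `s`, the loops through `sigma` have holonomy `G(s, 0)⁻¹ G(s, ε)`; its
`ε`-derivative belongs, up to a positive factor, to the holonomy algebra and so annihilates `e_j`.
Since this holds for all small `s`, `exists_propagator` returns the vanishing of the curvature. -/
theorem IsLocalAdaptedFrame.curv_eq_zero_of_holonomyAlgebra (hU : IsLocalAdaptedFrame φ U e)
    (hcov : CovariantDerivative.ContMDiffCovariantDerivative cov ∞)
    (he : ∀ i, ContMDiff (𝓡 7) (𝓡 7).tangent ∞
        (fun x => (⟨x, e i x⟩ : TangentBundle (𝓡 7) M))) (hp : p ∈ U) {j : Fin 7}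
    (hol : ∀ A ∈ holonomyAlgebra cov p,
      (frameMatrix (fun i => e i p) A).mulVec (Pi.single j 1) = 0)
    (u v : EuclideanSpace ℝ (Fin 7)) :
    G2.curv (chartConn cov e p) u v (extChartAt (𝓡 7) p p) (Pi.single j 1) = 0 := by
  set y := extChartAt (𝓡 7) p p with hy
  have hO := isOpen_chartDomain p hU.isOpen
  have hyO : y ∈ chartDomain p U := mem_chartDomain_self hp
  obtain ⟨Wu, hWu, hWu'⟩ := exists_contDiff_eventuallyEq hO hyO
    fun z hz => contDiffAt_chartConn (e := e) hcov he hz.1 u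
  obtain ⟨Wv, hWv, hWv'⟩ := exists_contDiff_eventuallyEq hO hyO
    fun z hz => contDiffAt_chartConn (e := e) hcov he hz.1 v
  obtain ⟨δ, hδ, G, hsol, hunit, hsm, hcurv⟩ := exists_propagator y u v G2.mulVecL hWu hWv
  have hev : ∀ᶠ z in 𝓝 y, z ∈ chartDomain p U ∧ Wu z = chartConn cov e p u z ∧
      Wv z = chartConn cov e p v z :=
    Filter.Eventually.and (hO.mem_nhds hyO) (hWu'.and hWv')
  obtain ⟨r, hr, hball⟩ := Metric.eventually_nhds_iff_ball.1 hev
  obtain ⟨η', hη', hmem⟩ := exists_sigma_mem_ball y u v hr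
  set η := min δ η' with hη
  have hηpos : 0 < η := lt_min hδ hη'
  have key := hcurv (Pi.single j 1) (by
    filter_upwards [Metric.ball_mem_nhds (0 : ℝ) hηpos] with s hs
    have hs : |s| < η := by simpa using hs
    have hsδ := hs.trans_le (min_le_left _ _)
    have habs : ∀ ε, |ε| < η → ∀ a, a = ε ∨ a = 0 → |a| < η := by
      rintro ε hε a (rfl | rfl)
      exacts [hε, by simpa using hηpos]
    have hσ := fun (ε : ℝ) (hε : |ε| < η) (τ : ℝ) (hτ : τ ∈ Set.Icc (0 : ℝ) 1) =>
      hball _ (hmem s ε τ (hs.trans_le (min_le_right _ _)) (hε.trans_le (min_le_right _ _)) hτ)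
    obtain ⟨g, hg⟩ := hunit s hsδ
    set R : (Fin 7 → ℝ) →L[ℝ] Fin 7 → ℝ := ↑g⁻¹ with hR
    have hRG : R ∘L G s 0 = ContinuousLinearMap.id ℝ _ := by
      rw [← hg]; exact g.inv_mul
    have hGR : G s 0 ∘L R = ContinuousLinearMap.id ℝ _ := by
      rw [← hg]; exact g.mul_inv
    have hA := hol _ (hU.mem_holonomyAlgebra hp hηpos
      (fun ε hε => hsm s ε hsδ (hε.trans_le (min_le_left _ _))) hRG fun ε hε =>
        hU.loop_mem_holonomyGroup (fun a ha => hσ a (habs ε hε a ha))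
          (fun a ha => hsol s a hsδ ((habs ε hε a ha).trans_le (min_le_left _ _))) hGR)
    have h1 := (hU.frameMatrix_frameMap hp (R ∘L ((η / 2) • deriv (G s) 0)) j).symm.trans hA
    -- Applying `G s 0` undoes the return transport `R`, leaving the derivative of the propagator
    -- alone.
    have h2 := congrArg (G s 0) h1
    rw [map_zero] at h2
    have h3 : (η / 2) • deriv (G s) 0 (Pi.single j 1) = 0 :=
      (congrArg (fun T => T ((η / 2) • deriv (G s) 0 (Pi.single j 1))) hGR).symm.trans h2
    exact (smul_eq_zero.1 h3).resolve_left (by positivity))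
  -- The cut-off coefficients agree with the connection form near `y`, so they have the same value
  -- and derivative there.
  rw [hWu'.fderiv_eq, hWv'.fderiv_eq, hWu'.self_of_nhds, hWv'.self_of_nhds] at key
  exact key

end Holonomy

end

/-! ### The main theorem -/

theorem mainTheorem1 {M : Type*} [TopologicalSpace M] [T2Space M] [SecondCountableTopology M]
    [ConnectedSpace M] [ChartedSpace (EuclideanSpace ℝ (Fin 7)) M] [IsManifold (𝓡 7) ∞ M]
    [RiemannianBundle (TangentSpace (𝓡 7) : M → Type _)]
    [IsContMDiffRiemannianBundle (𝓡 7) ∞ (EuclideanSpace ℝ (Fin 7))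
      (TangentSpace (𝓡 7) : M → Type _)]
    (φ : ∀ x : M, (TangentSpace (𝓡 7) x) [⋀^Fin 3]→L[ℝ] ℝ) (hφ : IsG2Structure φ)
    (hnp : IsNearlyParallel φ)
    (cov : CovariantDerivative (𝓡 7) (EuclideanSpace ℝ (Fin 7))
      (TangentSpace (𝓡 7) : M → Type _))
    (hcov : IsCharacteristicConnection φ cov)
    (hT : torsionForm cov ≠ 0) :
    (∀ (p : M) (e : Fin 7 → TangentSpace (𝓡 7) p), IsAdaptedFrame φ p e →
      ¬ ∀ A ∈ holonomyAlgebra cov p, frameMatrix e A ∈ G2.su3) ∧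
    ∃ Ψ : SpinorField φ, Ψ.IsParallel cov ∧ Ψ.toFun ≠ 0 ∧
      ∀ Ψ' : SpinorField φ, Ψ'.IsParallel cov → ∃ a : ℝ, Ψ'.toFun = a • Ψ.toFun := by
  obtain ⟨c, hc, htor⟩ := hcov.exists_torsion_eq hφ hnp hT
  refine ⟨fun p e₀ he₀ hol => ?_, invariantSpinor φ, hcov.isParallel_invariantSpinor,
    fun h0 => ?_, fun Ψ hΨ => hΨ.eq_smul_invariantSpinor hφ hcov hc htor⟩
  · obtain ⟨U, e, hpU, hep, hU, he⟩ := exists_isLocalAdaptedFrame hφ he₀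
    obtain rfl : (fun i => e i p) = e₀ := funext hep
    -- Holonomy in `𝔰𝔲(3)` would annihilate `e₇` (index 6), so the curvature would too, forcing `e₇
    -- = 0`.
    have h := hcov.eq_zero_of_curv_eq_zero hU he hc (htor U e hU) (mem_chartDomain_self hpU)
      (hU.curv_eq_zero_of_holonomyAlgebra hcov.smooth he hpU fun A hA =>
        G2.mulVec_single_eq_zero_of_mem_su3 (hol A hA))
    simpa using congrFun h 6
  · obtain ⟨x⟩ : Nonempty M := inferInstance
    obtain ⟨e, he⟩ := hφ.exists_adaptedFrame x
    have h := congrFun (congrFun (congrFun h0 x) e) 0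
    rw [invariantSpinor_toFun he] at h
    simp [G2.basisSpinor] at h
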